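/- For $k\ge 0$ let $L^1_k$ be the space of (classes of) measurable functions $u:(0,\infty)\to\mathbb R$ with $\|u\|_{L^1_k}:=\int_0^\infty |u(x)|(1+x)^k\,dx<\infty$. Let $\mathcal W$ be the set of continuous functions $W:(0,\infty)^2\to[0,1]$ that are symmetric, $W(x,y)=W(y,x)$, and homogeneous of degree zero, $W(\lambda x,\lambda y)=W(x,y)$ for all $\lambda,x,y>0$. For $\varepsilon\ge 0$ and $W\in\mathcal W$ put $K_\varepsilon:=2+\varepsilon W$ and $$\mathcal C_\varepsilon(u,u)(x):=\tfrac12\int_0^x K_\varepsilon(x-y,y)u(x-y)u(y)\,dy-u(x)\int_0^\infty K_\varepsilon(x,y)u(y)\,dy,\qquad (S_tu)(x):=e^{2t}u(e^tx).$$ For $k\ge1$ and $f_0\in L^1_k$, a solution in $L^1_k$ of the self-similar Smoluchowski equation $\partial_tf=\mathcal C_\varepsilon(f,f)+2f+x\,\partial_xf$ with initial condition $f_0$ is a function $f\in C([0,\infty),L^1_k)$ such that $f(t)=S_tf_0+\int_0^tS_{t-s}\,\mathcal C_\varepsilon(f(s),f(s))\,ds$ for all $t\ge0$. A self-similar profile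 with mass $1$ for $K_\varepsilon$ is a function $G\in L^1_1$ with $G\ge0$ almost everywhere and $\int_0^\infty xG(x)\,dx=1$ such that the constant function $t\mapsto G$ is a solution in $L^1_1$. **Proposition 8.1.** There is $\varepsilon_1>0$ such that for all $W\in\mathcal W$ and $0\le\varepsilon\le\varepsilon_1$ there is exactly one self-similar profile $G_\varepsilon$ with mass $1$ for the kernel $K_\varepsilon$; and for every $k>2$ there are constants $C_*,M,r_1>0$ and $0<\varepsilon_2<\varepsilon_1$, depending only on $k$, with the following property. For all $W\in\mathcal W$ and all $0\le\varepsilon\le\varepsilon_2$ one has $G_\varepsilon\in L^1_k$, and every solution $f$ in $L^1_k$ of the self-similar Smoluchowski equation with kernel $K_\varepsilon$ whose initial condition $f_0\in L^1_k$ satisfies $$\int_0^\infty xf_0(x)\,dx=1,\qquad \|f_0-G_\varepsilon\|_{L^1_k}\le r_1$$ satisfies $$\|f(t,\cdot)-G_\varepsilon\|_{L^1_k}\le C_*\,e^{-(\frac12-M\varepsilon)t}\,\|f_0-G_\varepsilon\|_{L^1_k}\qquad\text{for all }t\ge0.$$ -/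

import Mathlib

open MeasureTheory Set

namespace Smoluchowski

noncomputable section

/-- The measure `(1 + x)^k dx` on the half-line `(0, ∞)`. -/
def weightMeasure (k : ℝ) : Measure ℝ :=
  (volume.restrict (Ioi 0)).withDensity fun x => ENNReal.ofReal ((1 + x) ^ k)

/-- The Banach space `L¹_k = L¹((0, ∞); (1 + x)^k dx)`. -/
abbrev L1 (k : ℝ) : Type := Lp ℝ 1 (weightMeasure k)

/-- The norm of `L¹_k`, written on functions. -/
def norm1 (k : ℝ) (u : ℝ → ℝ) : ℝ := ∫ x in Ioi 0, |u x| * (1 + x) ^ k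

/-- The first moment, or total mass, `∫₀^∞ x u(x) dx`. -/
def mass (u : ℝ → ℝ) : ℝ := ∫ x in Ioi 0, x * u x

open Classical in
/-- The class in `L¹_k` of a function that belongs to this space (and `0` for other functions;
by `memLp_coag` and `memLp_dilate` below the second case does not occur in what follows). -/
def toL1 (k : ℝ) (u : ℝ → ℝ) : L1 k :=
  if h : MemLp u 1 (weightMeasure k) then h.toLp u else 0

/-- The hypotheses on the perturbation `W : (0, ∞) × (0, ∞) → ℝ`: continuous, symmetric, with values
in `[0, 1]`, homogeneous of degree zero. -/
structure Admissible (W : ℝ → ℝ → ℝ) : Prop where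
  continuousOn : ContinuousOn (Function.uncurry W) (Ioi 0 ×ˢ Ioi 0)
  symm : ∀ x y, 0 < x → 0 < y → W x y = W y x
  nonneg : ∀ x y, 0 < x → 0 < y → 0 ≤ W x y
  le_one : ∀ x y, 0 < x → 0 < y → W x y ≤ 1
  homogeneous : ∀ c x y, 0 < c → 0 < x → 0 < y → W (c * x) (c * y) = W x y

/-- The coagulation kernel `K_ε = 2 + ε W`. -/
def kernel (ε : ℝ) (W : ℝ → ℝ → ℝ) (x y : ℝ) : ℝ := 2 + ε * W x y

/-- Smoluchowski's coagulation operator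
`C_K(u, u)(x) = ½ ∫₀^x K(x - y, y) u(x - y) u(y) dy - u(x) ∫₀^∞ K(x, y) u(y) dy`. -/
def coag (K : ℝ → ℝ → ℝ) (u : ℝ → ℝ) (x : ℝ) : ℝ :=
  1 / 2 * (∫ y in (0 : ℝ)..x, K (x - y) y * u (x - y) * u y) - u x * ∫ y in Ioi 0, K x y * u y

/-- `(S_t u)(x) = e^{2t} u(e^t x)`, the semigroup generated by `u ↦ 2 u + x u'`. -/
def dilate (t : ℝ) (u : ℝ → ℝ) (x : ℝ) : ℝ := Real.exp (2 * t) * u (Real.exp t * x)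

/-- The coagulation operator on `L¹_k`. -/
def coagL1 (k : ℝ) (K : ℝ → ℝ → ℝ) (u : L1 k) : L1 k := toL1 k (coag K u)

/-- The semigroup `S_t` on `L¹_k`, for `t ≥ 0`. -/
def dilateL1 (k t : ℝ) (u : L1 k) : L1 k := toL1 k (dilate t u)

/-- `f ∈ C([0, ∞), L¹_k)` is a (mild) solution, with initial condition `f₀`, of the self-similar
Smoluchowski equation `∂ₜ f = C_K(f, f) + 2 f + x ∂ₓ f`:
`f(t) = S_t f₀ + ∫₀^t S_{t-s} C_K(f(s), f(s)) ds` for all `t ≥ 0`, with a Bochner integral in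
`L¹_k`. Only the values `f t` with `t ≥ 0` matter. -/
structure IsMildSolution (k : ℝ) (K : ℝ → ℝ → ℝ) (f₀ : L1 k) (f : ℝ → L1 k) : Prop where
  continuousOn : ContinuousOn f (Ici 0)
  duhamel : ∀ t, 0 ≤ t →
    f t = dilateL1 k t f₀ + ∫ s in (0 : ℝ)..t, dilateL1 k (t - s) (coagL1 k K (f s))

/-- `G` is a self-similar profile of unit mass for the kernel `K`: a nonnegative element of `L¹_1`
of mass `1` that is a stationary solution of the self-similar Smoluchowski equation. -/
structure IsUnitProfile (K : ℝ → ℝ → ℝ) (G : L1 1) : Prop where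
  nonneg : ∀ᵐ x ∂volume.restrict (Ioi 0), 0 ≤ G x
  mass_eq_one : mass G = 1
  stationary : IsMildSolution 1 K G fun _ => G

/-! Both operators map `L¹_k` to itself. -/

theorem memLp_iff (k : ℝ) (u : ℝ → ℝ) :
    MemLp u 1 (weightMeasure k) ↔ IntegrableOn (fun x => (1 + x) ^ k * u x) (Ioi 0) := by
  rw [memLp_one_iff_integrable, weightMeasure,
    integrable_withDensity_iff_integrable_smul' (by fun_prop) (by simp)]
  refine integrableOn_congr_fun (fun x hx => ?_) measurableSet_Ioi
  have hx : 0 < x := hx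
  simp only [smul_eq_mul]
  rw [ENNReal.toReal_ofReal (by positivity)]

theorem memLp_dilate {k t : ℝ} (hk : 0 ≤ k) (ht : 0 ≤ t) {u : ℝ → ℝ}
    (hu : MemLp u 1 (weightMeasure k)) : MemLp (dilate t u) 1 (weightMeasure k) := by
  rw [memLp_iff] at hu ⊢
  have h1 := (integrableOn_Ioi_comp_mul_left_iff
    (fun x => (1 + x) ^ k * u x) 0 (Real.exp_pos t)).2 (by simpa using hu)
  have h2 := h1.const_mul (Real.exp (2 * t))
  have hm : AEStronglyMeasurable (fun x => (1 + x) ^ k * dilate t u x)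
      (volume.restrict (Ioi 0)) := by
    have h3 : AEStronglyMeasurable (fun x : ℝ => ((1 + x) ^ k / (1 + Real.exp t * x) ^ k) *
        (Real.exp (2 * t) * ((1 + Real.exp t * x) ^ k * u (Real.exp t * x))))
        (volume.restrict (Ioi 0)) :=
      (Measurable.aestronglyMeasurable (by fun_prop)).mul h2.aestronglyMeasurable
    refine h3.congr ?_
    filter_upwards [ae_restrict_mem measurableSet_Ioi] with x hx
    have hx : 0 < x := hx
    have : (1 + Real.exp t * x) ^ k ≠ 0 := by positivity
    simp only [dilate]
    field_simp
  refine h2.mono hm ?_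
  filter_upwards [ae_restrict_mem measurableSet_Ioi] with x hx
  have hx : 0 < x := hx
  have he : 1 ≤ Real.exp t := Real.one_le_exp ht
  have h4 : (1 + x) ^ k ≤ (1 + Real.exp t * x) ^ k := by
    apply Real.rpow_le_rpow (by positivity) _ hk
    nlinarith
  simp only [dilate, norm_mul, Real.norm_eq_abs, Real.abs_exp]
  rw [abs_of_nonneg (by positivity : (0 : ℝ) ≤ (1 + x) ^ k),
    abs_of_nonneg (by positivity : (0 : ℝ) ≤ (1 + Real.exp t * x) ^ k)]
  calc _ = (1 + x) ^ k * (Real.exp (2 * t) * |u (Real.exp t * x)|) := by ring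
    _ ≤ (1 + Real.exp t * x) ^ k * (Real.exp (2 * t) * |u (Real.exp t * x)|) := by gcongr
    _ = _ := by ring

theorem memLp_coag {k ε : ℝ} (hk : 0 ≤ k) (hε : 0 ≤ ε) {W : ℝ → ℝ → ℝ} (hW : Admissible W)
    {u : ℝ → ℝ} (hu : MemLp u 1 (weightMeasure k)) :
    MemLp (coag (kernel ε W) u) 1 (weightMeasure k) := by
  rw [memLp_iff] at hu ⊢
  -- the kernel, the weight and the weighted function, extended by zero
  set Q : Set (ℝ × ℝ) := Ioi 0 ×ˢ Ioi 0 with hQ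
  have hQm : MeasurableSet Q := measurableSet_Ioi.prod measurableSet_Ioi
  set L : ℝ × ℝ → ℝ := Q.indicator (Function.uncurry (kernel ε W)) with hL
  have hLm : Measurable L := by
    have hc : ContinuousOn (Function.uncurry (kernel ε W)) Q :=
      continuousOn_const.add (continuousOn_const.mul hW.continuousOn)
    have := hc.measurable_piecewise (continuousOn_const (c := (0 : ℝ))) hQm
    have h0 : Q.piecewise (Function.uncurry (kernel ε W)) (fun _ => (0 : ℝ)) = L :=
      Set.piecewise_eq_indicator
    rwa [h0] at this
  have hLQ : ∀ x y, 0 < x → 0 < y → L (x, y) = kernel ε W x y := by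
    intro x y hx hy
    have : ((x, y) : ℝ × ℝ) ∈ Q := ⟨hx, hy⟩
    simp [hL, this]
  have hLb : ∀ p, ‖L p‖ ≤ 2 + ε := by
    rintro ⟨x, y⟩
    by_cases h : ((x, y) : ℝ × ℝ) ∈ Q
    · have hx : 0 < x := h.1
      have hy : 0 < y := h.2
      rw [hLQ x y hx hy, kernel, Real.norm_eq_abs]
      have h0 := hW.nonneg x y hx hy
      have h1 := hW.le_one x y hx hy
      rw [abs_of_nonneg (by positivity)]
      nlinarith
    · simp only [hL, Set.indicator_of_notMem h, norm_zero]
      positivity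
  set w : ℝ → ℝ := (Ioi (0 : ℝ)).indicator (fun x => (1 + x) ^ k * u x) with hw
  have hwi : Integrable w := (integrable_indicator_iff measurableSet_Ioi).2 hu
  set v : ℝ → ℝ := (Ioi (0 : ℝ)).indicator u with hv
  have hwv : ∀ x, v x = ((1 + x) ^ k)⁻¹ * w x := by
    intro x
    by_cases h : x ∈ Ioi (0 : ℝ)
    · have hx : 0 < x := h
      have : (1 + x) ^ k ≠ 0 := by positivity
      simp only [hv, hw, Set.indicator_of_mem h]
      field_simp
    · simp [hv, hw, Set.indicator_of_notMem h]
  have hvw : ∀ x, ‖v x‖ ≤ ‖w x‖ := by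
    intro x
    by_cases h : x ∈ Ioi (0 : ℝ)
    · have hx : 0 < x := h
      simp only [hv, hw, Set.indicator_of_mem h, norm_mul]
      have : 1 ≤ ‖(1 + x) ^ k‖ := by
        rw [Real.norm_eq_abs, abs_of_nonneg (by positivity)]
        exact Real.one_le_rpow (by linarith) hk
      nlinarith [norm_nonneg (u x)]
    · simp [hv, hw, Set.indicator_of_notMem h]
  have hvm : AEStronglyMeasurable v volume := by
    have : v = fun x => ((1 + x) ^ k)⁻¹ * w x := funext hwv
    rw [this]
    exact (Measurable.aestronglyMeasurable (by fun_prop)).mul hwi.aestronglyMeasurable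
  have hvi : Integrable v := hwi.mono hvm (Filter.Eventually.of_forall hvw)
  -- gain term
  have hcw : Integrable (fun p : ℝ × ℝ => w p.2 * w (p.1 - p.2)) (volume.prod volume) := by
    simpa using hwi.convolution_integrand (ContinuousLinearMap.mul ℝ ℝ) hwi
  have hcv : AEStronglyMeasurable (fun p : ℝ × ℝ => v p.2 * v (p.1 - p.2))
      (volume.prod volume) := by
    simpa using (hvi.convolution_integrand (ContinuousLinearMap.mul ℝ ℝ) hvi).aestronglyMeasurable
  have hF : Integrable (fun p : ℝ × ℝ =>
      (1 + p.1) ^ k * (L (p.1 - p.2, p.2) * (v p.2 * v (p.1 - p.2)))) (volume.prod volume) := by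
    refine (hcw.const_mul (2 + ε)).mono ?_ (Filter.Eventually.of_forall ?_)
    · refine AEStronglyMeasurable.mul (Measurable.aestronglyMeasurable (by fun_prop))
        (AEStronglyMeasurable.mul (Measurable.aestronglyMeasurable ?_) hcv)
      exact hLm.comp (by fun_prop)
    · rintro ⟨x, y⟩
      by_cases hy : y ∈ Ioi (0 : ℝ)
      · by_cases hz : x - y ∈ Ioi (0 : ℝ)
        · have hy' : 0 < y := hy
          have hz' : 0 < x - y := hz
          have hx' : 0 < x := by linarith
          have hb := hLb (x - y, y)
          simp only [hv, hw, Set.indicator_of_mem hy, Set.indicator_of_mem hz, norm_mul]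
          have e1 : ‖(1 + x) ^ k‖ ≤ ‖(1 + y) ^ k‖ * ‖(1 + (x - y)) ^ k‖ := by
            rw [Real.norm_of_nonneg (by positivity), Real.norm_of_nonneg (by positivity),
              Real.norm_of_nonneg (by positivity), ← Real.mul_rpow (by positivity) (by positivity)]
            apply Real.rpow_le_rpow (by positivity) _ hk
            nlinarith
          have e2 : ‖2 + ε‖ = 2 + ε := Real.norm_of_nonneg (by positivity)
          rw [e2]
          calc ‖(1 + x) ^ k‖ * (‖L (x - y, y)‖ * (‖u y‖ * ‖u (x - y)‖))
              ≤ (‖(1 + y) ^ k‖ * ‖(1 + (x - y)) ^ k‖) * ((2 + ε) * (‖u y‖ * ‖u (x - y)‖)) := by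
                gcongr
            _ = _ := by ring
        · simp [hv, hw, Set.indicator_of_notMem hz]
      · simp [hv, hw, Set.indicator_of_notMem hy]
  have hgain : IntegrableOn (fun x => (1 + x) ^ k *
      ∫ y in (0 : ℝ)..x, kernel ε W (x - y) y * u (x - y) * u y) (Ioi 0) := by
    refine (hF.integral_prod_left.integrableOn (s := Ioi 0)).congr_fun ?_ measurableSet_Ioi
    intro x hx
    have hx : 0 < x := hx
    simp only []
    rw [integral_const_mul, intervalIntegral.integral_of_le hx.le, integral_Ioc_eq_integral_Ioo,
      ← integral_indicator measurableSet_Ioo]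
    congr 1
    refine integral_congr_ae (Filter.Eventually.of_forall fun y => ?_)
    by_cases hy : y ∈ Ioo 0 x
    · have hy1 : y ∈ Ioi (0 : ℝ) := hy.1
      have hy2 : x - y ∈ Ioi (0 : ℝ) := sub_pos.2 hy.2
      simp only [hv, Set.indicator_of_mem hy, Set.indicator_of_mem hy1, Set.indicator_of_mem hy2,
        hLQ _ _ (sub_pos.2 hy.2) hy.1]
      ring
    · simp only [Set.indicator_of_notMem hy]
      by_cases hy1 : y ∈ Ioi (0 : ℝ)
      · have hy2 : x - y ∉ Ioi (0 : ℝ) := fun h => hy ⟨hy1, sub_pos.1 h⟩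
        simp [hv, Set.indicator_of_notMem hy2]
      · simp [hv, Set.indicator_of_notMem hy1]
  have hloss : IntegrableOn (fun x => (1 + x) ^ k *
      (u x * ∫ y in Ioi 0, kernel ε W x y * u y)) (Ioi 0) := by
    have hH : Integrable (fun p : ℝ × ℝ => L p * (w p.1 * v p.2)) (volume.prod volume) := by
      refine ((hwi.mul_prod hvi).const_mul (2 + ε)).mono ?_ (Filter.Eventually.of_forall ?_)
      · exact hLm.aestronglyMeasurable.mul (hwi.mul_prod hvi).aestronglyMeasurable
      · intro p
        have e2 : ‖2 + ε‖ = 2 + ε := Real.norm_of_nonneg (by positivity)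
        simp only [norm_mul, e2]
        gcongr
        exact hLb p
    refine (hH.integral_prod_left.integrableOn (s := Ioi 0)).congr_fun ?_ measurableSet_Ioi
    intro x hx
    have hx' : 0 < x := hx
    simp only []
    rw [← integral_indicator measurableSet_Ioi, ← mul_assoc, ← integral_const_mul]
    refine integral_congr_ae (Filter.Eventually.of_forall fun y => ?_)
    by_cases hy : y ∈ Ioi (0 : ℝ)
    · simp only [hv, hw, Set.indicator_of_mem hy, Set.indicator_of_mem hx, hLQ _ _ hx' hy]
      ring
    · simp [hv, Set.indicator_of_notMem hy]
  have hsub : IntegrableOn (fun x => 1 / 2 * ((1 + x) ^ k *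
      ∫ y in (0 : ℝ)..x, kernel ε W (x - y) y * u (x - y) * u y) - (1 + x) ^ k *
      (u x * ∫ y in Ioi 0, kernel ε W x y * u y)) (Ioi 0) := (hgain.const_mul (1 / 2)).sub hloss
  refine hsub.congr_fun (fun x _ => ?_) measurableSet_Ioi
  simp only [coag]
  ring

end

end Smoluchowski

/-! The transform `F(z) = ∫ (1 - e^{-zx}) u(x) dx` is injective on `L¹_k` and makes the constant
kernel explicit: since `1 - e^{-z(x+y)}` is nearly additive, with defect minus a product,
coagulation with kernel `2` becomes `-F²`, and dilation by `t` becomes `e^t F(e^{-t} z)`. Hence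
`e^{-x}`, with transform `z / (1 + z)`, is stationary for `ε = 0`, and the linearisation there is
solved along characteristics: its semigroup multiplies `e^t F(e^{-t} z)` by `((1 + e^{-t} z) / (1 +
z))²` (`bern_linT`). Expanding the square writes it through dilations and convolutions with `e^{-x}`
and `x e^{-x}`. On functions of zero mass the first-order Taylor term of the last convolution
cancels, which gives decay `e^{-(p-1)t}` in `L¹_k` for `1 ≤ p ≤ min(2, k)` (`exists_norm_linT_le`).

For small `ε` and near `e^{-x}`, the nonlinear and `ε`-dependent remainders are absorbed by this
gap. In the norm `sup_t e^{γt} ‖T_t u‖` the semigroup is a strict contraction, so the implicit Euler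
scheme contracts towards a nonnegative stationary solution (`exists_stationary`). The same
inequality with step parameter `0` gives local uniqueness (`exists_stationary_unique`).

Global uniqueness needs every profile of mass `1` to be close to `e^{-x}`
(`exists_norm_profile_sub_le`). Along characteristics the reciprocal transform of a profile grows at
a rate between those of the kernels `2` and `2 + ε`; this sandwiches `F(z)` between `z / (1 + (1 +
ε/2) z)` and `z / (1 + z)`. These bounds control the second moment and the number of particles near
the origin, and make the transform of the difference at most `ε z²`. Smallness of the transform
becomes smallness in `L¹` by a quantitative Tauberian argument: stationarity makes the difference
almost invariant under small dilations, while averages over dilations against powers of `4 s (1 -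
s)`, `s = 2^{-τ}`, are finite combinations of transform values. Interpolation with the second moment
reaches `L¹_{3/2}`.

For `k > 2` one may take `p = 2`, so the linear decay rate is `1`. A continuity argument in the
Duhamel formula then gives decay of the nonlinear problem at rate `1/2` (`norm_sub_stationary_le`).
-/

namespace Smoluchowski

noncomputable section

section

/-! ### Weighted spaces, test functions and the Bernstein transform -/

section Basic

variable {k : ℝ} {u v φ : ℝ → ℝ}

theorem ae_weightMeasure_iff {p : ℝ → Prop} :
    (∀ᵐ x ∂weightMeasure k, p x) ↔ ∀ᵐ x ∂volume.restrict (Ioi 0), p x := by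
  rw [weightMeasure, ae_withDensity_iff (by fun_prop)]
  constructor <;> intro h
  · filter_upwards [h, ae_restrict_mem measurableSet_Ioi] with x hx hx0
    have hx0 : 0 < x := hx0
    refine hx ?_
    have : 0 < (1 + x) ^ k := by positivity
    simpa using this
  · filter_upwards [h] with x hx _ using hx

theorem integral_weightMeasure (f : ℝ → ℝ) :
    ∫ x, f x ∂weightMeasure k = ∫ x in Ioi 0, f x * (1 + x) ^ k := by
  rw [weightMeasure, integral_withDensity_eq_integral_toReal_smul (by fun_prop) (by simp)]
  refine setIntegral_congr_fun measurableSet_Ioi fun x hx => ?_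
  have hx : 0 < x := hx
  simp only [smul_eq_mul]
  rw [ENNReal.toReal_ofReal (by positivity), mul_comm]

theorem norm_eq_norm1 (u : L1 k) : ‖u‖ = norm1 k u := by
  rw [L1.norm_eq_integral_norm, integral_weightMeasure]
  rfl

theorem coeFn_toL1 (hu : MemLp u 1 (weightMeasure k)) :
    toL1 k u =ᵐ[volume.restrict (Ioi 0)] u := by
  rw [toL1, dif_pos hu]
  exact ae_weightMeasure_iff.1 hu.coeFn_toLp

theorem memLp_coe (u : L1 k) : MemLp u 1 (weightMeasure k) := Lp.memLp u

theorem norm1_congr (h : u =ᵐ[volume.restrict (Ioi 0)] v) : norm1 k u = norm1 k v := by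
  refine integral_congr_ae ?_
  filter_upwards [h] with x hx
  rw [hx]

theorem norm_toL1 (hu : MemLp u 1 (weightMeasure k)) : ‖toL1 k u‖ = norm1 k u := by
  rw [norm_eq_norm1, norm1_congr (coeFn_toL1 hu)]

theorem L1_ext {u v : L1 k} (h : u =ᵐ[volume.restrict (Ioi 0)] v) : u = v :=
  Lp.ext (ae_weightMeasure_iff.2 h)

theorem toL1_coe (u : L1 k) : toL1 k u = u := L1_ext (coeFn_toL1 (memLp_coe u))

theorem toL1_congr (hu : MemLp u 1 (weightMeasure k))
    (h : u =ᵐ[volume.restrict (Ioi 0)] v) : toL1 k u = toL1 k v := by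
  have hv : MemLp v 1 (weightMeasure k) := hu.ae_eq (ae_weightMeasure_iff.2 h)
  exact L1_ext ((coeFn_toL1 hu).trans (h.trans (coeFn_toL1 hv).symm))

theorem coeFn_add' (u v : L1 k) :
    (u + v : L1 k) =ᵐ[volume.restrict (Ioi 0)] fun x => u x + v x :=
  ae_weightMeasure_iff.1 (Lp.coeFn_add u v)

theorem coeFn_sub' (u v : L1 k) :
    (u - v : L1 k) =ᵐ[volume.restrict (Ioi 0)] fun x => u x - v x :=
  ae_weightMeasure_iff.1 (Lp.coeFn_sub u v)

theorem coeFn_smul' (c : ℝ) (u : L1 k) :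
    (c • u : L1 k) =ᵐ[volume.restrict (Ioi 0)] fun x => c * u x :=
  ae_weightMeasure_iff.1 (Lp.coeFn_smul c u)

theorem memLp_iff_norm : MemLp u 1 (weightMeasure k) ↔
    AEStronglyMeasurable u (volume.restrict (Ioi 0)) ∧
      IntegrableOn (fun x => |u x| * (1 + x) ^ k) (Ioi 0) := by
  rw [memLp_iff]
  constructor
  · intro h
    constructor
    · have h2 : AEStronglyMeasurable (fun x : ℝ => ((1 + x) ^ k)⁻¹ * ((1 + x) ^ k * u x))
          (volume.restrict (Ioi 0)) :=
        (Measurable.aestronglyMeasurable (by fun_prop)).mul h.aestronglyMeasurable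
      refine h2.congr ?_
      filter_upwards [ae_restrict_mem measurableSet_Ioi] with x hx
      have hx : 0 < x := hx
      have : (1 + x) ^ k ≠ 0 := by positivity
      field_simp
    · refine IntegrableOn.congr_fun (f := fun x => ‖(1 + x) ^ k * u x‖) h.norm (fun x hx => ?_)
        measurableSet_Ioi
      have hx : 0 < x := hx
      simp only [norm_mul, Real.norm_eq_abs]
      rw [abs_of_nonneg (by positivity : (0 : ℝ) ≤ (1 + x) ^ k), mul_comm]
  · rintro ⟨h1, h2⟩
    refine Integrable.mono h2 (AEStronglyMeasurable.mul (f := fun x : ℝ => (1 + x) ^ k)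
      (Measurable.aestronglyMeasurable (by fun_prop)) h1) ?_
    filter_upwards [] with x
    simp [mul_comm]

theorem MemLp_aesm (hu : MemLp u 1 (weightMeasure k)) :
    AEStronglyMeasurable u (volume.restrict (Ioi 0)) := (memLp_iff_norm.1 hu).1

/-- `φ` is a measurable function dominated by the weight `(1 + x)^k`. -/
def IsTest (k : ℝ) (φ : ℝ → ℝ) : Prop :=
  Measurable φ ∧ ∃ C, ∀ x, 0 < x → |φ x| ≤ C * (1 + x) ^ k

theorem integrableOn_mul_of_le (hφ : AEStronglyMeasurable φ (volume.restrict (Ioi 0))) {C : ℝ}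
    (hC : ∀ x, 0 < x → |φ x| ≤ C * (1 + x) ^ k) (hu : MemLp u 1 (weightMeasure k)) :
    IntegrableOn (fun x => φ x * u x) (Ioi 0) := by
  have h := memLp_iff_norm.1 hu
  refine (h.2.const_mul C).mono (hφ.mul h.1) ?_
  filter_upwards [ae_restrict_mem measurableSet_Ioi] with x hx
  have hx : 0 < x := hx
  have h1 := hC x hx
  have h2 : 0 ≤ C * (1 + x) ^ k := (abs_nonneg _).trans h1
  rw [norm_mul, Real.norm_eq_abs, Real.norm_eq_abs, Real.norm_eq_abs, abs_mul, abs_mul, abs_abs,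
    mul_left_comm, ← abs_mul C, abs_of_nonneg h2, mul_comm]
  gcongr

theorem IsTest.integrable (hφ : IsTest k φ) (hu : MemLp u 1 (weightMeasure k)) :
    IntegrableOn (fun x => φ x * u x) (Ioi 0) :=
  integrableOn_mul_of_le hφ.1.aestronglyMeasurable hφ.2.choose_spec hu

theorem abs_integral_mul_le {C : ℝ} (hC : ∀ x, 0 < x → |φ x| ≤ C * (1 + x) ^ k)
    (hu : MemLp u 1 (weightMeasure k)) : |∫ x in Ioi 0, φ x * u x| ≤ C * norm1 k u := by
  have h := memLp_iff_norm.1 hu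
  rw [norm1, ← integral_const_mul, ← Real.norm_eq_abs]
  refine norm_integral_le_of_norm_le (h.2.const_mul C) ?_
  filter_upwards [ae_restrict_mem measurableSet_Ioi] with x hx
  have hx : 0 < x := hx
  have h1 := hC x hx
  rw [norm_mul, Real.norm_eq_abs, Real.norm_eq_abs, mul_left_comm, mul_comm]
  gcongr

theorem pairing_congr (h : u =ᵐ[volume.restrict (Ioi 0)] v) :
    ∫ x in Ioi 0, φ x * u x = ∫ x in Ioi 0, φ x * v x := by
  refine integral_congr_ae ?_
  filter_upwards [h] with x hx
  rw [hx]

open Classical in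
/-- The continuous linear functional `u ↦ ∫₀^∞ φ u` on `L¹_k`, for a test function `φ`. -/
def pairing (k : ℝ) (φ : ℝ → ℝ) : L1 k →L[ℝ] ℝ :=
  if h : IsTest k φ then
    LinearMap.mkContinuous
      { toFun := fun u => ∫ x in Ioi 0, φ x * u x
        map_add' := fun u v => by
          rw [pairing_congr (coeFn_add' u v),
            ← integral_add (h.integrable (memLp_coe u)) (h.integrable (memLp_coe v))]
          simp only [mul_add]
        map_smul' := fun c u => by
          rw [pairing_congr (coeFn_smul' c u)]
          simp only [mul_left_comm _ c]
          rw [integral_const_mul]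
          rfl } h.2.choose
      fun u => by
        rw [norm_eq_norm1]
        exact abs_integral_mul_le h.2.choose_spec (memLp_coe u)
  -- A default value which keeps `pairing` total in `φ`; all formulas for it assume `IsTest`. In
  -- particular `bern k z` is only evaluated for `z ≥ 0`.
  else 0

theorem pairing_apply (h : IsTest k φ) (u : L1 k) :
    pairing k φ u = ∫ x in Ioi 0, φ x * u x := by
  rw [pairing, dif_pos h]
  rfl

theorem pairing_toL1 (h : IsTest k φ) (hu : MemLp u 1 (weightMeasure k)) :
    pairing k φ (toL1 k u) = ∫ x in Ioi 0, φ x * u x := by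
  rw [pairing_apply h, pairing_congr (coeFn_toL1 hu)]

theorem one_le_weight (hk : 0 ≤ k) {x : ℝ} (hx : 0 < x) : 1 ≤ (1 + x) ^ k :=
  Real.one_le_rpow (by linarith) hk

theorem le_weight (hk : 1 ≤ k) {x : ℝ} (hx : 0 < x) : 1 + x ≤ (1 + x) ^ k := by
  simpa using Real.rpow_le_rpow_of_exponent_le (by linarith : 1 ≤ 1 + x) hk

/-- The function `x ↦ 1 - e^{-zx}`. -/
def bernFun (z x : ℝ) : ℝ := 1 - Real.exp (-(z * x))

theorem measurable_bernFun (z : ℝ) : Measurable (bernFun z) := by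
  unfold bernFun; fun_prop

theorem bernFun_nonneg {z x : ℝ} (h : 0 ≤ z * x) : 0 ≤ bernFun z x := by
  simp [bernFun, h]

theorem bernFun_le_one (z x : ℝ) : bernFun z x ≤ 1 := by
  have := Real.exp_pos (-(z * x))
  simp only [bernFun]; linarith

theorem bernFun_le (z x : ℝ) : bernFun z x ≤ z * x := by
  have := Real.add_one_le_exp (-(z * x))
  simp only [bernFun]; linarith

theorem isTest_bernFun (hk : 0 ≤ k) {z : ℝ} (hz : 0 ≤ z) : IsTest k (bernFun z) := by
  refine ⟨measurable_bernFun z, 1, fun x hx => ?_⟩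
  have := one_le_weight hk hx
  rw [abs_of_nonneg (bernFun_nonneg (by positivity))]
  linarith [bernFun_le_one z x]

theorem isTest_id (hk : 1 ≤ k) : IsTest k (fun x => x) := by
  refine ⟨measurable_id, 1, fun x hx => ?_⟩
  rw [abs_of_pos hx]
  linarith [le_weight hk hx]

theorem isTest_one (hk : 0 ≤ k) : IsTest k (fun _ => 1) := by
  refine ⟨measurable_const, 1, fun x hx => ?_⟩
  simpa using one_le_weight hk hx

/-- The Bernstein transform `u ↦ ∫₀^∞ (1 - e^{-zx}) u(x) dx` as a functional on `L¹_k`. -/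
def bern (k z : ℝ) : L1 k →L[ℝ] ℝ := pairing k (bernFun z)

/-- The mass `u ↦ ∫₀^∞ x u(x) dx` as a functional on `L¹_k`. -/
def massL (k : ℝ) : L1 k →L[ℝ] ℝ := pairing k fun x => x

theorem massL_apply (hk : 1 ≤ k) (u : L1 k) : massL k u = mass u :=
  pairing_apply (isTest_id hk) u

theorem bern_apply (hk : 0 ≤ k) {z : ℝ} (hz : 0 ≤ z) (u : L1 k) :
    bern k z u = ∫ x in Ioi 0, bernFun z x * u x := pairing_apply (isTest_bernFun hk hz) u

theorem memLp_mono {j : ℝ} (hjk : j ≤ k) (hu : MemLp u 1 (weightMeasure k)) :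
    MemLp u 1 (weightMeasure j) := by
  rw [memLp_iff]
  refine integrableOn_mul_of_le (k := k) (C := 1)
    (Measurable.aestronglyMeasurable (by fun_prop)) (fun x hx => ?_) hu
  rw [abs_of_nonneg (by positivity), one_mul]
  exact Real.rpow_le_rpow_of_exponent_le (by linarith) hjk

theorem norm1_mono {j : ℝ} (hjk : j ≤ k) (hu : MemLp u 1 (weightMeasure k)) :
    norm1 j u ≤ norm1 k u := by
  refine setIntegral_mono_on (memLp_iff_norm.1 (memLp_mono hjk hu)).2 (memLp_iff_norm.1 hu).2
    measurableSet_Ioi fun x hx => ?_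
  have hx : 0 < x := hx
  gcongr
  linarith

end Basic

/-! ### Injectivity of the Bernstein transform -/

section Injective

/-- In the variable `s = e^{-x}` the hypothesis says that `u` annihilates all polynomials on `[0,
1]`, hence by Weierstrass all continuous functions of `s`. These include the smooth functions
compactly supported in `(0, ∞)`, which determine `u`. -/
theorem eq_zero_of_laplace {u : ℝ → ℝ} (hu : IntegrableOn u (Ioi 0))
    (h : ∀ n : ℕ, ∫ x in Ioi 0, Real.exp (-x) ^ n * u x = 0) :
    u =ᵐ[volume.restrict (Ioi 0)] 0 := by
  have hpoly : ∀ p : Polynomial ℝ, ∫ x in Ioi 0, p.eval (Real.exp (-x)) * u x = 0 := by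
    intro p
    have hint : ∀ n : ℕ, IntegrableOn (fun x => Real.exp (-x) ^ n * u x) (Ioi 0) := by
      intro n
      refine hu.bdd_mul (c := 1) (Measurable.aestronglyMeasurable (by fun_prop)) ?_
      filter_upwards [ae_restrict_mem measurableSet_Ioi] with x hx
      have hx : 0 < x := hx
      rw [norm_pow, Real.norm_eq_abs, Real.abs_exp]
      exact pow_le_one₀ (Real.exp_pos _).le (by simpa using hx.le)
    induction p using Polynomial.induction_on' with
    | add p q hp hq =>
      have hi : ∀ p : Polynomial ℝ, IntegrableOn (fun x => p.eval (Real.exp (-x)) * u x)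
          (Ioi 0) := by
        intro p
        simp only [Polynomial.eval_eq_sum_range, Finset.sum_mul]
        refine integrable_finsetSum _ fun n _ => ?_
        simpa only [mul_assoc] using (hint n).const_mul _
      simp only [Polynomial.eval_add, add_mul]
      rw [integral_add (hi p) (hi q), hp, hq, add_zero]
    | monomial n a =>
      simp only [Polynomial.eval_monomial, mul_assoc]
      rw [integral_const_mul, h n, mul_zero]
  have hcont : ∀ g : ℝ → ℝ, ContinuousOn g (Icc 0 1) →
      ∫ x in Ioi 0, g (Real.exp (-x)) * u x = 0 := by
    intro g hg
    have hmem : ∀ x : ℝ, 0 < x → Real.exp (-x) ∈ Icc (0 : ℝ) 1 := fun x hx =>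
      ⟨(Real.exp_pos _).le, by simpa using hx.le⟩
    have hgm : AEStronglyMeasurable (fun x => g (Real.exp (-x))) (volume.restrict (Ioi 0)) := by
      refine ContinuousOn.aestronglyMeasurable ?_ measurableSet_Ioi
      exact hg.comp (by fun_prop) (fun x hx => hmem x hx)
    obtain ⟨B, hB⟩ := isCompact_Icc.exists_bound_of_continuousOn hg
    have hgi : IntegrableOn (fun x => g (Real.exp (-x)) * u x) (Ioi 0) := by
      refine hu.bdd_mul (c := B) hgm ?_
      filter_upwards [ae_restrict_mem measurableSet_Ioi] with x hx
      exact hB _ (hmem x hx)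
    have hpi : ∀ p : Polynomial ℝ, IntegrableOn (fun x => p.eval (Real.exp (-x)) * u x)
        (Ioi 0) := by
      intro p
      obtain ⟨B, hB⟩ := isCompact_Icc.exists_bound_of_continuousOn
        (p.continuous.continuousOn (s := Icc (0 : ℝ) 1))
      refine hu.bdd_mul (c := B) (Continuous.aestronglyMeasurable (by fun_prop)) ?_
      filter_upwards [ae_restrict_mem measurableSet_Ioi] with x hx
      exact hB _ (hmem x hx)
    have key : ∀ ε : ℝ, 0 < ε →
        |∫ x in Ioi 0, g (Real.exp (-x)) * u x| ≤ ε * ∫ x in Ioi 0, |u x| := by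
      intro ε hε
      obtain ⟨p, hp⟩ := exists_polynomial_near_of_continuousOn 0 1 g hg ε hε
      have h1 : ∫ x in Ioi 0, g (Real.exp (-x)) * u x = ∫ x in Ioi 0,
          (g (Real.exp (-x)) * u x - p.eval (Real.exp (-x)) * u x) := by
        rw [integral_sub hgi (hpi p), hpoly p, sub_zero]
      rw [h1, ← integral_const_mul, ← Real.norm_eq_abs]
      refine norm_integral_le_of_norm_le (hu.abs.const_mul ε) ?_
      filter_upwards [ae_restrict_mem measurableSet_Ioi] with x hx
      rw [← sub_mul, norm_mul, Real.norm_eq_abs, Real.norm_eq_abs]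
      gcongr
      rw [abs_sub_comm]
      exact (hp _ (hmem x hx)).le
    by_contra hne
    have hpos : 0 < |∫ x in Ioi 0, g (Real.exp (-x)) * u x| := abs_pos.2 hne
    set I := ∫ x in Ioi 0, |u x| with hI
    have hI0 : 0 ≤ I := setIntegral_nonneg measurableSet_Ioi fun x _ => abs_nonneg _
    -- This choice of `ε` bounds a positive number by less than itself; the `+ 1` covers the case `I
    -- = 0`.
    have := key (|∫ x in Ioi 0, g (Real.exp (-x)) * u x| / (2 * (I + 1))) (by positivity)
    rw [div_mul_eq_mul_div, le_div_iff₀ (by positivity)] at this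
    nlinarith
  have hloc : ∀ᵐ x, x ∈ Ioi (0 : ℝ) → u x = 0 := by
    refine isOpen_Ioi.ae_eq_zero_of_integral_contDiff_smul_eq_zero hu.locallyIntegrableOn ?_
    intro g hg hgc hgs
    -- Continuity at `s = 0` holds because `g` vanishes for large arguments. The value there is `g
    -- 0`, as `Real.log 0 = 0`, and it vanishes since `0` lies outside the support.
    have hc : ContinuousOn (fun s => g (-Real.log s)) (Icc 0 1) := by
      have hsub : ∃ R, 0 < R ∧ ∀ x, R < x → g x = 0 := by
        obtain ⟨R, hR⟩ := hgc.isCompact.isBounded.subset_closedBall 0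
        refine ⟨|R| + 1, by positivity, fun x hx => ?_⟩
        by_contra hne
        have := hR (subset_tsupport g hne)
        rw [mem_closedBall_zero_iff, Real.norm_eq_abs] at this
        have := le_abs_self x
        have := le_abs_self R
        linarith
      obtain ⟨R, hR0, hR⟩ := hsub
      intro s hs
      rcases eq_or_lt_of_le hs.1 with h0 | h0
      · have hz : g 0 = 0 := by
          by_contra hne
          have : (0 : ℝ) ∈ Ioi (0 : ℝ) := hgs (subset_tsupport g hne)
          exact lt_irrefl (0 : ℝ) this
        have hev : (fun s => g (-Real.log s)) =ᶠ[nhdsWithin s (Icc 0 1)] fun _ => 0 := by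
          have h1 : ∀ᶠ y in nhdsWithin s (Icc 0 1), y < Real.exp (-R) :=
            mem_nhdsWithin_of_mem_nhds (Iio_mem_nhds (by rw [← h0]; exact Real.exp_pos _))
          filter_upwards [h1, self_mem_nhdsWithin] with y hy hy2
          rcases eq_or_lt_of_le hy2.1 with h3 | h3
          · simp [← h3, hz]
          · apply hR
            have := Real.log_lt_log h3 hy
            rw [Real.log_exp] at this
            linarith
        refine (continuousWithinAt_const (b := (0 : ℝ))).congr_of_eventuallyEq hev ?_
        simp [← h0, hz]
      · exact (hg.continuous.continuousAt.comp
          (Real.continuousAt_log h0.ne').neg).continuousWithinAt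
    have := hcont _ hc
    simp only [Real.log_exp, neg_neg] at this
    rw [← this, ← integral_indicator measurableSet_Ioi]
    refine integral_congr_ae (Filter.Eventually.of_forall fun x => ?_)
    by_cases hx : x ∈ Ioi (0 : ℝ)
    · simp [indicator_of_mem hx]
    · simp only [indicator_of_notMem hx, smul_eq_mul]
      have : g x = 0 := by
        by_contra hne
        exact hx (hgs (subset_tsupport g hne))
      rw [this, zero_mul]
  filter_upwards [ae_restrict_of_ae hloc, ae_restrict_mem measurableSet_Ioi] with x hx hx0
  exact hx hx0

theorem integrableOn_of_memLp {k : ℝ} {u : ℝ → ℝ} (hk : 0 ≤ k)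
    (hu : MemLp u 1 (weightMeasure k)) : IntegrableOn u (Ioi 0) := by
  simpa using (isTest_one hk).integrable hu

/-- Dominated convergence: the Bernstein transform tends to the total integral. -/
theorem tendsto_bern {u : ℝ → ℝ} (hu : IntegrableOn u (Ioi 0)) :
    Filter.Tendsto (fun z => ∫ x in Ioi 0, bernFun z x * u x) Filter.atTop
      (nhds (∫ x in Ioi 0, u x)) := by
  refine tendsto_integral_filter_of_dominated_convergence (fun x => |u x|) ?_ ?_ hu.abs ?_
  · exact Filter.Eventually.of_forall fun z =>
      (measurable_bernFun z).aestronglyMeasurable.mul hu.aestronglyMeasurable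
  · filter_upwards [Filter.eventually_ge_atTop 0] with z hz
    filter_upwards [ae_restrict_mem measurableSet_Ioi] with x hx
    have hx : 0 < x := hx
    rw [norm_mul, Real.norm_eq_abs, Real.norm_eq_abs,
      abs_of_nonneg (bernFun_nonneg (by positivity))]
    exact mul_le_of_le_one_left (abs_nonneg _) (bernFun_le_one z x)
  · filter_upwards [ae_restrict_mem measurableSet_Ioi] with x hx
    have hx : 0 < x := hx
    have h1 : Filter.Tendsto (fun z : ℝ => Real.exp (-(z * x))) Filter.atTop (nhds 0) :=
      Real.tendsto_exp_neg_atTop_nhds_zero.comp (Filter.tendsto_id.atTop_mul_const hx)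
    simpa [bernFun] using (h1.const_sub 1).mul_const (u x)

/-- Letting `z → ∞` shows that the total integral vanishes; the values at positive integers `z` then
yield the exponential moments required by `eq_zero_of_laplace`. -/
theorem eq_zero_of_bern {k : ℝ} (hk : 0 ≤ k) {u : ℝ → ℝ} (hu : MemLp u 1 (weightMeasure k))
    (h : ∀ z, 0 < z → ∫ x in Ioi 0, bernFun z x * u x = 0) :
    u =ᵐ[volume.restrict (Ioi 0)] 0 := by
  have hi := integrableOn_of_memLp hk hu
  have h0 : ∫ x in Ioi 0, u x = 0 := by
    refine tendsto_nhds_unique (tendsto_bern hi) (tendsto_const_nhds.congr' ?_)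
    filter_upwards [Filter.eventually_gt_atTop 0] with z hz
    rw [h z hz]
  refine eq_zero_of_laplace hi fun n => ?_
  rcases Nat.eq_zero_or_pos n with rfl | hn
  · simpa using h0
  · have hn : (0 : ℝ) < n := by exact_mod_cast hn
    have h1 := h n hn
    have h2 : ∀ x, Real.exp (-x) ^ n * u x = u x - bernFun n x * u x := by
      intro x
      rw [← Real.exp_nat_mul, bernFun]
      ring_nf
    simp only [h2]
    rw [integral_sub hi ((isTest_bernFun hk hn.le).integrable hu), h0, h1, sub_zero]

/-- This is how identities in `L¹_k` are proved below (bilinearity, semigroup laws, variation of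
constants): both sides are compared through their transforms, where they become scalar identities.
-/
theorem bern_injective {k : ℝ} (hk : 0 ≤ k) {u v : L1 k}
    (h : ∀ z, 0 < z → bern k z u = bern k z v) : u = v := by
  rw [← sub_eq_zero]
  refine L1_ext ?_
  have h0 : ((0 : L1 k) : ℝ → ℝ) =ᵐ[volume.restrict (Ioi 0)] 0 :=
    ae_weightMeasure_iff.1 (Lp.coeFn_zero _ _ _)
  refine (eq_zero_of_bern hk (memLp_coe _) fun z hz => ?_).trans h0.symm
  rw [← bern_apply hk hz.le, map_sub, h z hz, sub_self]

end Injective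

end

section

/-! ### The bilinear coagulation operator -/

/-- Lebesgue measure on the quadrant `(0, ∞)²`. -/
def quadrant : Measure (ℝ × ℝ) :=
  (volume.restrict (Ioi (0 : ℝ))).prod (volume.restrict (Ioi (0 : ℝ)))

theorem quadrant_eq : quadrant = (volume.prod volume).restrict (Ioi (0 : ℝ) ×ˢ Ioi (0 : ℝ)) := by
  rw [quadrant, Measure.prod_restrict]

theorem measurableSet_quadrant : MeasurableSet (Ioi (0 : ℝ) ×ˢ Ioi (0 : ℝ)) :=
  measurableSet_Ioi.prod measurableSet_Ioi

theorem ae_quadrant : ∀ᵐ p ∂quadrant, 0 < p.1 ∧ 0 < p.2 := by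
  rw [quadrant_eq]
  filter_upwards [ae_restrict_mem measurableSet_quadrant] with p hp
  exact ⟨hp.1, hp.2⟩

/-- `K` is a measurable kernel on `(0, ∞)²` that is bounded by `κ`. -/
structure IsKernel (K : ℝ → ℝ → ℝ) (κ : ℝ) : Prop where
  aesm : AEStronglyMeasurable (Function.uncurry K) quadrant
  nonneg : 0 ≤ κ
  le : ∀ x y, 0 < x → 0 < y → |K x y| ≤ κ

/-- The bilinear operator with `bil K u u = coag K u`. -/
def bil (K : ℝ → ℝ → ℝ) (u v : ℝ → ℝ) (x : ℝ) : ℝ :=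
  1 / 2 * (∫ y in (0 : ℝ)..x, K (x - y) y * u (x - y) * v y) - u x * ∫ y in Ioi 0, K x y * v y

variable {k κ : ℝ} {K : ℝ → ℝ → ℝ} {u v u' v' φ : ℝ → ℝ}

/-- Submultiplicativity of the weight makes `L¹_k` closed under convolution, hence under the gain
term. -/
theorem mul_weight (hk : 0 ≤ k) {x y : ℝ} (hx : 0 < x) (hy : 0 < y) :
    (1 + (x + y)) ^ k ≤ (1 + x) ^ k * (1 + y) ^ k := by
  rw [← Real.mul_rpow (by positivity) (by positivity)]
  apply Real.rpow_le_rpow (by positivity) _ hk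
  nlinarith

theorem integrable_weight_prod (hu : MemLp u 1 (weightMeasure k))
    (hv : MemLp v 1 (weightMeasure k)) :
    Integrable (fun p : ℝ × ℝ => (|u p.1| * (1 + p.1) ^ k) * (|v p.2| * (1 + p.2) ^ k))
      quadrant :=
  (memLp_iff_norm.1 hu).2.mul_prod (memLp_iff_norm.1 hv).2

theorem aesm_tensor (hu : AEStronglyMeasurable u (volume.restrict (Ioi 0)))
    (hv : AEStronglyMeasurable v (volume.restrict (Ioi 0))) :
    AEStronglyMeasurable (fun p : ℝ × ℝ => u p.1 * v p.2) quadrant :=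
  (hu.comp_quasiMeasurePreserving Measure.quasiMeasurePreserving_fst).mul
    (hv.comp_quasiMeasurePreserving Measure.quasiMeasurePreserving_snd)

theorem norm_quad_le (hK : IsKernel K κ) {ψ : ℝ × ℝ → ℝ} {C : ℝ}
    (hψ' : ∀ x y, 0 < x → 0 < y → |ψ (x, y)| ≤ C * ((1 + x) ^ k * (1 + y) ^ k)) :
    ∀ᵐ p ∂quadrant, ‖K p.1 p.2 * (u p.1 * v p.2) * ψ p‖ ≤
      C * κ * ((|u p.1| * (1 + p.1) ^ k) * (|v p.2| * (1 + p.2) ^ k)) := by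
  filter_upwards [ae_quadrant] with p hp
  have h1 := hK.le p.1 p.2 hp.1 hp.2
  have h2 := hψ' p.1 p.2 hp.1 hp.2
  simp only [norm_mul, Real.norm_eq_abs]
  calc |K p.1 p.2| * (|u p.1| * |v p.2|) * |ψ p|
      ≤ κ * (|u p.1| * |v p.2|) * (C * ((1 + p.1) ^ k * (1 + p.2) ^ k)) := by
        have := hK.nonneg
        gcongr
    _ = _ := by ring

theorem integrable_quad (hK : IsKernel K κ) (hu : MemLp u 1 (weightMeasure k))
    (hv : MemLp v 1 (weightMeasure k)) {ψ : ℝ × ℝ → ℝ} (hψ : AEStronglyMeasurable ψ quadrant)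
    {C : ℝ} (hψ' : ∀ x y, 0 < x → 0 < y → |ψ (x, y)| ≤ C * ((1 + x) ^ k * (1 + y) ^ k)) :
    Integrable (fun p => K p.1 p.2 * (u p.1 * v p.2) * ψ p) quadrant :=
  ((integrable_weight_prod hu hv).const_mul (C * κ)).mono'
    ((hK.aesm.mul (aesm_tensor (MemLp_aesm hu) (MemLp_aesm hv))).mul hψ) (norm_quad_le hK hψ')

theorem abs_integral_quad_le (hK : IsKernel K κ) (hu : MemLp u 1 (weightMeasure k))
    (hv : MemLp v 1 (weightMeasure k)) {ψ : ℝ × ℝ → ℝ}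
    {C : ℝ} (hψ' : ∀ x y, 0 < x → 0 < y → |ψ (x, y)| ≤ C * ((1 + x) ^ k * (1 + y) ^ k)) :
    |∫ p, K p.1 p.2 * (u p.1 * v p.2) * ψ p ∂quadrant| ≤ C * κ * (norm1 k u * norm1 k v) := by
  rw [norm1, norm1, ← integral_prod_mul, ← integral_const_mul, ← Real.norm_eq_abs]
  exact norm_integral_le_of_norm_le ((integrable_weight_prod hu hv).const_mul (C * κ))
    (norm_quad_le hK hψ')

theorem quad_congr (hu : u =ᵐ[volume.restrict (Ioi 0)] u') (hv : v =ᵐ[volume.restrict (Ioi 0)] v')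
    (ψ : ℝ × ℝ → ℝ) :
    ∫ p, K p.1 p.2 * (u p.1 * v p.2) * ψ p ∂quadrant =
      ∫ p, K p.1 p.2 * (u' p.1 * v' p.2) * ψ p ∂quadrant := by
  refine integral_congr_ae ?_
  have h1 : (fun p : ℝ × ℝ => u p.1) =ᵐ[quadrant] fun p => u' p.1 :=
    Measure.quasiMeasurePreserving_fst.ae_eq hu
  have h2 : (fun p : ℝ × ℝ => v p.2) =ᵐ[quadrant] fun p => v' p.2 :=
    Measure.quasiMeasurePreserving_snd.ae_eq hv
  filter_upwards [h1, h2] with p h1 h2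
  rw [h1, h2]

theorem gain_eq (K : ℝ → ℝ → ℝ) (u v φ : ℝ → ℝ) {x : ℝ} (hx : 0 < x) :
    φ x * ∫ y in (0 : ℝ)..x, K (x - y) y * u (x - y) * v y =
      ∫ y, (Ioi (0 : ℝ) ×ˢ Ioi (0 : ℝ)).indicator
        (fun p : ℝ × ℝ => K p.1 p.2 * (u p.1 * v p.2) * φ (p.1 + p.2)) (x - y, y) := by
  rw [intervalIntegral.integral_of_le hx.le, integral_Ioc_eq_integral_Ioo,
    ← integral_indicator measurableSet_Ioo, ← integral_const_mul]
  refine integral_congr_ae (Filter.Eventually.of_forall fun y => ?_)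
  by_cases hy : y ∈ Ioo 0 x
  · have h : ((x - y, y) : ℝ × ℝ) ∈ Ioi (0 : ℝ) ×ˢ Ioi (0 : ℝ) := ⟨sub_pos.2 hy.2, hy.1⟩
    simp only [indicator_of_mem hy, indicator_of_mem h, sub_add_cancel]
    ring
  · have h : ((x - y, y) : ℝ × ℝ) ∉ Ioi (0 : ℝ) ×ˢ Ioi (0 : ℝ) :=
      fun h => hy ⟨h.2, sub_pos.1 h.1⟩
    simp only [indicator_of_notMem hy, indicator_of_notMem h, mul_zero]

theorem measurePreserving_shear :
    MeasurePreserving (fun p : ℝ × ℝ => (p.1 - p.2, p.2)) (volume.prod volume)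
      (volume.prod volume) := by
  have h := (measurePreserving_sub_prod (volume : Measure ℝ) (volume : Measure ℝ))
  exact h

theorem isTest_shift (hk : 0 ≤ k) {C : ℝ} (hC : ∀ x, 0 < x → |φ x| ≤ C * (1 + x) ^ k) :
    ∀ x y, 0 < x → 0 < y → |φ (x + y)| ≤ C * ((1 + x) ^ k * (1 + y) ^ k) := by
  intro x y hx hy
  have h0 := hC (x + y) (by positivity)
  have h1 : 0 ≤ C := by
    have : 0 < (1 + (x + y)) ^ k := by positivity
    by_contra hneg
    push Not at hneg
    have := mul_neg_of_neg_of_pos hneg this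
    have := abs_nonneg (φ (x + y))
    linarith
  exact h0.trans (mul_le_mul_of_nonneg_left (mul_weight hk hx hy) h1)

theorem isTest_fst (hk : 0 ≤ k) {C : ℝ} (hC : ∀ x, 0 < x → |φ x| ≤ C * (1 + x) ^ k) :
    ∀ x y, 0 < x → 0 < y → |φ x| ≤ C * ((1 + x) ^ k * (1 + y) ^ k) := by
  intro x y hx hy
  have h0 := hC x hx
  have h1 := one_le_weight hk hy
  nlinarith [abs_nonneg (φ x)]

/-- The weak form. The shear `(x, y) ↦ (x - y, y)` preserves measure and moves the gain term to the
quadrant, where it is tested with `φ(x + y)`; the loss term is plain Fubini. The norm bounds, mass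
conservation and transforms of the operator all come from this identity. -/
theorem integral_mul_bil (hk : 0 ≤ k) (hK : IsKernel K κ) (hu : MemLp u 1 (weightMeasure k))
    (hv : MemLp v 1 (weightMeasure k)) (hφ : IsTest k φ) :
    IntegrableOn (fun x => φ x * bil K u v x) (Ioi 0) ∧
    ∫ x in Ioi 0, φ x * bil K u v x =
      ∫ p, K p.1 p.2 * (u p.1 * v p.2) * (1 / 2 * φ (p.1 + p.2) - φ p.1) ∂quadrant := by
  obtain ⟨hφm, C, hC⟩ := hφ
  have hgm : AEStronglyMeasurable (fun p : ℝ × ℝ => φ (p.1 + p.2)) quadrant :=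
    (hφm.comp (by fun_prop : Measurable fun p : ℝ × ℝ => p.1 + p.2)).aestronglyMeasurable
  have hlm : AEStronglyMeasurable (fun p : ℝ × ℝ => φ p.1) quadrant :=
    (hφm.comp measurable_fst).aestronglyMeasurable
  have hg := integrable_quad hK hu hv hgm (isTest_shift hk hC)
  have hl := integrable_quad hK hu hv hlm (isTest_fst hk hC)
  set Q : Set (ℝ × ℝ) := Ioi (0 : ℝ) ×ˢ Ioi (0 : ℝ) with hQ
  set Ψ : ℝ × ℝ → ℝ := Q.indicator
    (fun p : ℝ × ℝ => K p.1 p.2 * (u p.1 * v p.2) * φ (p.1 + p.2)) with hΨ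
  have hΨi : Integrable Ψ (volume.prod volume) := by
    rw [hΨ, integrable_indicator_iff measurableSet_quadrant, IntegrableOn, ← quadrant_eq]
    exact hg
  have hΨs : Integrable (fun p : ℝ × ℝ => Ψ (p.1 - p.2, p.2)) (volume.prod volume) :=
    (measurePreserving_shear.integrable_comp hΨi.aestronglyMeasurable).2 hΨi
  have hgain : IntegrableOn
      (fun x => φ x * ∫ y in (0 : ℝ)..x, K (x - y) y * u (x - y) * v y) (Ioi 0) :=
    (hΨs.integral_prod_left.integrableOn (s := Ioi 0)).congr_fun
      (fun x hx => (gain_eq K u v φ hx).symm) measurableSet_Ioi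
  have hgain' : ∫ x in Ioi 0, φ x * ∫ y in (0 : ℝ)..x, K (x - y) y * u (x - y) * v y =
      ∫ p, K p.1 p.2 * (u p.1 * v p.2) * φ (p.1 + p.2) ∂quadrant := by
    rw [quadrant_eq, ← integral_indicator measurableSet_quadrant,
      ← measurePreserving_shear.map_eq, integral_map (by fun_prop) (by
        rw [measurePreserving_shear.map_eq]; exact hΨi.aestronglyMeasurable),
      integral_prod _ hΨs, ← integral_indicator measurableSet_Ioi]
    refine integral_congr_ae (Filter.Eventually.of_forall fun x => ?_)
    by_cases hx : x ∈ Ioi (0 : ℝ)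
    · simp only [indicator_of_mem hx]
      exact gain_eq K u v φ hx
    · simp only [indicator_of_notMem hx]
      rw [eq_comm]
      refine integral_eq_zero_of_ae (Filter.Eventually.of_forall fun y => ?_)
      refine indicator_of_notMem (fun h => hx ?_) _
      have h1 : 0 < x - y := h.1
      have h2 : 0 < y := h.2
      exact (by linarith : 0 < x)
  have hlosse : ∀ x, φ x * (u x * ∫ y in Ioi 0, K x y * v y) =
      ∫ y in Ioi 0, K x y * (u x * v y) * φ x := by
    intro x
    rw [← mul_assoc, ← integral_const_mul]
    congr 1
    ext y
    ring
  have hloss : IntegrableOn (fun x => φ x * (u x * ∫ y in Ioi 0, K x y * v y)) (Ioi 0) := by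
    simp only [hlosse]
    exact hl.integral_prod_left
  have hloss' : ∫ x in Ioi 0, φ x * (u x * ∫ y in Ioi 0, K x y * v y) =
      ∫ p, K p.1 p.2 * (u p.1 * v p.2) * φ p.1 ∂quadrant := by
    simp only [hlosse]
    exact (integral_prod _ hl).symm
  have hsplit : ∀ x, φ x * bil K u v x =
      1 / 2 * (φ x * ∫ y in (0 : ℝ)..x, K (x - y) y * u (x - y) * v y) -
        φ x * (u x * ∫ y in Ioi 0, K x y * v y) := by
    intro x
    rw [bil]
    ring
  simp only [hsplit]
  refine ⟨(hgain.const_mul _).sub hloss, ?_⟩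
  rw [integral_sub (hgain.const_mul _) hloss, integral_const_mul, hgain', hloss',
    ← integral_const_mul, ← integral_sub (hg.const_mul _) hl]
  congr 1
  ext p
  ring

theorem isTest_weight : IsTest k fun x => (1 + x) ^ k := by
  refine ⟨by fun_prop, 1, fun x hx => ?_⟩
  rw [abs_of_nonneg (by positivity), one_mul]

theorem memLp_bil (hk : 0 ≤ k) (hK : IsKernel K κ) (hu : MemLp u 1 (weightMeasure k))
    (hv : MemLp v 1 (weightMeasure k)) : MemLp (bil K u v) 1 (weightMeasure k) :=
  (memLp_iff _ _).2 (integral_mul_bil hk hK hu hv isTest_weight).1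

/-- The weighted norm is attained by duality. -/
theorem norm1_le_of_forall (hu : MemLp u 1 (weightMeasure k)) {B : ℝ}
    (h : ∀ φ : ℝ → ℝ, Measurable φ → (∀ x, 0 < x → |φ x| ≤ 1 * (1 + x) ^ k) →
      ∫ x in Ioi 0, φ x * u x ≤ B) : norm1 k u ≤ B := by
  have hm := MemLp_aesm hu
  -- The sign of `u` has to be a measurable test function, hence the measurable representative.
  set w := hm.mk u with hw
  have hwm : Measurable w := hm.stronglyMeasurable_mk.measurable
  have hs : Measurable (fun x => if 0 ≤ w x then (1 : ℝ) else -1) :=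
    Measurable.ite (measurableSet_le measurable_const hwm) measurable_const measurable_const
  refine le_trans (le_of_eq ?_)
    (h (fun x => (1 + x) ^ k * if 0 ≤ w x then (1 : ℝ) else -1) ?_ ?_)
  · rw [norm1]
    refine integral_congr_ae ?_
    filter_upwards [hm.ae_eq_mk] with x hx
    rw [← hw] at hx
    by_cases h0 : 0 ≤ w x
    · simp only [h0, if_true]
      rw [abs_of_nonneg (hx ▸ h0)]
      ring
    · simp only [h0, if_false]
      rw [abs_of_neg (by rw [hx]; linarith)]
      ring
  · exact Measurable.mul (by fun_prop) hs
  · intro x hx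
    rw [abs_mul, abs_of_nonneg (by positivity : (0 : ℝ) ≤ (1 + x) ^ k)]
    split_ifs <;> simp

/-- By duality with the weak form; `3/2` is `1/2` from the gain plus `1` from the loss. -/
theorem norm1_bil_le (hk : 0 ≤ k) (hK : IsKernel K κ) (hu : MemLp u 1 (weightMeasure k))
    (hv : MemLp v 1 (weightMeasure k)) :
    norm1 k (bil K u v) ≤ 3 / 2 * κ * (norm1 k u * norm1 k v) := by
  refine norm1_le_of_forall (memLp_bil hk hK hu hv) fun φ hφm hφ => ?_
  rw [(integral_mul_bil hk hK hu hv ⟨hφm, 1, hφ⟩).2]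
  refine (le_abs_self _).trans (abs_integral_quad_le hK hu hv
    (ψ := fun p => 1 / 2 * φ (p.1 + p.2) - φ p.1) fun x y hx hy => ?_)
  have h1 := isTest_shift hk hφ x y hx hy
  have h2 := isTest_fst hk hφ x y hx hy
  simp only []
  calc |1 / 2 * φ (x + y) - φ x| ≤ |1 / 2 * φ (x + y)| + |φ x| := abs_sub _ _
    _ = 1 / 2 * |φ (x + y)| + |φ x| := by rw [abs_mul]; norm_num
    _ ≤ _ := by linarith

theorem isTest_quad (hk : 0 ≤ k) (hφ : IsTest k φ) :
    AEStronglyMeasurable (fun p : ℝ × ℝ => 1 / 2 * φ (p.1 + p.2) - φ p.1) quadrant ∧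
    ∃ C, ∀ x y, 0 < x → 0 < y →
      |1 / 2 * φ (x + y) - φ x| ≤ C * ((1 + x) ^ k * (1 + y) ^ k) := by
  obtain ⟨hφm, C, hC⟩ := hφ
  refine ⟨Measurable.aestronglyMeasurable (((hφm.comp (by fun_prop :
    Measurable fun p : ℝ × ℝ => p.1 + p.2)).const_mul _).sub (hφm.comp measurable_fst)),
    3 / 2 * C, fun x y hx hy => ?_⟩
  have h1 := isTest_shift hk hC x y hx hy
  have h2 := isTest_fst hk hC x y hx hy
  calc |1 / 2 * φ (x + y) - φ x| ≤ |1 / 2 * φ (x + y)| + |φ x| := abs_sub _ _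
    _ = 1 / 2 * |φ (x + y)| + |φ x| := by rw [abs_mul]; norm_num
    _ ≤ _ := by linarith

theorem pairing_bil (hk : 0 ≤ k) (hK : IsKernel K κ) (u v : L1 k) (hφ : IsTest k φ) :
    pairing k φ (toL1 k (bil K u v)) =
      ∫ p, K p.1 p.2 * (u p.1 * v p.2) * (1 / 2 * φ (p.1 + p.2) - φ p.1) ∂quadrant := by
  rw [pairing_toL1 hφ (memLp_bil hk hK (memLp_coe u) (memLp_coe v)),
    (integral_mul_bil hk hK (memLp_coe u) (memLp_coe v) hφ).2]

/-- The bilinear coagulation operator on `L¹_k`. -/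
def bilL (hk : 0 ≤ k) (hK : IsKernel K κ) : L1 k →L[ℝ] L1 k →L[ℝ] L1 k :=
  LinearMap.mkContinuous₂
    (LinearMap.mk₂ ℝ (fun u v : L1 k => toL1 k (bil K u v))
      (fun u u' v => by
        -- Additivity need not hold at every point, since the inner integrals may diverge on a null
        -- set. On transforms it is additivity of absolutely convergent double integrals.
        refine bern_injective hk fun z hz => ?_
        have hφ := isTest_bernFun hk hz.le
        obtain ⟨hm, C, hC⟩ := isTest_quad hk hφ
        rw [map_add, bern, pairing_bil hk hK _ _ hφ, pairing_bil hk hK _ _ hφ,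
          pairing_bil hk hK _ _ hφ, quad_congr (coeFn_add' u u') (ae_eq_refl _),
          ← integral_add (integrable_quad hK (memLp_coe _) (memLp_coe _) hm hC)
            (integrable_quad hK (memLp_coe _) (memLp_coe _) hm hC)]
        congr 1
        ext p
        ring)
      (fun c u v => by
        refine bern_injective hk fun z hz => ?_
        have hφ := isTest_bernFun hk hz.le
        rw [map_smul, bern, pairing_bil hk hK _ _ hφ, pairing_bil hk hK _ _ hφ,
          quad_congr (coeFn_smul' c u) (ae_eq_refl _), smul_eq_mul, ← integral_const_mul]
        congr 1
        ext p
        ring)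
      (fun u v v' => by
        refine bern_injective hk fun z hz => ?_
        have hφ := isTest_bernFun hk hz.le
        obtain ⟨hm, C, hC⟩ := isTest_quad hk hφ
        rw [map_add, bern, pairing_bil hk hK _ _ hφ, pairing_bil hk hK _ _ hφ,
          pairing_bil hk hK _ _ hφ, quad_congr (ae_eq_refl _) (coeFn_add' v v'),
          ← integral_add (integrable_quad hK (memLp_coe _) (memLp_coe _) hm hC)
            (integrable_quad hK (memLp_coe _) (memLp_coe _) hm hC)]
        congr 1
        ext p
        ring)
      (fun c u v => by
        refine bern_injective hk fun z hz => ?_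
        have hφ := isTest_bernFun hk hz.le
        rw [map_smul, bern, pairing_bil hk hK _ _ hφ, pairing_bil hk hK _ _ hφ,
          quad_congr (ae_eq_refl _) (coeFn_smul' c v), smul_eq_mul, ← integral_const_mul]
        congr 1
        ext p
        ring))
    (3 / 2 * κ) fun u v => by
      simp only [LinearMap.mk₂_apply]
      rw [norm_toL1 (memLp_bil hk hK (memLp_coe u) (memLp_coe v)), norm_eq_norm1, norm_eq_norm1,
        mul_assoc]
      exact norm1_bil_le hk hK (memLp_coe u) (memLp_coe v)

theorem bilL_apply (hk : 0 ≤ k) (hK : IsKernel K κ) (u v : L1 k) :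
    bilL hk hK u v = toL1 k (bil K u v) := rfl

theorem coagL1_eq (hk : 0 ≤ k) (hK : IsKernel K κ) (u : L1 k) :
    coagL1 k K u = bilL hk hK u u := rfl

theorem norm_bilL_le (hk : 0 ≤ k) (hK : IsKernel K κ) (u v : L1 k) :
    ‖bilL hk hK u v‖ ≤ 3 / 2 * κ * (‖u‖ * ‖v‖) := by
  rw [bilL_apply, norm_toL1 (memLp_bil hk hK (memLp_coe u) (memLp_coe v)), norm_eq_norm1,
    norm_eq_norm1]
  exact norm1_bil_le hk hK (memLp_coe u) (memLp_coe v)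

theorem pairing_bilL (hk : 0 ≤ k) (hK : IsKernel K κ) (u v : L1 k) (hφ : IsTest k φ) :
    pairing k φ (bilL hk hK u v) =
      ∫ p, K p.1 p.2 * (u p.1 * v p.2) * (1 / 2 * φ (p.1 + p.2) - φ p.1) ∂quadrant :=
  pairing_bil hk hK u v hφ

end

section

variable {k κ ε : ℝ} {K : ℝ → ℝ → ℝ} {W : ℝ → ℝ → ℝ} {φ : ℝ → ℝ}

/-! ### The kernels and the weak form of the coagulation operator -/

theorem isKernel_of_admissible (hW : Admissible W) : IsKernel W 1 := by
  refine ⟨?_, zero_le_one, fun x y hx hy => ?_⟩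
  · rw [quadrant_eq]
    exact hW.continuousOn.aestronglyMeasurable measurableSet_quadrant
  · rw [abs_of_nonneg (hW.nonneg x y hx hy)]
    exact hW.le_one x y hx hy

theorem isKernel_two : IsKernel (fun _ _ => 2) 2 :=
  ⟨aestronglyMeasurable_const, by norm_num, fun _ _ _ _ => by norm_num⟩

theorem isKernel_kernel (hε : 0 ≤ ε) (hW : Admissible W) : IsKernel (kernel ε W) (2 + ε) := by
  refine ⟨?_, by positivity, fun x y hx hy => ?_⟩
  · exact aestronglyMeasurable_const.add ((isKernel_of_admissible hW).aesm.const_mul ε)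
  · have h0 := hW.nonneg x y hx hy
    have h1 := hW.le_one x y hx hy
    rw [kernel, abs_of_nonneg (by positivity)]
    nlinarith

theorem bilL_kernel (hk : 0 ≤ k) (hε : 0 ≤ ε) (hW : Admissible W) (u v : L1 k) :
    bilL hk (isKernel_kernel hε hW) u v =
      bilL hk isKernel_two u v + ε • bilL hk (isKernel_of_admissible hW) u v := by
  refine bern_injective hk fun z hz => ?_
  have hφ := isTest_bernFun hk hz.le
  obtain ⟨hm, C, hC⟩ := isTest_quad hk hφ
  rw [map_add, map_smul, bern, pairing_bilL hk _ _ _ hφ, pairing_bilL hk _ _ _ hφ,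
    pairing_bilL hk _ _ _ hφ, smul_eq_mul, ← integral_const_mul, ← integral_add
      (integrable_quad isKernel_two (memLp_coe _) (memLp_coe _) hm hC)
      ((integrable_quad (isKernel_of_admissible hW) (memLp_coe _) (memLp_coe _) hm hC).const_mul ε)]
  congr 1
  ext p
  simp only [kernel]
  ring

/-- Exchanging the two variables in the second term symmetrises the weak form. The bracket `φ(x + y)
- φ(x) - φ(y)` vanishes for `φ(x) = x`, which is conservation of mass, and factorises for `φ =
bernFun z`. -/
theorem pairing_bilL_symm (hk : 0 ≤ k) (hK : IsKernel K κ)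
    (hs : ∀ x y, 0 < x → 0 < y → K x y = K y x) (u v : L1 k) (hφ : IsTest k φ) :
    pairing k φ (bilL hk hK u v + bilL hk hK v u) =
      ∫ p, K p.1 p.2 * (u p.1 * v p.2) * (φ (p.1 + p.2) - φ p.1 - φ p.2) ∂quadrant := by
  obtain ⟨hm, C, hC⟩ := isTest_quad hk hφ
  rw [map_add, pairing_bilL hk _ _ _ hφ, pairing_bilL hk _ _ _ hφ]
  have hi1 := integrable_quad hK (memLp_coe u) (memLp_coe v) hm hC
  have hi2 := integrable_quad hK (memLp_coe v) (memLp_coe u) hm hC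
  have hswap : ∫ p, K p.1 p.2 * (v p.1 * u p.2) * (1 / 2 * φ (p.1 + p.2) - φ p.1) ∂quadrant =
      ∫ p, K p.2 p.1 * (v p.2 * u p.1) * (1 / 2 * φ (p.2 + p.1) - φ p.2) ∂quadrant := by
    rw [quadrant, ← integral_prod_swap]
    rfl
  have hi3 : Integrable (fun p : ℝ × ℝ =>
      K p.2 p.1 * (v p.2 * u p.1) * (1 / 2 * φ (p.2 + p.1) - φ p.2)) quadrant := by
    rw [quadrant] at hi2 ⊢
    exact hi2.swap
  rw [hswap, ← integral_add hi1 hi3]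
  refine integral_congr_ae ?_
  filter_upwards [ae_quadrant] with p hp
  rw [hs p.2 p.1 hp.2 hp.1, add_comm p.2 p.1]
  ring

theorem massL_bilL_symm (hk : 1 ≤ k) (hK : IsKernel K κ)
    (hs : ∀ x y, 0 < x → 0 < y → K x y = K y x) (u v : L1 k) :
    massL k (bilL (zero_le_one.trans hk) hK u v + bilL (zero_le_one.trans hk) hK v u) = 0 := by
  rw [massL, pairing_bilL_symm _ hK hs u v (isTest_id hk)]
  simp

theorem massL_bilL_self (hk : 1 ≤ k) (hK : IsKernel K κ)
    (hs : ∀ x y, 0 < x → 0 < y → K x y = K y x) (u : L1 k) :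
    massL k (bilL (zero_le_one.trans hk) hK u u) = 0 := by
  have := massL_bilL_symm hk hK hs u u
  rw [map_add] at this
  linarith

theorem kernel_symm (hW : Admissible W) (ε : ℝ) :
    ∀ x y, 0 < x → 0 < y → kernel ε W x y = kernel ε W y x := fun x y hx hy => by
  rw [kernel, kernel, hW.symm x y hx hy]

/-- The defect of additivity is a product: this is why the transform of coagulation with a constant
kernel is a product of transforms. -/
theorem bernFun_add (z x y : ℝ) :
    bernFun z (x + y) - bernFun z x - bernFun z y = -(bernFun z x * bernFun z y) := by
  simp only [bernFun]
  rw [mul_add, neg_add, Real.exp_add]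
  ring

theorem bern_bilL_symm (hk : 0 ≤ k) (hK : IsKernel K κ)
    (hs : ∀ x y, 0 < x → 0 < y → K x y = K y x) (u v : L1 k) {z : ℝ} (hz : 0 ≤ z) :
    bern k z (bilL hk hK u v + bilL hk hK v u) =
      -∫ p, K p.1 p.2 * ((bernFun z p.1 * u p.1) * (bernFun z p.2 * v p.2)) ∂quadrant := by
  rw [bern, pairing_bilL_symm hk hK hs u v (isTest_bernFun hk hz), ← integral_neg]
  congr 1
  ext p
  rw [bernFun_add]
  ring

theorem bern_bilL_two_symm (hk : 0 ≤ k) (u v : L1 k) {z : ℝ} (hz : 0 ≤ z) :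
    bern k z (bilL hk isKernel_two u v + bilL hk isKernel_two v u) =
      -2 * (bern k z u * bern k z v) := by
  rw [bern_bilL_symm hk _ (fun _ _ _ _ => rfl) u v hz, integral_const_mul, quadrant,
    integral_prod_mul (fun x => bernFun z x * u x) (fun x => bernFun z x * v x),
    bern_apply hk hz, bern_apply hk hz]
  ring

theorem bern_bilL_two_self (hk : 0 ≤ k) (u : L1 k) {z : ℝ} (hz : 0 ≤ z) :
    bern k z (bilL hk isKernel_two u u) = -(bern k z u) ^ 2 := by
  have := bern_bilL_two_symm hk u u hz
  rw [map_add] at this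
  linarith

/-! ### The dilation semigroup -/

section Dilation

variable {u v : ℝ → ℝ} {t : ℝ}

theorem integral_mul_dilate (φ u : ℝ → ℝ) (t : ℝ) :
    ∫ x in Ioi 0, φ x * dilate t u x =
      Real.exp t * ∫ x in Ioi 0, φ (Real.exp (-t) * x) * u x := by
  have h := integral_comp_mul_left_Ioi
    (fun y => Real.exp (2 * t) * (φ (Real.exp (-t) * y) * u y)) 0 (Real.exp_pos t)
  have h1 : ∀ x, Real.exp (-t) * (Real.exp t * x) = x := by
    intro x
    rw [← mul_assoc, ← Real.exp_add]
    simp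
  simp only [h1, mul_zero, smul_eq_mul] at h
  rw [integral_const_mul (Real.exp (2 * t)) fun x => φ (Real.exp (-t) * x) * u x, ← mul_assoc,
    ← Real.exp_neg, ← Real.exp_add, show -t + 2 * t = t by ring] at h
  rw [← h]
  congr 1
  ext x
  rw [dilate]
  ring

theorem norm1_dilate (u : ℝ → ℝ) (t : ℝ) :
    norm1 k (dilate t u) = Real.exp t * ∫ x in Ioi 0, |u x| * (1 + Real.exp (-t) * x) ^ k := by
  have h := integral_mul_dilate (fun x => (1 + x) ^ k) (fun x => |u x|) t
  rw [norm1]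
  simp only [mul_comm (|u _|)]
  rw [← h]
  congr 1
  ext x
  rw [dilate, dilate, abs_mul, Real.abs_exp]
  ring

theorem norm1_dilate_le (hk : 0 ≤ k) (ht : 0 ≤ t) (hu : MemLp u 1 (weightMeasure k)) :
    norm1 k (dilate t u) ≤ Real.exp t * norm1 k u := by
  rw [norm1_dilate, norm1]
  have he : Real.exp (-t) ≤ 1 := by simpa using ht
  refine mul_le_mul_of_nonneg_left ?_ (Real.exp_pos t).le
  refine integral_mono_of_nonneg ?_ (memLp_iff_norm.1 hu).2 ?_
  · filter_upwards [ae_restrict_mem measurableSet_Ioi] with x hx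
    have hx : 0 < x := hx
    simp only [Pi.zero_apply]
    positivity
  · filter_upwards [ae_restrict_mem measurableSet_Ioi] with x hx
    have hx : 0 < x := hx
    gcongr
    nlinarith

theorem ae_comp_dilation {p : ℝ → Prop} (h : ∀ᵐ x ∂volume.restrict (Ioi (0 : ℝ)), p x) (t : ℝ) :
    ∀ᵐ x ∂volume.restrict (Ioi (0 : ℝ)), p (Real.exp t * x) := by
  rw [ae_restrict_iff' measurableSet_Ioi] at h ⊢
  have hq : Measure.QuasiMeasurePreserving (fun x : ℝ => Real.exp t * x) volume volume := by
    refine ⟨by fun_prop, ?_⟩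
    rw [Real.map_volume_mul_left (Real.exp_pos t).ne']
    exact Measure.smul_absolutelyContinuous
  filter_upwards [hq.ae h] with x hx hx0
  have hx0 : 0 < x := hx0
  exact hx (mul_pos (Real.exp_pos t) hx0)

theorem dilate_congr (h : u =ᵐ[volume.restrict (Ioi 0)] v) (t : ℝ) :
    dilate t u =ᵐ[volume.restrict (Ioi 0)] dilate t v := by
  filter_upwards [ae_comp_dilation h t] with x hx
  rw [dilate, dilate, hx]

/-- The dilation `S_t` as an operator on `L¹_k`; for `t ≤ 0` this is the identity. -/
def dilL (hk : 0 ≤ k) (t : ℝ) : L1 k →L[ℝ] L1 k :=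
  LinearMap.mkContinuous
    -- Freezing the operator at negative times makes `t ↦ dilL hk t u` continuous on all of `ℝ`, so
    -- that no one-sided continuity statements are needed.
    { toFun := fun u => dilateL1 k (max t 0) u
      map_add' := fun u v => by
        have hm := fun u : L1 k => memLp_dilate hk (le_max_right t 0) (memLp_coe u)
        rw [dilateL1, toL1_congr (hm (u + v)) (dilate_congr (coeFn_add' u v) _)]
        refine L1_ext ?_
        have h3 : MemLp (fun x => dilate (max t 0) u x + dilate (max t 0) v x) 1
            (weightMeasure k) := (hm u).add (hm v)
        have h4 : dilate (max t 0) (fun x => u x + v x) =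
            fun x => dilate (max t 0) u x + dilate (max t 0) v x := by
          ext x
          simp only [dilate]
          ring
        rw [h4]
        filter_upwards [coeFn_toL1 h3, coeFn_add' (dilateL1 k (max t 0) u)
          (dilateL1 k (max t 0) v), coeFn_toL1 (hm u), coeFn_toL1 (hm v)] with x h5 h6 h7 h8
        rw [h5, h6, dilateL1, dilateL1, h7, h8]
      map_smul' := fun c u => by
        have hm := fun u : L1 k => memLp_dilate hk (le_max_right t 0) (memLp_coe u)
        rw [dilateL1, toL1_congr (hm (c • u)) (dilate_congr (coeFn_smul' c u) _)]
        refine L1_ext ?_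
        have h3 : MemLp (fun x => c * dilate (max t 0) u x) 1
            (weightMeasure k) := (hm u).const_mul c
        have h4 : dilate (max t 0) (fun x => c * u x) =
            fun x => c * dilate (max t 0) u x := by
          ext x
          simp only [dilate]
          ring
        rw [h4]
        simp only [RingHom.id_apply]
        filter_upwards [coeFn_toL1 h3, coeFn_smul' c (dilateL1 k (max t 0) u),
          coeFn_toL1 (hm u)] with x h5 h6 h7
        rw [h5, h6, dilateL1, h7] }
    (Real.exp (max t 0))
    fun u => by
      have hm := memLp_dilate hk (le_max_right t 0) (memLp_coe u)
      simp only [LinearMap.coe_mk, AddHom.coe_mk]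
      rw [dilateL1, norm_toL1 hm, norm_eq_norm1]
      exact norm1_dilate_le hk (le_max_right t 0) (memLp_coe u)

theorem dilL_apply (hk : 0 ≤ k) (ht : 0 ≤ t) (u : L1 k) : dilL hk t u = dilateL1 k t u := by
  have : dilL hk t u = dilateL1 k (max t 0) u := rfl
  rw [this, max_eq_left ht]

theorem dilL_of_nonpos (hk : 0 ≤ k) (ht : t ≤ 0) (u : L1 k) : dilL hk t u = u := by
  have : dilL hk t u = dilateL1 k (max t 0) u := rfl
  rw [this, max_eq_right ht, dilateL1]
  have : dilate 0 u = u := by ext x; simp [dilate]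
  rw [this, toL1_coe]

theorem coeFn_dilL (hk : 0 ≤ k) (ht : 0 ≤ t) (u : L1 k) :
    dilL hk t u =ᵐ[volume.restrict (Ioi 0)] dilate t u := by
  rw [dilL_apply hk ht]
  exact coeFn_toL1 (memLp_dilate hk ht (memLp_coe u))

theorem norm_dilL_le (hk : 0 ≤ k) (ht : 0 ≤ t) (u : L1 k) :
    ‖dilL hk t u‖ ≤ Real.exp t * ‖u‖ := by
  rw [dilL_apply hk ht, dilateL1, norm_toL1 (memLp_dilate hk ht (memLp_coe u)), norm_eq_norm1]
  exact norm1_dilate_le hk ht (memLp_coe u)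

theorem bern_dilL (hk : 0 ≤ k) (ht : 0 ≤ t) {z : ℝ} (hz : 0 ≤ z) (u : L1 k) :
    bern k z (dilL hk t u) = Real.exp t * bern k (Real.exp (-t) * z) u := by
  rw [bern_apply hk hz, bern_apply hk (by positivity), pairing_congr (coeFn_dilL hk ht u),
    integral_mul_dilate]
  congr 2
  ext x
  simp only [bernFun]
  ring_nf

theorem massL_dilL (hk : 1 ≤ k) (t : ℝ) (u : L1 k) :
    massL k (dilL (zero_le_one.trans hk) t u) = massL k u := by
  rcases le_total t 0 with ht | ht
  · rw [dilL_of_nonpos _ ht]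
  rw [massL_apply hk, massL_apply hk, mass, mass, pairing_congr (coeFn_dilL _ ht u),
    integral_mul_dilate, ← integral_const_mul]
  congr 1
  ext x
  rw [← mul_assoc, ← mul_assoc, ← Real.exp_add]
  simp

theorem dilL_add (hk : 0 ≤ k) {s t : ℝ} (hs : 0 ≤ s) (ht : 0 ≤ t) (u : L1 k) :
    dilL hk (s + t) u = dilL hk s (dilL hk t u) := by
  refine bern_injective hk fun z hz => ?_
  rw [bern_dilL hk (by positivity) hz.le, bern_dilL hk hs hz.le,
    bern_dilL hk ht (by positivity), Real.exp_add, neg_add, Real.exp_add, mul_assoc]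
  congr 3
  ring_nf

/-- Nonnegativity almost everywhere on `(0, ∞)`. -/
def Nonneg (u : ℝ → ℝ) : Prop := ∀ᵐ x ∂volume.restrict (Ioi (0 : ℝ)), 0 ≤ u x

theorem nonneg_dilL (hk : 0 ≤ k) {u : L1 k} (hu : Nonneg u) (t : ℝ) : Nonneg (dilL hk t u) := by
  rcases le_total t 0 with ht | ht
  · rwa [dilL_of_nonpos _ ht]
  filter_upwards [coeFn_dilL hk ht u, ae_comp_dilation hu t] with x h1 h2
  rw [h1, dilate]
  positivity

end Dilation

end

section

variable {k : ℝ}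

/-! ### Strong continuity of the dilations -/

theorem isLocallyFinite_weightMeasure (hk : 0 ≤ k) :
    IsLocallyFiniteMeasure (weightMeasure k) := by
  have hc : Continuous fun x : ℝ => (1 + x) ^ k :=
    Continuous.rpow_const (by fun_prop) fun _ => Or.inr hk
  exact IsLocallyFiniteMeasure.withDensity_ofReal hc

theorem continuous_dilL_of_compact (hk : 0 ≤ k) {g : ℝ → ℝ} (hg : Continuous g)
    (hgc : HasCompactSupport g) (hgm : MemLp g 1 (weightMeasure k)) :
    Continuous fun t => dilL hk t (toL1 k g) := by
  obtain ⟨B, hB⟩ := hg.bounded_above_of_compact_support hgc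
  obtain ⟨R, hR0, hR⟩ : ∃ R, 0 < R ∧ ∀ x, R < x → g x = 0 := by
    obtain ⟨R, hR⟩ := hgc.isCompact.isBounded.subset_closedBall 0
    refine ⟨|R| + 1, by positivity, fun x hx => ?_⟩
    by_contra hne
    have := hR (subset_tsupport g hne)
    rw [mem_closedBall_zero_iff, Real.norm_eq_abs] at this
    have := le_abs_self x
    have := le_abs_self R
    linarith
  have hB0 : 0 ≤ B := (norm_nonneg _).trans (hB 0)
  rw [continuous_iff_continuousAt]
  intro t₀
  rw [ContinuousAt, tendsto_iff_norm_sub_tendsto_zero]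
  have hnorm : ∀ t, ‖dilL hk t (toL1 k g) - dilL hk t₀ (toL1 k g)‖ =
      ∫ x in Ioi 0, |dilate (max t 0) g x - dilate (max t₀ 0) g x| * (1 + x) ^ k := by
    intro t
    rw [norm_eq_norm1, norm1]
    refine integral_congr_ae ?_
    have h1 : ∀ t, dilL hk t (toL1 k g) =ᵐ[volume.restrict (Ioi 0)] dilate (max t 0) g := by
      intro t
      have h2 : dilL hk t (toL1 k g) = dilL hk (max t 0) (toL1 k g) := by
        rcases le_total t 0 with ht | ht
        · rw [max_eq_right ht, dilL_of_nonpos _ ht, dilL_of_nonpos _ le_rfl]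
        · rw [max_eq_left ht]
      rw [h2]
      exact (coeFn_dilL hk (le_max_right _ _) _).trans (dilate_congr (coeFn_toL1 hgm) _)
    filter_upwards [coeFn_sub' (dilL hk t (toL1 k g)) (dilL hk t₀ (toL1 k g)), h1 t, h1 t₀]
      with x h3 h4 h5
    rw [h3, h4, h5]
  simp only [hnorm]
  set T := max t₀ 0 + 1 with hT
  have hdil : ∀ t x, 0 < x → 0 ≤ t → t ≤ T →
      |dilate t g x| ≤ Real.exp (2 * T) * B ∧ (R < x → dilate t g x = 0) := by
    intro t x hx ht0 htT
    have h2 : Real.exp (2 * t) ≤ Real.exp (2 * T) := by gcongr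
    constructor
    · rw [dilate, abs_mul, Real.abs_exp]
      have := hB (Real.exp t * x)
      rw [Real.norm_eq_abs] at this
      gcongr
    · intro hxR
      have h1 : 1 ≤ Real.exp t := Real.one_le_exp ht0
      rw [dilate, hR _ (by nlinarith), mul_zero]
  suffices h : Filter.Tendsto (fun t => ∫ x in Ioi 0,
      |dilate (max t 0) g x - dilate (max t₀ 0) g x| * (1 + x) ^ k) (nhds t₀)
      (nhds (∫ x in Ioi 0,
        |dilate (max t₀ 0) g x - dilate (max t₀ 0) g x| * (1 + x) ^ k)) by simpa using h
  refine tendsto_integral_filter_of_dominated_convergence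
    ((Ioc 0 R).indicator fun _ => 2 * (Real.exp (2 * T) * B) * (1 + R) ^ k) ?_ ?_ ?_ ?_
  · refine Filter.Eventually.of_forall fun t => Measurable.aestronglyMeasurable ?_
    have := hg.measurable
    unfold dilate
    fun_prop
  · have hev : ∀ᶠ t in nhds t₀, max t 0 ≤ T := by
      have hc : Continuous fun t : ℝ => max t 0 := by fun_prop
      have : (fun t : ℝ => max t 0) t₀ < T := by simp [hT]
      exact (hc.continuousAt.eventually_lt continuousAt_const this).mono fun _ h => h.le
    filter_upwards [hev] with t ht
    filter_upwards [ae_restrict_mem measurableSet_Ioi] with x hx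
    have hx : 0 < x := hx
    obtain ⟨h1, h2⟩ := hdil (max t 0) x hx (le_max_right _ _) ht
    obtain ⟨h3, h4⟩ := hdil (max t₀ 0) x hx (le_max_right _ _) (by simp [hT])
    rw [norm_mul, Real.norm_eq_abs, Real.norm_eq_abs, abs_abs,
      abs_of_nonneg (by positivity : (0 : ℝ) ≤ (1 + x) ^ k)]
    by_cases hxR : x ≤ R
    · rw [indicator_of_mem (show x ∈ Ioc 0 R from ⟨hx, hxR⟩)]
      have h5 : |dilate (max t 0) g x - dilate (max t₀ 0) g x| ≤ 2 * (Real.exp (2 * T) * B) :=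
        (abs_sub _ _).trans (by linarith)
      gcongr
    · push Not at hxR
      rw [h2 hxR, h4 hxR, sub_zero, abs_zero, zero_mul]
      exact indicator_nonneg (fun _ _ => by positivity) _
  · exact ((integrable_indicator_iff measurableSet_Ioc).2
      (integrableOn_const (by simp))).integrableOn
  · filter_upwards with x
    have : Continuous fun t => |dilate (max t 0) g x - dilate (max t₀ 0) g x| * (1 + x) ^ k := by
      unfold dilate
      fun_prop
    exact this.tendsto t₀

theorem norm_dilL_le_of_le (hk : 0 ≤ k) {t T : ℝ} (htT : t ≤ T) (hT : 0 ≤ T) (u : L1 k) :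
    ‖dilL hk t u‖ ≤ Real.exp T * ‖u‖ := by
  rcases le_total t 0 with ht | ht
  · rw [dilL_of_nonpos hk ht]
    nlinarith [norm_nonneg u, Real.one_le_exp hT]
  · refine (norm_dilL_le hk ht u).trans ?_
    gcongr

/-- Approximation by compactly supported continuous functions, for which dominated convergence
applies; the bound `e^T` on the operators with `t ≤ T` makes the approximation locally uniform in
`t`. -/
theorem continuous_dilL (hk : 0 ≤ k) (u : L1 k) : Continuous fun t => dilL hk t u := by
  have := isLocallyFinite_weightMeasure hk
  rw [continuous_iff_continuousAt]
  intro t₀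
  refine continuousAt_of_locally_uniform_approx_of_continuousAt fun s hs => ?_
  obtain ⟨δ, hδ, hs⟩ := Metric.mem_uniformity_dist.1 hs
  set T := max t₀ 0 + 1 with hT
  have hT0 : 0 ≤ T := by positivity
  obtain ⟨g, hgc, hg1, hg2, hg3⟩ := Integrable.exists_hasCompactSupport_integral_sub_le
    (memLp_one_iff_integrable.1 (memLp_coe u)) (ε := δ / (2 * Real.exp T)) (by positivity)
  have hgm : MemLp g 1 (weightMeasure k) := memLp_one_iff_integrable.2 hg3
  refine ⟨Iio T, Iio_mem_nhds (by rw [hT]; linarith [le_max_left t₀ 0]),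
    fun t => dilL hk t (toL1 k g), (continuous_dilL_of_compact hk hg2 hgc hgm).continuousAt,
    fun t ht => hs ?_⟩
  rw [dist_eq_norm, ← map_sub]
  have h1 : ‖u - toL1 k g‖ ≤ δ / (2 * Real.exp T) := by
    refine le_trans (le_of_eq ?_) hg1
    rw [norm_eq_norm1, norm1, integral_weightMeasure]
    refine integral_congr_ae ?_
    filter_upwards [coeFn_sub' u (toL1 k g), coeFn_toL1 hgm] with x h3 h4
    rw [h3, h4, Real.norm_eq_abs]
  calc ‖dilL hk t (u - toL1 k g)‖ ≤ Real.exp T * ‖u - toL1 k g‖ :=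
        norm_dilL_le_of_le hk (le_of_lt ht) hT0 _
    _ ≤ Real.exp T * (δ / (2 * Real.exp T)) := by gcongr
    _ = δ / 2 := by field_simp
    _ < δ := by linarith

theorem continuous_dilL_comp (hk : 0 ≤ k) {a : ℝ → ℝ} {g : ℝ → L1 k} (ha : Continuous a)
    (hg : Continuous g) : Continuous fun s => dilL hk (a s) (g s) := by
  rw [continuous_iff_continuousAt]
  intro s₀
  rw [ContinuousAt, tendsto_iff_norm_sub_tendsto_zero]
  set T := max (a s₀) 0 + 1 with hT
  have hT0 : 0 ≤ T := by positivity
  have hlim : Filter.Tendsto (fun s => Real.exp T * ‖g s - g s₀‖ +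
      ‖dilL hk (a s) (g s₀) - dilL hk (a s₀) (g s₀)‖) (nhds s₀) (nhds 0) := by
    have h1 : Continuous fun s => Real.exp T * ‖g s - g s₀‖ +
        ‖dilL hk (a s) (g s₀) - dilL hk (a s₀) (g s₀)‖ := by
      have := (continuous_dilL hk (g s₀)).comp ha
      have h2 : Continuous fun s => dilL hk (a s) (g s₀) := this
      fun_prop
    simpa using h1.tendsto s₀
  refine squeeze_zero' (Filter.Eventually.of_forall fun _ => norm_nonneg _) ?_ hlim
  have hev : ∀ᶠ s in nhds s₀, a s < T :=
    ha.continuousAt.eventually_lt continuousAt_const (by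
      rw [hT]; linarith [le_max_left (a s₀) 0])
  filter_upwards [hev] with s hs
  have h3 : dilL hk (a s) (g s) - dilL hk (a s₀) (g s₀) = dilL hk (a s) (g s - g s₀) +
      (dilL hk (a s) (g s₀) - dilL hk (a s₀) (g s₀)) := by
    rw [map_sub]
    abel
  rw [h3]
  refine (norm_add_le _ _).trans ?_
  gcongr
  exact norm_dilL_le_of_le hk hs.le hT0 _

end

section

variable {k : ℝ}

/-! ### The exponential profile and the linearised semigroup -/

theorem integrableOn_weight_exp (k : ℝ) :
    IntegrableOn (fun x : ℝ => (1 + x) ^ k * Real.exp (-x)) (Ioi 0) := by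
  refine integrable_of_isBigO_exp_neg (b := 1 / 2) (by norm_num) ?_ ?_
  · refine ContinuousOn.mul (fun x hx => ?_) (by fun_prop)
    have hx : 0 ≤ x := hx
    exact (ContinuousAt.rpow_const (by fun_prop) (Or.inl (by linarith))).continuousWithinAt
  · have h1 := (isLittleO_rpow_exp_pos_mul_atTop k (by norm_num : (0 : ℝ) < 1 / 2)).isBigO
    have h2 := h1.comp_tendsto (Filter.tendsto_atTop_add_const_left Filter.atTop (1 : ℝ)
      Filter.tendsto_id)
    have h3 := h2.mul (Asymptotics.isBigO_refl (fun x : ℝ => Real.exp (-x)) Filter.atTop)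
    refine h3.trans (Asymptotics.IsBigO.of_bound (Real.exp (1 / 2)) ?_)
    refine Filter.Eventually.of_forall fun x => ?_
    simp only [Function.comp, id, ← Real.exp_add, Real.norm_eq_abs, Real.abs_exp]
    apply le_of_eq
    congr 1
    ring

/-- `e^{-x}`, the profile for the kernel `2`. -/
def expFun (x : ℝ) : ℝ := Real.exp (-x)

/-- `x e^{-x}`, the convolution square of `expFun` on the half-line. -/
def expFun₂ (x : ℝ) : ℝ := x * Real.exp (-x)

theorem memLp_expFun (k : ℝ) : MemLp expFun 1 (weightMeasure k) :=
  (memLp_iff _ _).2 (integrableOn_weight_exp k)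

theorem memLp_expFun₂ (k : ℝ) : MemLp expFun₂ 1 (weightMeasure k) := by
  rw [memLp_iff]
  refine Integrable.mono (integrableOn_weight_exp (k + 1))
    (show Measurable fun x : ℝ => (1 + x) ^ k * (x * Real.exp (-x)) by
      fun_prop).aestronglyMeasurable ?_
  filter_upwards [ae_restrict_mem measurableSet_Ioi] with x hx
  have hx : 0 < x := hx
  rw [expFun₂, Real.norm_of_nonneg (by positivity), Real.norm_of_nonneg (by positivity),
    Real.rpow_add_one (by positivity)]
  have : 0 ≤ (1 + x) ^ k * Real.exp (-x) := by positivity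
  nlinarith

theorem integral_exp_neg_mul {r : ℝ} (hr : 0 < r) :
    ∫ x in Ioi (0 : ℝ), Real.exp (-(r * x)) = 1 / r := by
  have := Real.integral_rpow_mul_exp_neg_mul_Ioi (a := 1) one_pos hr
  simpa using this

theorem integral_mul_exp_neg_mul {r : ℝ} (hr : 0 < r) :
    ∫ x in Ioi (0 : ℝ), x * Real.exp (-(r * x)) = 1 / r ^ 2 := by
  have := Real.integral_rpow_mul_exp_neg_mul_Ioi (a := 2) two_pos hr
  norm_num at this
  rw [this]
  norm_num

theorem integrableOn_exp_neg_mul {r : ℝ} (hr : 0 < r) :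
    IntegrableOn (fun x : ℝ => Real.exp (-(r * x))) (Ioi 0) := by
  have := integral_exp_neg_mul hr
  -- The integral of a non-integrable function is `0` by convention, so a nonzero value proves
  -- integrability.
  by_contra h
  rw [integral_undef h] at this
  have : 0 < 1 / r := by positivity
  linarith

theorem integrableOn_mul_exp_neg_mul {r : ℝ} (hr : 0 < r) :
    IntegrableOn (fun x : ℝ => x * Real.exp (-(r * x))) (Ioi 0) := by
  have := integral_mul_exp_neg_mul hr
  by_contra h
  rw [integral_undef h] at this
  have : 0 < 1 / r ^ 2 := by positivity
  linarith

theorem integral_bernFun_expFun {z : ℝ} (hz : 0 ≤ z) :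
    ∫ x in Ioi 0, bernFun z x * expFun x = z / (1 + z) := by
  have h : ∀ x, bernFun z x * expFun x = Real.exp (-(1 * x)) - Real.exp (-((1 + z) * x)) := by
    intro x
    rw [bernFun, expFun, sub_mul, ← Real.exp_add]
    ring_nf
  simp only [h]
  rw [integral_sub (integrableOn_exp_neg_mul one_pos)
    (integrableOn_exp_neg_mul (by positivity)), integral_exp_neg_mul one_pos,
    integral_exp_neg_mul (by positivity)]
  field_simp
  ring

theorem integral_bernFun_expFun₂ {z : ℝ} (hz : 0 ≤ z) :
    ∫ x in Ioi 0, bernFun z x * expFun₂ x = 1 - 1 / (1 + z) ^ 2 := by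
  have h : ∀ x, bernFun z x * expFun₂ x =
      x * Real.exp (-(1 * x)) - x * Real.exp (-((1 + z) * x)) := by
    intro x
    rw [bernFun, expFun₂, sub_mul, mul_left_comm (Real.exp (-(z * x))), ← Real.exp_add]
    ring_nf
  simp only [h]
  rw [integral_sub (integrableOn_mul_exp_neg_mul one_pos)
    (integrableOn_mul_exp_neg_mul (by positivity)), integral_mul_exp_neg_mul one_pos,
    integral_mul_exp_neg_mul (by positivity)]
  norm_num

/-- The class of `e^{-x}` in `L¹_k`. -/
def expL (k : ℝ) : L1 k := toL1 k expFun

/-- The class of `x e^{-x}` in `L¹_k`. -/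
def expL₂ (k : ℝ) : L1 k := toL1 k expFun₂

theorem bern_expL (hk : 0 ≤ k) {z : ℝ} (hz : 0 ≤ z) : bern k z (expL k) = z / (1 + z) := by
  rw [bern, expL, pairing_toL1 (isTest_bernFun hk hz) (memLp_expFun k),
    integral_bernFun_expFun hz]

theorem bern_expL₂ (hk : 0 ≤ k) {z : ℝ} (hz : 0 ≤ z) :
    bern k z (expL₂ k) = 1 - 1 / (1 + z) ^ 2 := by
  rw [bern, expL₂, pairing_toL1 (isTest_bernFun hk hz) (memLp_expFun₂ k),
    integral_bernFun_expFun₂ hz]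

theorem massL_expL (hk : 1 ≤ k) : massL k (expL k) = 1 := by
  rw [massL, expL, pairing_toL1 (isTest_id hk) (memLp_expFun k)]
  have := integral_mul_exp_neg_mul one_pos
  simpa [expFun] using this

theorem nonneg_expL (k : ℝ) : Nonneg (expL k) := by
  filter_upwards [coeFn_toL1 (memLp_expFun k)] with x hx
  rw [expL, hx]
  exact (Real.exp_pos _).le

/-- The linearised coagulation operator `h ↦ b(E, h) + b(h, E)` for the kernel `2`. -/
def linB (hk : 0 ≤ k) (E : L1 k) : L1 k →L[ℝ] L1 k :=
  bilL hk isKernel_two E + (bilL hk isKernel_two).flip E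

theorem linB_apply (hk : 0 ≤ k) (E u : L1 k) :
    linB hk E u = bilL hk isKernel_two E u + bilL hk isKernel_two u E := rfl

theorem bern_linB (hk : 0 ≤ k) (E u : L1 k) {z : ℝ} (hz : 0 ≤ z) :
    bern k z (linB hk E u) = -2 * (bern k z E * bern k z u) := by
  rw [linB_apply, bern_bilL_two_symm hk E u hz]

/-- Convolution with `E` minus the total integral times `E`. -/
def convL (hk : 0 ≤ k) (E : L1 k) : L1 k →L[ℝ] L1 k :=
  ContinuousLinearMap.id ℝ _ + (1 / 2 : ℝ) • linB hk E

theorem convL_apply (hk : 0 ≤ k) (E u : L1 k) :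
    convL hk E u = u + (1 / 2 : ℝ) • linB hk E u := rfl

/-- If `∫ E = 1`, the factor `1 - bern k z E` is the Laplace transform of `E`: it is `1 / (1 + z)`
for `e^{-x}` and `1 / (1 + z)²` for `x e^{-x}`. -/
theorem bern_convL (hk : 0 ≤ k) (E u : L1 k) {z : ℝ} (hz : 0 ≤ z) :
    bern k z (convL hk E u) = (1 - bern k z E) * bern k z u := by
  rw [convL_apply, map_add, map_smul, bern_linB hk E u hz, smul_eq_mul]
  ring

theorem massL_linB (hk : 1 ≤ k) (E u : L1 k) :
    massL k (linB (zero_le_one.trans hk) E u) = 0 := by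
  rw [linB_apply, massL_bilL_symm hk _ fun _ _ _ _ => rfl]

/-- The semigroup generated by the linearisation of the self-similar equation with kernel `2` at
`e^{-x}`. -/
def linT (hk : 0 ≤ k) (t : ℝ) : L1 k →L[ℝ] L1 k :=
  Real.exp (-(2 * t)) • dilL hk t +
    (2 * Real.exp (-t) * (1 - Real.exp (-t))) • (convL hk (expL k)).comp (dilL hk t) +
    (1 - Real.exp (-t)) ^ 2 • (convL hk (expL₂ k)).comp (dilL hk t)

theorem linT_apply (hk : 0 ≤ k) (t : ℝ) (u : L1 k) :
    linT hk t u = Real.exp (-(2 * t)) • dilL hk t u +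
      (2 * Real.exp (-t) * (1 - Real.exp (-t))) • convL hk (expL k) (dilL hk t u) +
      (1 - Real.exp (-t)) ^ 2 • convL hk (expL₂ k) (dilL hk t u) := rfl

/-- The three terms of `linT` are those of the expansion of the square of `(1 + e^{-t} z) / (1 + z)
= e^{-t} + (1 - e^{-t}) / (1 + z)`. This multiplier is what solving `∂ₜF = F - z F' - 2 z F / (1 +
z)` along characteristics produces. -/
theorem bern_linT (hk : 0 ≤ k) {t : ℝ} (ht : 0 ≤ t) (u : L1 k) {z : ℝ} (hz : 0 ≤ z) :
    bern k z (linT hk t u) = Real.exp t * ((1 + Real.exp (-t) * z) / (1 + z)) ^ 2 *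
      bern k (Real.exp (-t) * z) u := by
  rw [linT_apply, map_add, map_add, map_smul, map_smul, map_smul, bern_convL hk _ _ hz,
    bern_convL hk _ _ hz, bern_dilL hk ht hz, bern_expL hk hz, bern_expL₂ hk hz]
  have h : Real.exp (-(2 * t)) = Real.exp (-t) ^ 2 := by
    rw [← Real.exp_nat_mul]
    ring_nf
  rw [h]
  simp only [smul_eq_mul]
  have : 1 + z ≠ 0 := by positivity
  field_simp
  ring

theorem linT_add (hk : 0 ≤ k) {s t : ℝ} (hs : 0 ≤ s) (ht : 0 ≤ t) (u : L1 k) :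
    linT hk (s + t) u = linT hk s (linT hk t u) := by
  refine bern_injective hk fun z hz => ?_
  rw [bern_linT hk (by positivity) _ hz.le, bern_linT hk hs _ hz.le,
    bern_linT hk ht _ (by positivity), Real.exp_add, neg_add, Real.exp_add,
    show Real.exp (-s) * Real.exp (-t) * z = Real.exp (-t) * (Real.exp (-s) * z) by ring]
  have : 1 + z ≠ 0 := by positivity
  have : 1 + Real.exp (-s) * z ≠ 0 := by positivity
  field_simp

theorem linT_zero (hk : 0 ≤ k) (u : L1 k) : linT hk 0 u = u := by
  rw [linT_apply, dilL_of_nonpos hk le_rfl]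
  simp

theorem continuous_linT_comp (hk : 0 ≤ k) {a : ℝ → ℝ} {g : ℝ → L1 k} (ha : Continuous a)
    (hg : Continuous g) : Continuous fun s => linT hk (a s) (g s) := by
  have := continuous_dilL_comp hk ha hg
  simp only [linT_apply]
  fun_prop

/-! ### Variation of constants -/

theorem abs_bernFun_sub_le {z z' x : ℝ} (hz : 0 ≤ z) (hz' : 0 ≤ z') (hx : 0 ≤ x) :
    |bernFun z x - bernFun z' x| ≤ |z - z'| * x := by
  wlog h : z' ≤ z generalizing z z'
  · rw [abs_sub_comm, abs_sub_comm z]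
    exact this hz' hz (by linarith)
  have h1 : bernFun z x - bernFun z' x = Real.exp (-(z' * x)) * bernFun (z - z') x := by
    rw [bernFun, bernFun, bernFun, mul_sub, ← Real.exp_add]
    ring_nf
  have h2 := bernFun_le (z - z') x
  have h3 : 0 ≤ bernFun (z - z') x := bernFun_nonneg (mul_nonneg (by linarith) hx)
  have h4 : Real.exp (-(z' * x)) ≤ 1 := by
    rw [Real.exp_le_one_iff]
    have := mul_nonneg hz' hx
    linarith
  rw [h1, abs_of_nonneg (by positivity), abs_of_nonneg (by linarith)]
  nlinarith

/-- `z ↦ 1 - e^{-zx}` is Lipschitz with constant `x`, so the transform is Lipschitz in `z` with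
constant the norm in `L¹_k`; this is where `k ≥ 1` enters. -/
theorem continuous_bern_comp (hk : 1 ≤ k) {a : ℝ → ℝ} {g : ℝ → L1 k} (ha : Continuous a)
    (ha0 : ∀ s, 0 ≤ a s) (hg : Continuous g) : Continuous fun s => bern k (a s) (g s) := by
  have hk0 : 0 ≤ k := zero_le_one.trans hk
  rw [continuous_iff_continuousAt]
  intro s₀
  rw [ContinuousAt, tendsto_iff_norm_sub_tendsto_zero]
  have hlim : Filter.Tendsto (fun s => |a s - a s₀| * ‖g s‖ +
      ‖bern k (a s₀) (g s) - bern k (a s₀) (g s₀)‖) (nhds s₀) (nhds 0) := by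
    have h1 : Continuous fun s => |a s - a s₀| * ‖g s‖ +
        ‖bern k (a s₀) (g s) - bern k (a s₀) (g s₀)‖ := by fun_prop
    simpa using h1.tendsto s₀
  refine squeeze_zero (fun _ => norm_nonneg _) (fun s => ?_) hlim
  have h2 : bern k (a s) (g s) - bern k (a s₀) (g s₀) = (bern k (a s) (g s) -
      bern k (a s₀) (g s)) + (bern k (a s₀) (g s) - bern k (a s₀) (g s₀)) := by ring
  rw [h2]
  refine (norm_add_le _ _).trans ?_
  gcongr
  have hi := fun s => (isTest_bernFun hk0 (ha0 s)).integrable (memLp_coe (g s))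
  rw [bern_apply hk0 (ha0 s), bern_apply hk0 (ha0 s₀), ← integral_sub
    ((isTest_bernFun hk0 (ha0 s)).integrable (memLp_coe (g s)))
    ((isTest_bernFun hk0 (ha0 s₀)).integrable (memLp_coe (g s))), norm_eq_norm1, Real.norm_eq_abs]
  simp only [← sub_mul]
  refine abs_integral_mul_le (φ := fun x => bernFun (a s) x - bernFun (a s₀) x) (fun x hx => ?_)
    (memLp_coe (g s))
  refine (abs_bernFun_sub_le (ha0 s) (ha0 s₀) hx.le).trans ?_
  gcongr
  linarith [le_weight hk hx]

/-- `u` solves `∂ₜ u = 2 u + x ∂ₓ u + g`, expressed by the Bernstein transform along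
characteristics. -/
def CharSol (k : ℝ) (u g : ℝ → L1 k) : Prop :=
  ∀ ζ, 0 < ζ → ∀ t, 0 ≤ t → Real.exp (-t) * bern k (Real.exp t * ζ) (u t) =
    bern k ζ (u 0) + ∫ s in (0 : ℝ)..t, Real.exp (-s) * bern k (Real.exp s * ζ) (g s)

theorem continuous_char (hk : 1 ≤ k) {g : ℝ → L1 k} (hg : Continuous g) {ζ : ℝ} (hζ : 0 < ζ) :
    Continuous fun s => Real.exp (-s) * bern k (Real.exp s * ζ) (g s) :=
  Continuous.mul (by fun_prop)
    (continuous_bern_comp hk (by fun_prop) (fun _ => by positivity) hg)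

/-- Taking the transform of Duhamel's formula at the moving point `e^t ζ` removes the semigroup.
What remains is a scalar integral equation which may be differentiated in `t`, although the
semigroup itself is only strongly continuous. -/
theorem charSol_of_mild (hk : 1 ≤ k) {u g : ℝ → L1 k} (hg : Continuous g)
    (h : ∀ t, 0 ≤ t → u t = dilL (zero_le_one.trans hk) t (u 0) +
      ∫ s in (0 : ℝ)..t, dilL (zero_le_one.trans hk) (t - s) (g s)) : CharSol k u g := by
  have hk0 : 0 ≤ k := zero_le_one.trans hk
  intro ζ hζ t ht
  have hc : Continuous fun s => dilL hk0 (t - s) (g s) :=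
    continuous_dilL_comp hk0 (by fun_prop) hg
  rw [h t ht, map_add, ← ContinuousLinearMap.intervalIntegral_comp_comm _
    (hc.intervalIntegrable _ _), bern_dilL hk0 ht (by positivity), mul_add, ← mul_assoc,
    ← mul_assoc, ← Real.exp_add, ← intervalIntegral.integral_const_mul]
  congr 1
  · simp
  · refine intervalIntegral.integral_congr fun s hs => ?_
    rw [uIcc_of_le ht] at hs
    rw [bern_dilL hk0 (by linarith [hs.2]) (by positivity), ← mul_assoc, ← mul_assoc,
      ← Real.exp_add, ← Real.exp_add]
    ring_nf

theorem mild_of_charSol (hk : 1 ≤ k) {u g : ℝ → L1 k} (hg : Continuous g) (h : CharSol k u g)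
    {t : ℝ} (ht : 0 ≤ t) : u t = dilL (zero_le_one.trans hk) t (u 0) +
      ∫ s in (0 : ℝ)..t, dilL (zero_le_one.trans hk) (t - s) (g s) := by
  have hk0 : 0 ≤ k := zero_le_one.trans hk
  refine bern_injective hk0 fun z hz => ?_
  have hc : Continuous fun s => dilL hk0 (t - s) (g s) :=
    continuous_dilL_comp hk0 (by fun_prop) hg
  have h1 := h (Real.exp (-t) * z) (by positivity) t ht
  rw [← mul_assoc, ← Real.exp_add, add_neg_cancel, Real.exp_zero, one_mul] at h1
  have h2 : bern k z (u t) = Real.exp t * (Real.exp (-t) * bern k z (u t)) := by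
    rw [← mul_assoc, ← Real.exp_add, add_neg_cancel, Real.exp_zero, one_mul]
  rw [h2, h1, map_add, ← ContinuousLinearMap.intervalIntegral_comp_comm _
    (hc.intervalIntegrable _ _), bern_dilL hk0 ht hz.le, mul_add,
    ← intervalIntegral.integral_const_mul]
  congr 1
  refine intervalIntegral.integral_congr fun s hs => ?_
  rw [uIcc_of_le ht] at hs
  rw [bern_dilL hk0 (by linarith [hs.2]) hz.le, ← mul_assoc, ← mul_assoc, ← Real.exp_add,
    ← Real.exp_add]
  ring_nf

theorem hasDerivAt_char (hk : 1 ≤ k) {g : ℝ → L1 k} (hg : Continuous g) {ζ : ℝ} (hζ : 0 < ζ)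
    (c s : ℝ) : HasDerivAt (fun t => c + ∫ s in (0 : ℝ)..t,
      Real.exp (-s) * bern k (Real.exp s * ζ) (g s))
      (Real.exp (-s) * bern k (Real.exp s * ζ) (g s)) s :=
  ((continuous_char hk hg hζ).integral_hasStrictDerivAt 0 s).hasDerivAt.const_add c

/-- Variation of constants for the linearised equation. -/
theorem eq_linT_of_charSol (hk : 1 ≤ k) {u r : ℝ → L1 k} (hu : Continuous u) (hr : Continuous r)
    (h : CharSol k u fun s => linB (zero_le_one.trans hk) (expL k) (u s) + r s)
    {t : ℝ} (ht : 0 ≤ t) : u t = linT (zero_le_one.trans hk) t (u 0) +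
      ∫ s in (0 : ℝ)..t, linT (zero_le_one.trans hk) (t - s) (r s) := by
  have hk0 : 0 ≤ k := zero_le_one.trans hk
  refine bern_injective hk0 fun z hz => ?_
  have hc : Continuous fun s => linT hk0 (t - s) (r s) :=
    continuous_linT_comp hk0 (by fun_prop) hr
  rw [map_add, ← ContinuousLinearMap.intervalIntegral_comp_comm _ (hc.intervalIntegrable _ _)]
  set ζ := Real.exp (-t) * z with hζ
  have hζ0 : 0 < ζ := by positivity
  have hzζ : Real.exp t * ζ = z := by
    rw [hζ, ← mul_assoc, ← Real.exp_add, add_neg_cancel, Real.exp_zero, one_mul]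
  set g : ℝ → L1 k := fun s => linB hk0 (expL k) (u s) + r s with hg
  have hgc : Continuous g := by fun_prop
  -- The linear term has the coefficient `-2 e^s ζ / (1 + e^s ζ)` along the characteristic, and `(1
  -- + e^s ζ)²` is its integrating factor.
  have hderiv : ∀ s ∈ uIcc 0 t, HasDerivAt (fun s => (1 + Real.exp s * ζ) ^ 2 *
      (bern k ζ (u 0) + ∫ s in (0 : ℝ)..s, Real.exp (-s) * bern k (Real.exp s * ζ) (g s)))
      ((1 + Real.exp s * ζ) ^ 2 * (Real.exp (-s) * bern k (Real.exp s * ζ) (r s))) s := by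
    intro s hs
    rw [uIcc_of_le ht] at hs
    have h1 := hasDerivAt_char hk hgc hζ0 (bern k ζ (u 0)) s
    have h2 : HasDerivAt (fun s => (1 + Real.exp s * ζ) ^ 2)
        (2 * (1 + Real.exp s * ζ) * (Real.exp s * ζ)) s := by
      have h4 : HasDerivAt (fun s => (1 + Real.exp s * ζ) ^ 2) _ s :=
        (((Real.hasDerivAt_exp s).mul_const ζ).const_add 1).pow 2
      exact h4.congr_deriv (by norm_num)
    have h3 := h2.mul h1
    refine h3.congr_deriv ?_
    have hpos : 0 < Real.exp s * ζ := by positivity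
    rw [← h ζ hζ0 s hs.1]
    simp only [hg]
    rw [map_add, bern_linB hk0 _ _ hpos.le, bern_expL hk0 hpos.le]
    have hne : 1 + Real.exp s * ζ ≠ 0 := by positivity
    field_simp
    ring
  have hint := intervalIntegral.integral_eq_sub_of_hasDerivAt hderiv
    ((Continuous.mul (by fun_prop) (continuous_char hk hr hζ0)).intervalIntegrable _ _)
  simp only [intervalIntegral.integral_same, add_zero] at hint
  rw [← h ζ hζ0 t ht, hzζ, Real.exp_zero, one_mul] at hint
  have hterm : ∫ s in (0 : ℝ)..t, bern k z (linT hk0 (t - s) (r s)) =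
      Real.exp t / (1 + z) ^ 2 * ∫ s in (0 : ℝ)..t,
        (1 + Real.exp s * ζ) ^ 2 * (Real.exp (-s) * bern k (Real.exp s * ζ) (r s)) := by
    rw [← intervalIntegral.integral_const_mul]
    refine intervalIntegral.integral_congr fun s hs => ?_
    rw [uIcc_of_le ht] at hs
    have e1 : Real.exp (-(t - s)) * z = Real.exp s * ζ := by
      rw [hζ, ← mul_assoc, ← Real.exp_add]
      ring_nf
    rw [bern_linT hk0 (by linarith [hs.2]) _ hz.le, e1, Real.exp_sub, Real.exp_neg]
    have := Real.exp_ne_zero s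
    field_simp
  rw [hterm, hint, bern_linT hk0 ht _ hz.le, ← hζ]
  have hne : 1 + z ≠ 0 := by positivity
  have e2 : Real.exp t * Real.exp (-t) = 1 := by rw [← Real.exp_add]; simp
  field_simp
  linear_combination (-(1 + z) ^ 2 * bern k z (u t)) * e2

end

section

variable {k : ℝ}

/-! ### Decay of the linearised semigroup -/

theorem integrableOn_mul_shift (hk : 0 ≤ k) {E φ : ℝ → ℝ} (hE : MemLp E 1 (weightMeasure k))
    (hφ : Measurable φ) {C : ℝ} (hC : ∀ x, 0 < x → |φ x| ≤ C * (1 + x) ^ k) {y : ℝ} (hy : 0 < y) :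
    IntegrableOn (fun x => φ (x + y) * E x) (Ioi 0) := by
  refine integrableOn_mul_of_le (k := k) (C := C * (1 + y) ^ k)
    (hφ.comp (measurable_add_const y)).aestronglyMeasurable (fun x hx => ?_) hE
  refine (isTest_shift hk hC x y hx hy).trans (le_of_eq ?_)
  ring

/-- The identity part of `convL` contributes `φ(y)`, which cancels the term `-φ(y)` of the
symmetrised weak form because `∫ E = 1`. Only the `E`-average of the increment `φ(x + y) - φ(x)`
survives, and it is small for small `y`. -/
theorem pairing_convL (hk : 0 ≤ k) {E φ : ℝ → ℝ} (hE : MemLp E 1 (weightMeasure k))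
    (hE1 : ∫ x in Ioi 0, E x = 1) (hφ : IsTest k φ) (v : L1 k) :
    pairing k φ (convL hk (toL1 k E) v) =
      ∫ y in Ioi 0, v y * ∫ x in Ioi 0, (φ (x + y) * E x - φ x * E x) := by
  obtain ⟨hφm, C, hC⟩ := hφ
  have hm : AEStronglyMeasurable (fun p : ℝ × ℝ => φ (p.1 + p.2) - φ p.1 - φ p.2) quadrant := by
    have h1 : Measurable fun p : ℝ × ℝ => φ (p.1 + p.2) := hφm.comp (by fun_prop)
    exact ((h1.sub (hφm.comp measurable_fst)).sub (hφm.comp measurable_snd)).aestronglyMeasurable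
  have hb : ∀ x y, 0 < x → 0 < y →
      |φ (x + y) - φ x - φ y| ≤ 3 * C * ((1 + x) ^ k * (1 + y) ^ k) := by
    intro x y hx hy
    have h1 := isTest_shift hk hC x y hx hy
    have h2 := isTest_fst hk hC x y hx hy
    have h3 := isTest_fst hk hC y x hy hx
    calc _ ≤ |φ (x + y) - φ x| + |φ y| := abs_sub _ _
      _ ≤ |φ (x + y)| + |φ x| + |φ y| := by gcongr; exact abs_sub _ _
      _ ≤ _ := by linarith
  have hi := integrable_quad isKernel_two hE (memLp_coe v) hm hb
  have hφv := IsTest.integrable ⟨hφm, C, hC⟩ (memLp_coe v)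
  have hEi := integrableOn_of_memLp hk hE
  have hq := quad_congr (K := fun _ _ => (2 : ℝ)) (coeFn_toL1 hE) (ae_eq_refl (v : ℝ → ℝ))
    fun p => φ (p.1 + p.2) - φ p.1 - φ p.2
  rw [convL_apply, map_add, map_smul, linB_apply,
    pairing_bilL_symm hk isKernel_two (fun _ _ _ _ => rfl) _ _ ⟨hφm, C, hC⟩, hq, quadrant, integral_prod_symm _ (by rwa [← quadrant]),
    pairing_apply ⟨hφm, C, hC⟩, smul_eq_mul, ← integral_const_mul, ← integral_add hφv
      (Integrable.const_mul (by rw [quadrant] at hi; exact hi.integral_prod_right) _)]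
  refine integral_congr_ae ?_
  filter_upwards [ae_restrict_mem measurableSet_Ioi] with y hy
  have e1 : ∀ x, 2 * (E x * v y) * (φ (x + y) - φ x - φ y) =
      2 * v y * ((φ (x + y) * E x - φ x * E x) - φ y * E x) := fun x => by ring
  have h5 : IntegrableOn (fun x => φ (x + y) * E x - φ x * E x) (Ioi 0) :=
    (integrableOn_mul_shift hk hE hφm hC hy).sub (IsTest.integrable ⟨hφm, C, hC⟩ hE)
  simp only [e1]
  rw [integral_const_mul, integral_sub h5 (hEi.const_mul _), integral_const_mul, hE1]
  ring

theorem rpow_le_weight {p : ℝ} (hp : 0 ≤ p) (hpk : p ≤ k) {x : ℝ} (hx : 0 < x) :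
    x ^ p ≤ (1 + x) ^ k :=
  (Real.rpow_le_rpow hx.le (by linarith) hp).trans
    (Real.rpow_le_rpow_of_exponent_le (by linarith) hpk)

/-- If the shift defect of `E` is controlled, then convolution with `E` makes the dilation
semigroup decay. -/
theorem norm_convL_dilL_le (hk : 1 ≤ k) {p : ℝ} (hp1 : 1 ≤ p) (hpk : p ≤ k) {E : ℝ → ℝ}
    (hE : MemLp E 1 (weightMeasure k)) (hE1 : ∫ x in Ioi 0, E x = 1) {C : ℝ} (hC0 : 0 ≤ C)
    {u : L1 k} (d : (ℝ → ℝ) → ℝ) (hd : ∀ φ, d φ * massL k u = 0)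
    (hN : ∀ φ : ℝ → ℝ, Measurable φ → (∀ x, 0 < x → |φ x| ≤ 1 * (1 + x) ^ k) → ∀ y, 0 < y →
      |(∫ x in Ioi 0, (φ (x + y) * E x - φ x * E x)) + y * d φ| ≤ C * (y ^ p + y ^ k))
    {t : ℝ} (ht : 0 ≤ t) :
    ‖convL (zero_le_one.trans hk) (toL1 k E) (dilL (zero_le_one.trans hk) t u)‖ ≤
      2 * C * Real.exp (-((p - 1) * t)) * ‖u‖ := by
  have hk0 : 0 ≤ k := zero_le_one.trans hk
  set v := dilL hk0 t u with hv
  rw [norm_eq_norm1]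
  refine norm1_le_of_forall (memLp_coe _) fun φ hφm hφ => ?_
  rw [← pairing_apply ⟨hφm, 1, hφ⟩, pairing_convL hk0 hE hE1 ⟨hφm, 1, hφ⟩]
  have hmass : ∫ y in Ioi 0, y * v y = massL k u := by
    rw [← massL_dilL hk t u, massL_apply hk, mass]
  have hφtest : IsTest k φ := ⟨hφm, 1, hφ⟩
  have hyv : IntegrableOn (fun y => y * v y) (Ioi 0) := (isTest_id hk).integrable (memLp_coe v)
  have hwt : IsTest k fun y => C * (y ^ p + y ^ k) := by
    refine ⟨by fun_prop, 2 * C, fun x hx => ?_⟩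
    have h1 := rpow_le_weight (by linarith : 0 ≤ p) hpk hx
    have h2 := rpow_le_weight hk0 le_rfl hx
    rw [abs_of_nonneg (by positivity)]
    nlinarith
  have hwv : IntegrableOn (fun y => C * (y ^ p + y ^ k) * |v y|) (Ioi 0) := by
    refine IntegrableOn.congr_fun (f := fun y => |C * (y ^ p + y ^ k) * v y|)
      (hwt.integrable (memLp_coe v)).abs (fun y hy => ?_) measurableSet_Ioi
    have hy : 0 < y := hy
    simp only []
    rw [abs_mul, abs_of_nonneg (by positivity)]
  have hin : IntegrableOn
      (fun y => v y * ∫ x in Ioi 0, (φ (x + y) * E x - φ x * E x)) (Ioi 0) := by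
    have hmeas : AEStronglyMeasurable
        (fun y => ∫ x in Ioi 0, (φ (x + y) * E x - φ x * E x)) (volume.restrict (Ioi 0)) := by
      have h1 : AEStronglyMeasurable (fun q : ℝ × ℝ => φ (q.2 + q.1) * E q.2 - φ q.2 * E q.2)
          ((volume.restrict (Ioi 0)).prod (volume.restrict (Ioi 0))) := by
        have h2 : AEStronglyMeasurable (fun q : ℝ × ℝ => E q.2)
            ((volume.restrict (Ioi 0)).prod (volume.restrict (Ioi 0))) :=
          (MemLp_aesm hE).comp_quasiMeasurePreserving Measure.quasiMeasurePreserving_snd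
        have h3 : Measurable fun q : ℝ × ℝ => φ (q.2 + q.1) := hφm.comp (by fun_prop)
        exact (h3.aestronglyMeasurable.mul h2).sub
          ((hφm.comp measurable_snd).aestronglyMeasurable.mul h2)
      exact h1.integral_prod_right'
    have h0 : IntegrableOn (fun y => C * (y ^ p + y ^ k) * |v y| + |d φ| * |y * v y|) (Ioi 0) :=
      hwv.add (hyv.abs.const_mul _)
    refine Integrable.mono' h0 ((MemLp_aesm (memLp_coe v)).mul hmeas) ?_
    filter_upwards [ae_restrict_mem measurableSet_Ioi] with y hy
    have h5 := hN φ hφm hφ y hy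
    have h6 : |∫ x in Ioi 0, (φ (x + y) * E x - φ x * E x)| ≤
        C * (y ^ p + y ^ k) + |y| * |d φ| := by
      have := abs_sub ((∫ x in Ioi 0, (φ (x + y) * E x - φ x * E x)) + y * d φ) (y * d φ)
      rw [add_sub_cancel_right, abs_mul y] at this
      linarith
    rw [norm_mul, Real.norm_eq_abs, Real.norm_eq_abs, abs_mul y]
    nlinarith [mul_le_mul_of_nonneg_left h6 (abs_nonneg (v y))]
  -- By `hd`, either the correction `d φ` vanishes or `u` has zero mass; dilation preserves mass, so
  -- a multiple of `y` may be added for free.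
  have hsum : ∫ y in Ioi 0, v y * ∫ x in Ioi 0, (φ (x + y) * E x - φ x * E x) =
      ∫ y in Ioi 0, v y *
        ((∫ x in Ioi 0, (φ (x + y) * E x - φ x * E x)) + y * d φ) := by
    have h7 : ∫ y in Ioi 0, v y * (y * d φ) = 0 := by
      have : ∀ y, v y * (y * d φ) = d φ * (y * v y) := fun y => by ring
      simp only [this]
      rw [integral_const_mul, hmass, hd]
    have h8 : IntegrableOn (fun y => v y * (y * d φ)) (Ioi 0) := by
      have : (fun y => v y * (y * d φ)) = fun y => d φ * (y * v y) := by ext y; ring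
      rw [this]
      exact hyv.const_mul _
    simp only [mul_add]
    rw [integral_add hin h8, h7, add_zero]
  rw [hsum]
  have hle : ∫ y in Ioi 0, v y * ((∫ x in Ioi 0, (φ (x + y) * E x - φ x * E x)) + y * d φ) ≤
      ∫ y in Ioi 0, C * (y ^ p + y ^ k) * |v y| := by
    refine (le_abs_self _).trans ?_
    rw [← Real.norm_eq_abs]
    refine norm_integral_le_of_norm_le hwv ?_
    filter_upwards [ae_restrict_mem measurableSet_Ioi] with y hy
    rw [norm_mul, Real.norm_eq_abs, Real.norm_eq_abs, mul_comm]
    gcongr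
    exact hN φ hφm hφ y hy
  refine hle.trans ?_
  have habs : ∫ y in Ioi 0, C * (y ^ p + y ^ k) * |v y| =
      ∫ y in Ioi 0, C * (y ^ p + y ^ k) * dilate t (fun y => |u y|) y := by
    refine integral_congr_ae ?_
    filter_upwards [coeFn_dilL hk0 ht u] with y hy
    rw [hv, hy, dilate, dilate, abs_mul, Real.abs_exp]
  rw [habs, integral_mul_dilate, norm_eq_norm1, norm1, ← integral_const_mul, ← integral_const_mul]
  refine integral_mono_of_nonneg ?_ ((memLp_iff_norm.1 (memLp_coe u)).2.const_mul _) ?_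
  · filter_upwards [ae_restrict_mem measurableSet_Ioi] with x hx
    have hx : 0 < x := hx
    simp only [Pi.zero_apply]
    positivity
  · filter_upwards [ae_restrict_mem measurableSet_Ioi] with x hx
    have hx : 0 < x := hx
    have h1 := rpow_le_weight (by linarith : 0 ≤ p) hpk hx
    have h2 := rpow_le_weight hk0 le_rfl hx
    -- The source of decay: dilation pushes everything towards the origin, where the increment is
    -- `O(y^p)`, and one power of `e^{-t}` is lost to the growth of the particle number. The part
    -- `y^k` decays at least as fast since `p ≤ k`.
    have h3 : Real.exp t * (Real.exp (-t) * x) ^ p = Real.exp (-((p - 1) * t)) * x ^ p := by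
      rw [Real.mul_rpow (Real.exp_pos _).le hx.le, ← Real.exp_mul, ← mul_assoc, ← Real.exp_add]
      ring_nf
    have h4 : Real.exp t * (Real.exp (-t) * x) ^ k ≤ Real.exp (-((p - 1) * t)) * x ^ k := by
      rw [Real.mul_rpow (Real.exp_pos _).le hx.le, ← Real.exp_mul, ← mul_assoc, ← Real.exp_add]
      gcongr
      nlinarith
    have h5 : Real.exp t * (C * ((Real.exp (-t) * x) ^ p + (Real.exp (-t) * x) ^ k)) ≤
        C * (Real.exp (-((p - 1) * t)) * (2 * (1 + x) ^ k)) := by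
      have h6 : 0 < Real.exp (-((p - 1) * t)) := Real.exp_pos _
      calc _ = C * (Real.exp t * (Real.exp (-t) * x) ^ p +
            Real.exp t * (Real.exp (-t) * x) ^ k) := by ring
        _ ≤ C * (Real.exp (-((p - 1) * t)) * x ^ p + Real.exp (-((p - 1) * t)) * x ^ k) := by
            rw [h3]; gcongr
        _ = C * (Real.exp (-((p - 1) * t)) * (x ^ p + x ^ k)) := by ring
        _ ≤ _ := by gcongr; linarith
    calc _ = (Real.exp t * (C * ((Real.exp (-t) * x) ^ p + (Real.exp (-t) * x) ^ k))) * |u x| := by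
          ring
      _ ≤ (C * (Real.exp (-((p - 1) * t)) * (2 * (1 + x) ^ k))) * |u x| := by gcongr
      _ = _ := by ring

theorem integral_comp_shift (f : ℝ → ℝ) (y : ℝ) :
    ∫ x in Ioi (0 : ℝ), f (x + y) = ∫ x in Ioi y, f x := by
  have h := (measurePreserving_add_right (volume : Measure ℝ) y).setIntegral_preimage_emb
    (measurableEmbedding_addRight y) f (Ioi y)
  rw [← h]
  congr 2
  ext x
  simp

theorem integral_Ioi_split {f : ℝ → ℝ} (hf : IntegrableOn f (Ioi 0)) {y : ℝ} (hy : 0 ≤ y) :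
    ∫ x in Ioi 0, f x = (∫ x in Ioc 0 y, f x) + ∫ x in Ioi y, f x := by
  rw [← Ioc_union_Ioi_eq_Ioi hy, setIntegral_union (by
    rw [Set.disjoint_left]; exact fun x hx hx' => not_lt.2 hx.2 hx') measurableSet_Ioi
    (hf.mono_set Ioc_subset_Ioi_self) (hf.mono_set (Ioi_subset_Ioi hy))]

/-- Bound of a weighted integral by the moment of the exponential. -/
theorem abs_integral_le_weight_exp {φ q : ℝ → ℝ} (hφ : ∀ x, 0 < x → |φ x| ≤ 1 * (1 + x) ^ k)
    {y B : ℝ} (hB : 0 ≤ B) (hy : 0 ≤ y)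
    (hq : ∀ x, y < x → |q x| ≤ B * ((1 + x) * Real.exp (-x))) :
    |∫ x in Ioi y, φ x * q x| ≤ B * ∫ x in Ioi (0 : ℝ), (1 + x) ^ (k + 1) * Real.exp (-x) := by
  have hi := integrableOn_weight_exp (k + 1)
  calc |∫ x in Ioi y, φ x * q x| ≤ ∫ x in Ioi y, B * ((1 + x) ^ (k + 1) * Real.exp (-x)) := by
        rw [← Real.norm_eq_abs]
        refine norm_integral_le_of_norm_le ((hi.mono_set (Ioi_subset_Ioi hy)).const_mul B) ?_
        filter_upwards [ae_restrict_mem measurableSet_Ioi] with x hx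
        have hx : y < x := hx
        have hx0 : 0 < x := by linarith
        rw [norm_mul, Real.norm_eq_abs, Real.norm_eq_abs, Real.rpow_add_one (by positivity)]
        calc |φ x| * |q x| ≤ (1 * (1 + x) ^ k) * (B * ((1 + x) * Real.exp (-x))) := by
              gcongr
              · exact hφ x hx0
              · exact hq x hx
          _ = _ := by ring
    _ ≤ _ := by
        rw [integral_const_mul]
        refine mul_le_mul_of_nonneg_left
          (setIntegral_mono_set hi ?_ (Ioi_subset_Ioi hy).eventuallyLE) hB
        filter_upwards [ae_restrict_mem measurableSet_Ioi] with x hx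
        have hx : 0 < x := hx
        simp only [Pi.zero_apply]
        positivity

theorem abs_integral_Ioc_le {φ q : ℝ → ℝ} (hk : 0 ≤ k)
    (hφ : ∀ x, 0 < x → |φ x| ≤ 1 * (1 + x) ^ k) {y B : ℝ} (hy : 0 ≤ y) (hy1 : y ≤ 1)
    (hq : ∀ x, 0 < x → x ≤ y → |q x| ≤ B) :
    |∫ x in Ioc 0 y, φ x * q x| ≤ 2 ^ k * B * y := by
  rw [← Real.norm_eq_abs]
  have := norm_setIntegral_le_of_norm_le_const (μ := volume) (s := Ioc 0 y) (C := 2 ^ k * B)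
    (f := fun x => φ x * q x) (by simp) (fun x hx => by
      have h1 := hφ x hx.1
      have h2 : (1 + x) ^ k ≤ 2 ^ k :=
        Real.rpow_le_rpow (by linarith [hx.1]) (by linarith [hx.2]) hk
      have h3 := hq x hx.1 hx.2
      rw [norm_mul, Real.norm_eq_abs, Real.norm_eq_abs]
      have : |φ x| ≤ 2 ^ k := by linarith
      gcongr)
  simpa [hy] using this

/-- The moment of order `k + 1` of the exponential with respect to `1 + x`. -/
def expMoment (k : ℝ) : ℝ := ∫ x in Ioi (0 : ℝ), (1 + x) ^ (k + 1) * Real.exp (-x)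

theorem expMoment_nonneg (k : ℝ) : 0 ≤ expMoment k :=
  setIntegral_nonneg measurableSet_Ioi fun x hx => by
    have hx : 0 < x := hx
    positivity

/-- Crude bound of the shift defect for large shifts. -/
theorem shift_defect_large (hk : 1 ≤ k) {E q φ : ℝ → ℝ} (hE : MemLp E 1 (weightMeasure k))
    (hEb : ∀ x, 0 < x → |E x| ≤ 1 * ((1 + x) * Real.exp (-x)))
    (hqb : ∀ x, 0 < x → |q x| ≤ 1 * ((1 + x) * Real.exp (-x)))
    (hφm : Measurable φ) (hφ : ∀ x, 0 < x → |φ x| ≤ 1 * (1 + x) ^ k) {y : ℝ} (hy : 1 ≤ y) :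
    |(∫ x in Ioi 0, (φ (x + y) * E x - φ x * E x)) + y * ∫ x in Ioi 0, φ x * q x| ≤
      (2 ^ k + 2) * expMoment k * y ^ k := by
  have hk0 : 0 ≤ k := zero_le_one.trans hk
  have hy0 : 0 < y := by linarith
  rw [integral_sub (integrableOn_mul_shift hk0 hE hφm hφ hy0)
    (integrableOn_mul_of_le hφm.aestronglyMeasurable hφ hE)]
  have h1 := abs_integral_le_weight_exp hφ zero_le_one le_rfl hEb
  have h2 := abs_integral_le_weight_exp hφ zero_le_one le_rfl hqb
  have h3 : |∫ x in Ioi 0, φ (x + y) * E x| ≤ (1 + y) ^ k * expMoment k := by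
    have h4 : ∀ x, 0 < x → |φ (x + y) / (1 + y) ^ k| ≤ 1 * (1 + x) ^ k := by
      intro x hx
      have := isTest_shift hk0 hφ x y hx hy0
      rw [abs_div, abs_of_nonneg (by positivity : 0 ≤ (1 + y) ^ k),
        div_le_iff₀ (by positivity)]
      linarith
    have h5 := abs_integral_le_weight_exp (q := E) h4 zero_le_one le_rfl hEb
    have h6 : ∀ x, φ (x + y) / (1 + y) ^ k * E x = ((1 + y) ^ k)⁻¹ * (φ (x + y) * E x) :=
      fun x => by ring
    simp only [h6] at h5
    rw [integral_const_mul, abs_mul, abs_of_nonneg (by positivity), one_mul,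
      inv_mul_le_iff₀ (by positivity)] at h5
    exact h5
  rw [one_mul, ← expMoment] at h1 h2
  have h7 : (1 + y) ^ k ≤ 2 ^ k * y ^ k := by
    rw [← Real.mul_rpow (by norm_num) hy0.le]
    exact Real.rpow_le_rpow (by positivity) (by linarith) hk0
  have h8 : y ≤ y ^ k := by simpa using Real.rpow_le_rpow_of_exponent_le hy hk
  have hΛ := expMoment_nonneg k
  calc _ ≤ |(∫ x in Ioi 0, φ (x + y) * E x) - ∫ x in Ioi 0, φ x * E x| +
        |y * ∫ x in Ioi 0, φ x * q x| := abs_add_le _ _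
    _ ≤ |∫ x in Ioi 0, φ (x + y) * E x| + |∫ x in Ioi 0, φ x * E x| +
        y * |∫ x in Ioi 0, φ x * q x| := by
        rw [abs_mul, abs_of_pos hy0]
        gcongr
        exact abs_sub _ _
    _ ≤ (1 + y) ^ k * expMoment k + expMoment k + y * expMoment k := by gcongr
    _ ≤ 2 ^ k * y ^ k * expMoment k + y ^ k * expMoment k + y ^ k * expMoment k := by
        have : expMoment k ≤ y ^ k * expMoment k := le_mul_of_one_le_left hΛ (hy.trans h8)
        gcongr
    _ = _ := by ring

theorem exp_sub_one_le {y : ℝ} (hy : 0 ≤ y) (hy1 : y ≤ 1) :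
    0 ≤ Real.exp y - 1 - y ∧ Real.exp y - 1 - y ≤ y ^ 2 := by
  have h1 := Real.add_one_le_exp y
  have h2 := Real.abs_exp_sub_one_sub_id_le (x := y) (by rwa [abs_of_nonneg hy])
  rw [abs_of_nonneg (by linarith)] at h2
  exact ⟨by linarith, h2⟩

theorem integrableOn_of_weight_exp {φ q : ℝ → ℝ} (hφm : Measurable φ) (hq : Measurable q)
    (hφ : ∀ x, 0 < x → |φ x| ≤ 1 * (1 + x) ^ k) {B : ℝ}
    (hqb : ∀ x, 0 < x → |q x| ≤ B * ((1 + x) * Real.exp (-x))) :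
    IntegrableOn (fun x => φ x * q x) (Ioi 0) := by
  refine Integrable.mono' ((integrableOn_weight_exp (k + 1)).const_mul B)
    (hφm.mul hq).aestronglyMeasurable ?_
  filter_upwards [ae_restrict_mem measurableSet_Ioi] with x hx
  have hx : 0 < x := hx
  rw [norm_mul, Real.norm_eq_abs, Real.norm_eq_abs, Real.rpow_add_one (by positivity)]
  calc |φ x| * |q x| ≤ (1 * (1 + x) ^ k) * (B * ((1 + x) * Real.exp (-x))) := by
        gcongr
        · exact hφ x hx
        · exact hqb x hx
    _ = _ := by ring

theorem abs_exp_le_weight {x : ℝ} (hx : 0 < x) :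
    |expFun x| ≤ 1 * ((1 + x) * Real.exp (-x)) := by
  rw [expFun, Real.abs_exp]
  nlinarith [Real.exp_pos (-x)]

theorem abs_exp₂_le_weight {x : ℝ} (hx : 0 < x) :
    |expFun₂ x| ≤ 1 * ((1 + x) * Real.exp (-x)) := by
  have := Real.exp_pos (-x)
  rw [expFun₂, abs_of_nonneg (by positivity)]
  nlinarith

/-- Moving the shift onto the exponential multiplies it by `e^y` on `(y, ∞)`: for `y ≤ 1` this
leaves `e^y - 1 = O(y)` there, and an integral over `(0, y]` that is `O(y)`. The summand `y * 0` is
the form used by `norm_convL_dilL_le` with `d = 0`, so no zero-mass condition is needed for this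
term. -/
theorem shift_defect_exp (hk : 1 ≤ k) {φ : ℝ → ℝ} (hφm : Measurable φ)
    (hφ : ∀ x, 0 < x → |φ x| ≤ 1 * (1 + x) ^ k) {y : ℝ} (hy : 0 < y) :
    |(∫ x in Ioi 0, (φ (x + y) * expFun x - φ x * expFun x)) + y * 0| ≤
      (2 ^ k + 2) * (expMoment k + 1) * (y ^ (1 : ℝ) + y ^ k) := by
  have hk0 : 0 ≤ k := zero_le_one.trans hk
  have hΛ := expMoment_nonneg k
  have h2k : (0 : ℝ) < 2 ^ k := by positivity
  have hyk : 0 < y ^ k := by positivity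
  rw [Real.rpow_one]
  rcases le_total 1 y with h1 | h1
  · have := shift_defect_large hk (q := fun _ => 0) (memLp_expFun k)
      (fun x hx => abs_exp_le_weight hx) (fun x hx => by
        rw [abs_zero]; positivity) hφm hφ h1
    simp only [mul_zero, integral_zero] at this ⊢
    refine this.trans ?_
    gcongr
    · linarith
    · linarith
  · have hi := integrableOn_mul_of_le hφm.aestronglyMeasurable hφ (memLp_expFun k)
    have h3 : ∫ x in Ioi 0, φ (x + y) * expFun x =
        Real.exp y * ∫ x in Ioi y, φ x * expFun x := by
      rw [← integral_comp_shift _ y, ← integral_const_mul]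
      congr 1
      ext x
      simp only [expFun, neg_add, Real.exp_add]
      have : Real.exp y * Real.exp (-y) = 1 := by rw [← Real.exp_add]; simp
      linear_combination (-(φ (x + y) * Real.exp (-x))) * this
    rw [integral_sub (integrableOn_mul_shift hk0 (memLp_expFun k) hφm hφ hy) hi, h3,
      integral_Ioi_split hi hy.le]
    have h4 := abs_integral_le_weight_exp (q := expFun) hφ zero_le_one hy.le
      (fun x hx => abs_exp_le_weight (hy.trans hx))
    have h5 := abs_integral_Ioc_le (q := expFun) hk0 hφ hy.le h1 (B := 1) (fun x hx _ => by
      rw [expFun, Real.abs_exp, Real.exp_le_one_iff]; linarith)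
    rw [one_mul, ← expMoment] at h4
    set A := ∫ x in Ioi y, φ x * expFun x
    set B := ∫ x in Ioc 0 y, φ x * expFun x
    obtain ⟨h6, h7⟩ := exp_sub_one_le hy.le h1
    have h8 : Real.exp y * A - (B + A) + y * 0 = (Real.exp y - 1) * A - B := by ring
    rw [h8]
    have h9 : |(Real.exp y - 1) * A - B| ≤ (Real.exp y - 1) * |A| + |B| := by
      refine (abs_sub _ _).trans (le_of_eq ?_)
      rw [abs_mul, abs_of_nonneg (by linarith : 0 ≤ Real.exp y - 1)]
    have h10 : (Real.exp y - 1) * |A| ≤ 2 * y * expMoment k := by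
      have : Real.exp y - 1 ≤ 2 * y := by nlinarith
      gcongr
    nlinarith [mul_nonneg h2k.le hΛ, mul_nonneg (mul_nonneg h2k.le hΛ) hy.le,
      mul_nonneg (mul_nonneg h2k.le hΛ) hyk.le, mul_nonneg hΛ hyk.le, mul_nonneg h2k.le hyk.le]

/-- The added term removes the first-order part of the shift, `(1 - x) e^{-x}` being the derivative
of `x e^{-x}`. As `x e^{-x}` vanishes at the origin, the boundary strip also contributes only
`O(y²)`; hence the restriction `p ≤ 2`. -/
theorem shift_defect_exp₂ (hk : 1 ≤ k) {p : ℝ} (hp2 : p ≤ 2) {φ : ℝ → ℝ}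
    (hφm : Measurable φ) (hφ : ∀ x, 0 < x → |φ x| ≤ 1 * (1 + x) ^ k) {y : ℝ} (hy : 0 < y) :
    |(∫ x in Ioi 0, (φ (x + y) * expFun₂ x - φ x * expFun₂ x)) +
        y * ∫ x in Ioi 0, φ x * ((1 - x) * Real.exp (-x))| ≤
      (2 ^ k + 2) * (expMoment k + 1) * (y ^ p + y ^ k) := by
  have hk0 : 0 ≤ k := zero_le_one.trans hk
  have hΛ := expMoment_nonneg k
  have h2k : (0 : ℝ) < 2 ^ k := by positivity
  have hyk : 0 < y ^ k := by positivity
  have hyp : 0 < y ^ p := by positivity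
  have hqb : ∀ x, 0 < x → |(1 - x) * Real.exp (-x)| ≤ 1 * ((1 + x) * Real.exp (-x)) := by
    intro x hx
    rw [abs_mul, Real.abs_exp, one_mul]
    gcongr
    rw [abs_le]
    constructor <;> linarith
  rcases le_total 1 y with h1 | h1
  · refine (shift_defect_large hk (memLp_expFun₂ k)
      (fun x hx => abs_exp₂_le_weight hx) hqb hφm hφ h1).trans ?_
    gcongr
    · linarith
    · linarith
  · have hi := integrableOn_mul_of_le hφm.aestronglyMeasurable hφ (memLp_expFun₂ k)
    have hi' : IntegrableOn (fun x => φ x * ((1 - x) * Real.exp (-x))) (Ioi 0) :=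
      integrableOn_of_weight_exp hφm (by fun_prop) hφ hqb
    have h3 : ∫ x in Ioi 0, φ (x + y) * expFun₂ x =
        ∫ x in Ioi y, φ x * ((x - y) * Real.exp y * Real.exp (-x)) := by
      rw [← integral_comp_shift _ y]
      congr 1
      ext x
      simp only [expFun₂, neg_add, Real.exp_add]
      have : Real.exp y * Real.exp (-y) = 1 := by rw [← Real.exp_add]; simp
      linear_combination (-(φ (x + y) * x * Real.exp (-x))) * this
    have hi3 : IntegrableOn (fun x => φ x * ((x - y) * Real.exp y * Real.exp (-x))) (Ioi y) := by
      refine (integrableOn_of_weight_exp (B := Real.exp y) hφm (by fun_prop) hφ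
        (fun x hx => ?_)).mono_set (Ioi_subset_Ioi hy.le)
      rw [abs_mul, abs_mul, Real.abs_exp, Real.abs_exp]
      have : |x - y| ≤ 1 + x := by rw [abs_le]; constructor <;> linarith
      calc _ ≤ (1 + x) * Real.exp y * Real.exp (-x) := by gcongr
        _ = _ := by ring
    rw [integral_sub (integrableOn_mul_shift hk0 (memLp_expFun₂ k) hφm hφ hy) hi, h3,
      integral_Ioi_split hi hy.le, integral_Ioi_split hi' hy.le]
    -- The Taylor remainder, with `e^{-x}` factored out: on `(y, ∞)` it is of second order in `y`,
    -- and on the strip `(0, y]` it is at most `y` over a length `y`.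
    have e1 : (∫ x in Ioi y, φ x * ((x - y) * Real.exp y * Real.exp (-x))) -
        ((∫ x in Ioc 0 y, φ x * expFun₂ x) + ∫ x in Ioi y, φ x * expFun₂ x) +
        y * ((∫ x in Ioc 0 y, φ x * ((1 - x) * Real.exp (-x))) +
          ∫ x in Ioi y, φ x * ((1 - x) * Real.exp (-x))) =
        (∫ x in Ioi y, φ x * (((x - y) * (Real.exp y - 1 - y) - y ^ 2) * Real.exp (-x))) +
        ∫ x in Ioc 0 y, φ x * ((y - x - x * y) * Real.exp (-x)) := by
      have j1 := hi.mono_set (Ioi_subset_Ioi hy.le)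
      have j2 := hi'.mono_set (Ioi_subset_Ioi hy.le)
      have j3 := hi.mono_set (show Ioc 0 y ⊆ Ioi 0 from fun x hx => hx.1)
      have j4 := hi'.mono_set (show Ioc 0 y ⊆ Ioi 0 from fun x hx => hx.1)
      have j5 : IntegrableOn (fun x => φ x * ((x - y) * Real.exp y * Real.exp (-x)) -
          φ x * expFun₂ x) (Ioi y) := hi3.sub j1
      have j6 : IntegrableOn (fun x => -(φ x * expFun₂ x)) (Ioc 0 y) := j3.neg
      have a1 : ∫ x in Ioi y, φ x * (((x - y) * (Real.exp y - 1 - y) - y ^ 2) * Real.exp (-x)) =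
          (∫ x in Ioi y, φ x * ((x - y) * Real.exp y * Real.exp (-x))) -
          (∫ x in Ioi y, φ x * expFun₂ x) + y * ∫ x in Ioi y, φ x * ((1 - x) * Real.exp (-x)) := by
        rw [← integral_const_mul, ← integral_sub hi3 j1, ← integral_add j5
          (j2.const_mul y)]
        congr 1
        ext x
        simp only [expFun₂]
        ring
      have a2 : ∫ x in Ioc 0 y, φ x * ((y - x - x * y) * Real.exp (-x)) =
          -(∫ x in Ioc 0 y, φ x * expFun₂ x) +
          y * ∫ x in Ioc 0 y, φ x * ((1 - x) * Real.exp (-x)) := by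
        rw [← integral_const_mul, ← integral_neg, ← integral_add j6 (j4.const_mul y)]
        congr 1
        ext x
        simp only [expFun₂]
        ring
      rw [a1, a2]
      ring
    rw [e1]
    obtain ⟨h6, h7⟩ := exp_sub_one_le hy.le h1
    have b1 := abs_integral_le_weight_exp
      (q := fun x => ((x - y) * (Real.exp y - 1 - y) - y ^ 2) * Real.exp (-x)) hφ
      (sq_nonneg y) hy.le (fun x hx => by
        rw [abs_mul, Real.abs_exp, ← mul_assoc]
        gcongr
        rw [abs_le]
        have : 0 ≤ x - y := by linarith
        constructor <;> nlinarith [mul_nonneg this h6, mul_le_mul_of_nonneg_left h7 this])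
    have b2 := abs_integral_Ioc_le (q := fun x => (y - x - x * y) * Real.exp (-x)) hk0 hφ hy.le h1
      (B := y) (fun x hx hxy => by
        rw [abs_mul, Real.abs_exp]
        have c1 : |y - x - x * y| ≤ y := by
          rw [abs_le]
          constructor <;> nlinarith
        have c2 : Real.exp (-x) ≤ 1 := by rw [Real.exp_le_one_iff]; linarith
        calc _ ≤ y * 1 := by gcongr
          _ = y := mul_one y)
    rw [← expMoment] at b1
    refine (abs_add_le _ _).trans ((add_le_add b1 b2).trans ?_)
    have hyp2 : y ^ 2 ≤ y ^ p := by
      rw [← Real.rpow_natCast]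
      exact Real.rpow_le_rpow_of_exponent_ge hy h1 (by simpa using hp2)
    calc y ^ 2 * expMoment k + 2 ^ k * y * y = (expMoment k + 2 ^ k) * y ^ 2 := by ring
      _ ≤ (expMoment k + 2 ^ k) * y ^ p := by gcongr
      _ ≤ _ := by
        nlinarith [mul_nonneg h2k.le hΛ, mul_nonneg (mul_nonneg h2k.le hΛ) hyp.le,
          mul_nonneg (mul_nonneg h2k.le hΛ) hyk.le, mul_nonneg hΛ hyk.le, mul_nonneg hΛ hyp.le,
          mul_nonneg h2k.le hyk.le]

theorem integral_expFun : ∫ x in Ioi 0, expFun x = 1 := by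
  simpa [expFun] using integral_exp_neg_mul one_pos

theorem integral_expFun₂ : ∫ x in Ioi 0, expFun₂ x = 1 := by
  simpa [expFun₂] using integral_mul_exp_neg_mul one_pos

/-- Exponential decay of the linearised semigroup on functions of zero mass. -/
theorem exists_norm_linT_le (hk : 1 ≤ k) {p : ℝ} (hp1 : 1 ≤ p) (hp2 : p ≤ 2) (hpk : p ≤ k) :
    ∃ C : ℝ, 1 ≤ C ∧ ∀ t, 0 ≤ t → ∀ u : L1 k, massL k u = 0 →
      ‖linT (zero_le_one.trans hk) t u‖ ≤ C * Real.exp (-((p - 1) * t)) * ‖u‖ := by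
  have hk0 : 0 ≤ k := zero_le_one.trans hk
  set D := (2 ^ k + 2) * (expMoment k + 1) with hD
  have hD0 : 0 ≤ D := by
    have := expMoment_nonneg k
    positivity
  -- One summand for each term of `linT`. The first two decay by their prefactors `e^{-2t}` (against
  -- the growth `e^t`) and `2 e^{-t}` (with the exponent `1` below, hence no decay from the
  -- convolution); only the third needs the exponent `p` and zero mass.
  refine ⟨1 + 4 * D + 2 * D, by linarith, fun t ht u hu => ?_⟩
  have h1 := norm_convL_dilL_le hk le_rfl hk (memLp_expFun k) integral_expFun hD0
    (u := u) (fun _ => 0) (fun _ => zero_mul _)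
    (fun φ h1 h2 y hy => shift_defect_exp hk h1 h2 hy) ht
  have h2 := norm_convL_dilL_le hk hp1 hpk (memLp_expFun₂ k) integral_expFun₂ hD0
    (u := u) (fun φ => ∫ x in Ioi 0, φ x * ((1 - x) * Real.exp (-x)))
    (fun φ => by rw [hu, mul_zero])
    (fun φ h1 h2 y hy => shift_defect_exp₂ hk hp2 h1 h2 hy) ht
  have h0 := norm_dilL_le hk0 ht u
  rw [← expL] at h1
  rw [← expL₂] at h2
  have he0 : Real.exp (-t) ≤ Real.exp (-((p - 1) * t)) := by
    gcongr
    nlinarith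
  have he1 : Real.exp (-t) ≤ 1 := by simpa using ht
  have hepos := Real.exp_pos (-t)
  set e := Real.exp (-((p - 1) * t)) with he
  have he3 : 0 < e := Real.exp_pos _
  rw [linT_apply]
  have n1 : ‖Real.exp (-(2 * t)) • dilL hk0 t u‖ ≤ e * ‖u‖ := by
    rw [norm_smul, Real.norm_eq_abs, Real.abs_exp]
    calc _ ≤ Real.exp (-(2 * t)) * (Real.exp t * ‖u‖) := by gcongr
      _ = Real.exp (-t) * ‖u‖ := by rw [← mul_assoc, ← Real.exp_add]; ring_nf
      _ ≤ _ := by gcongr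
  have n2 : ‖(2 * Real.exp (-t) * (1 - Real.exp (-t))) • convL hk0 (expL k) (dilL hk0 t u)‖ ≤
      4 * D * e * ‖u‖ := by
    rw [norm_smul, Real.norm_of_nonneg (mul_nonneg (by positivity) (by linarith))]
    simp only [sub_self, zero_mul, neg_zero, Real.exp_zero, mul_one] at h1
    have : 2 * Real.exp (-t) * (1 - Real.exp (-t)) ≤ 2 * e := by nlinarith
    calc _ ≤ 2 * e * (2 * D * ‖u‖) := by gcongr
      _ = _ := by ring
  have n3 : ‖(1 - Real.exp (-t)) ^ 2 • convL hk0 (expL₂ k) (dilL hk0 t u)‖ ≤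
      2 * D * e * ‖u‖ := by
    rw [norm_smul, Real.norm_of_nonneg (sq_nonneg _)]
    have : (1 - Real.exp (-t)) ^ 2 ≤ 1 := by nlinarith
    calc _ ≤ 1 * (2 * D * e * ‖u‖) := by gcongr
      _ = _ := by ring
  calc _ ≤ _ := norm_add₃_le
    _ ≤ e * ‖u‖ + 4 * D * e * ‖u‖ + 2 * D * e * ‖u‖ := by gcongr
    _ = _ := by ring

end

section

variable {k : ℝ}

/-! ### Changing the growth rate of a solution -/

theorem CharSol.exp_smul (hk : 1 ≤ k) {u g : ℝ → L1 k} (hu : Continuous u) (hg : Continuous g)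
    (h : CharSol k u g) (ν : ℝ) :
    CharSol k (fun t => Real.exp (ν * t) • u t)
      fun t => Real.exp (ν * t) • (ν • u t + g t) := by
  intro ζ hζ t ht
  have hderiv : ∀ s ∈ uIcc 0 t, HasDerivAt (fun s => Real.exp (ν * s) *
      (bern k ζ (u 0) + ∫ s in (0 : ℝ)..s, Real.exp (-s) * bern k (Real.exp s * ζ) (g s)))
      (Real.exp (-s) * bern k (Real.exp s * ζ) (Real.exp (ν * s) • (ν • u s + g s))) s := by
    intro s hs
    rw [uIcc_of_le ht] at hs
    have h1 := hasDerivAt_char hk hg hζ (bern k ζ (u 0)) s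
    have h2 : HasDerivAt (fun s => Real.exp (ν * s)) (Real.exp (ν * s) * (ν * 1)) s :=
      ((hasDerivAt_id s).const_mul ν).exp
    refine (h2.mul h1).congr_deriv ?_
    rw [← h ζ hζ s hs.1, map_smul, map_add, map_smul]
    simp only [smul_eq_mul]
    ring
  have hint := intervalIntegral.integral_eq_sub_of_hasDerivAt hderiv
    ((continuous_char hk (g := fun s => Real.exp (ν * s) • (ν • u s + g s)) (by fun_prop)
      hζ).intervalIntegrable _ _)
  simp only [intervalIntegral.integral_same, add_zero, mul_zero, Real.exp_zero, one_mul] at hint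
  rw [← h ζ hζ t ht] at hint
  simp only [mul_zero, Real.exp_zero, one_smul]
  rw [hint, map_smul, smul_eq_mul]
  ring

theorem CharSol.sub (hk : 1 ≤ k) {u u' g g' : ℝ → L1 k} (hg : Continuous g)
    (hg' : Continuous g') (h : CharSol k u g) (h' : CharSol k u' g') :
    CharSol k (fun t => u t - u' t) fun t => g t - g' t := by
  intro ζ hζ t ht
  have h1 := h ζ hζ t ht
  have h2 := h' ζ hζ t ht
  simp only [map_sub, mul_sub]
  rw [intervalIntegral.integral_sub ((continuous_char hk hg hζ).intervalIntegrable _ _)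
    ((continuous_char hk hg' hζ).intervalIntegrable _ _), h1, h2]
  ring

/-- `f = (ν - A)⁻¹ q`, where `A u = 2 u + x u'`. -/
def IsResolvent (k ν : ℝ) (f q : L1 k) : Prop :=
  CharSol k (fun t => Real.exp (ν * t) • f) fun t => Real.exp (ν * t) • q

theorem continuous_exp_smul (ν : ℝ) (q : L1 k) : Continuous fun t => Real.exp (ν * t) • q := by
  fun_prop

theorem IsResolvent.sub (hk : 1 ≤ k) {ν : ℝ} {f q f' q' : L1 k} (h : IsResolvent k ν f q)
    (h' : IsResolvent k ν f' q') : IsResolvent k ν (f - f') (q - q') := by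
  have := CharSol.sub hk (continuous_exp_smul ν q) (continuous_exp_smul ν q') h h'
  simpa only [IsResolvent, smul_sub] using this

/-- From `(ν - A) f = q` to `(μ + ν - A) f = μ f + q`. It connects large `ν`, where the resolvent is
a convergent integral, with `ν = 0`, which expresses stationarity. -/
theorem IsResolvent.shift (hk : 1 ≤ k) {ν : ℝ} {f q : L1 k} (h : IsResolvent k ν f q) (μ : ℝ) :
    IsResolvent k (μ + ν) f (μ • f + q) := by
  have := CharSol.exp_smul hk (continuous_exp_smul ν f) (continuous_exp_smul ν q) h μ
  have e : ∀ t : ℝ, Real.exp ((μ + ν) * t) = Real.exp (μ * t) * Real.exp (ν * t) := fun t => by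
    rw [add_mul, Real.exp_add]
  unfold IsResolvent
  simp only [e, mul_smul]
  convert this using 3 with t
  rw [smul_add, smul_comm μ]

theorem isResolvent_zero_iff {f q : L1 k} :
    IsResolvent k 0 f q ↔ CharSol k (fun _ => f) fun _ => q := by
  simp [IsResolvent]

theorem norm_bern_le (hk : 0 ≤ k) {z : ℝ} (hz : 0 ≤ z) (u : L1 k) : |bern k z u| ≤ ‖u‖ := by
  rw [bern_apply hk hz, norm_eq_norm1]
  refine (abs_integral_mul_le (C := 1) (fun x hx => ?_) (memLp_coe u)).trans (by rw [one_mul])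
  rw [abs_of_nonneg (bernFun_nonneg (by positivity)), one_mul]
  exact (bernFun_le_one z x).trans (one_le_weight hk hx)

/-- The difference `d` satisfies `e^{νt} d = S_t d`, while dilations grow at most like `e^t`;
letting `t → ∞` kills its transform. -/
theorem IsResolvent.unique (hk : 1 ≤ k) {ν : ℝ} (hν : 1 < ν) {f f' q : L1 k}
    (h : IsResolvent k ν f q) (h' : IsResolvent k ν f' q) : f = f' := by
  have hk0 : 0 ≤ k := zero_le_one.trans hk
  have hd := h.sub hk h'
  rw [sub_self] at hd
  refine bern_injective hk0 fun z hz => ?_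
  rw [← sub_eq_zero, ← map_sub]
  set d := f - f'
  have key : ∀ t : ℝ, 0 ≤ t → |bern k z d| ≤ Real.exp (-((ν - 1) * t)) * ‖d‖ := by
    intro t ht
    have h1 := hd (Real.exp (-t) * z) (by positivity) t ht
    simp only [smul_zero, map_zero, mul_zero, intervalIntegral.integral_zero, add_zero,
      Real.exp_zero, one_smul, map_smul, smul_eq_mul] at h1
    rw [← mul_assoc (Real.exp t), ← Real.exp_add, add_neg_cancel, Real.exp_zero, one_mul,
      ← mul_assoc, ← Real.exp_add] at h1
    have h2 : bern k z d = Real.exp (-((ν - 1) * t)) * bern k (Real.exp (-t) * z) d := by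
      rw [← h1, ← mul_assoc, ← Real.exp_add]
      ring_nf
      simp
    rw [h2, abs_mul, Real.abs_exp]
    gcongr
    exact norm_bern_le hk0 (by positivity) d
  have hlim : Filter.Tendsto (fun t : ℝ => Real.exp (-((ν - 1) * t)) * ‖d‖) Filter.atTop
      (nhds (0 * ‖d‖)) := by
    refine Filter.Tendsto.mul_const _ (Real.tendsto_exp_neg_atTop_nhds_zero.comp ?_)
    exact Filter.tendsto_id.const_mul_atTop (by linarith)
  have h3 : |bern k z d| ≤ 0 * ‖d‖ := by
    refine ge_of_tendsto hlim ?_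
    filter_upwards [Filter.eventually_ge_atTop 0] with t ht using key t ht
  rw [zero_mul] at h3
  exact abs_eq_zero.1 (le_antisymm h3 (abs_nonneg _))

/-! ### The resolvent of the dilation semigroup -/

/-- The resolvent `(ν - A)⁻¹ q = ∫₀^∞ e^{-νs} S_s q ds`. -/
def resolvent (hk : 0 ≤ k) (ν : ℝ) (q : L1 k) : L1 k :=
  ∫ s in Ioi (0 : ℝ), Real.exp (-(ν * s)) • dilL hk s q

section Resolvent

variable {ν : ℝ}

theorem continuous_resolvent_integrand (hk : 0 ≤ k) (ν : ℝ) (q : L1 k) :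
    Continuous fun s => Real.exp (-(ν * s)) • dilL hk s q :=
  Continuous.smul (f := fun s : ℝ => Real.exp (-(ν * s))) (by fun_prop) (continuous_dilL hk q)

theorem norm_resolvent_integrand_le (hk : 0 ≤ k) (ν : ℝ) (q : L1 k) :
    ∀ᵐ s ∂volume.restrict (Ioi (0 : ℝ)), ‖Real.exp (-(ν * s)) • dilL hk s q‖ ≤
      Real.exp (-((ν - 1) * s)) * ‖q‖ := by
  filter_upwards [ae_restrict_mem measurableSet_Ioi] with s hs
  have hs : 0 < s := hs
  rw [norm_smul, Real.norm_eq_abs, Real.abs_exp]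
  calc _ ≤ Real.exp (-(ν * s)) * (Real.exp s * ‖q‖) := by
        gcongr
        exact norm_dilL_le hk hs.le q
    _ = _ := by
        rw [← mul_assoc, ← Real.exp_add]
        ring_nf

theorem integrable_resolvent (hk : 0 ≤ k) (hν : 1 < ν) (q : L1 k) :
    IntegrableOn (fun s => Real.exp (-(ν * s)) • dilL hk s q) (Ioi 0) :=
  Integrable.mono' ((integrableOn_exp_neg_mul (by linarith : 0 < ν - 1)).mul_const ‖q‖)
    (continuous_resolvent_integrand hk ν q).aestronglyMeasurable
    (norm_resolvent_integrand_le hk ν q)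

theorem norm_resolvent_le (hk : 0 ≤ k) (hν : 1 < ν) (q : L1 k) :
    ‖resolvent hk ν q‖ ≤ ‖q‖ / (ν - 1) := by
  refine (norm_integral_le_of_norm_le ((integrableOn_exp_neg_mul
    (by linarith : 0 < ν - 1)).mul_const ‖q‖) (norm_resolvent_integrand_le hk ν q)).trans ?_
  rw [integral_mul_const, integral_exp_neg_mul (by linarith)]
  apply le_of_eq
  ring

theorem resolvent_sub (hk : 0 ≤ k) (hν : 1 < ν) (q q' : L1 k) :
    resolvent hk ν (q - q') = resolvent hk ν q - resolvent hk ν q' := by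
  rw [resolvent, resolvent, resolvent, ← integral_sub (integrable_resolvent hk hν q)
    (integrable_resolvent hk hν q')]
  simp only [map_sub, smul_sub]

theorem isResolvent_resolvent (hk : 1 ≤ k) (hν : 1 < ν) (q : L1 k) :
    IsResolvent k ν (resolvent (zero_le_one.trans hk) ν q) q := by
  have hk0 : 0 ≤ k := zero_le_one.trans hk
  refine charSol_of_mild hk (continuous_exp_smul ν q) fun t ht => ?_
  simp only [mul_zero, Real.exp_zero, one_smul]
  set F : ℝ → L1 k := fun s => Real.exp (-(ν * s)) • dilL hk0 s q with hF
  have hFi := integrable_resolvent hk0 hν q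
  have h1 : dilL hk0 t (resolvent hk0 ν q) = Real.exp (ν * t) • ∫ s in Ioi t, F s := by
    have hm := (measurePreserving_add_right (volume : Measure ℝ) t).setIntegral_preimage_emb
      (measurableEmbedding_addRight t) F (Ioi t)
    have hset : (fun x => x + t) ⁻¹' Ioi t = Ioi 0 := by
      ext x
      simp
    rw [hset] at hm
    rw [← hm, resolvent, ← ContinuousLinearMap.integral_comp_comm _ hFi, ← integral_smul]
    refine setIntegral_congr_fun measurableSet_Ioi fun s hs => ?_
    have hs : 0 < s := hs
    simp only [hF]
    rw [map_smul, smul_smul, ← Real.exp_add, add_comm s t, dilL_add hk0 ht hs.le]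
    ring_nf
  have h2 : ∫ s in (0 : ℝ)..t, dilL hk0 (t - s) (Real.exp (ν * s) • q) =
      Real.exp (ν * t) • ∫ s in (0 : ℝ)..t, F s := by
    have h3 := intervalIntegral.integral_comp_sub_left
      (fun s => Real.exp (ν * t) • F s) t (a := 0) (b := t)
    rw [sub_self, sub_zero, intervalIntegral.integral_smul, intervalIntegral.integral_smul] at h3
    rw [← h3, ← intervalIntegral.integral_smul]
    refine intervalIntegral.integral_congr fun s _ => ?_
    simp only [hF]
    rw [map_smul, smul_smul, ← Real.exp_add]
    ring_nf
  rw [h1, h2, ← smul_add, add_comm, intervalIntegral.integral_interval_add_Ioi hFi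
    (hFi.mono_set (Ioi_subset_Ioi ht))]
  rfl

theorem massL_resolvent (hk : 1 ≤ k) (hν : 1 < ν) (q : L1 k) :
    massL k (resolvent (zero_le_one.trans hk) ν q) = massL k q / ν := by
  rw [resolvent, ← ContinuousLinearMap.integral_comp_comm _
    (integrable_resolvent (zero_le_one.trans hk) hν q)]
  simp only [map_smul, massL_dilL hk, smul_eq_mul]
  rw [integral_mul_const, integral_exp_neg_mul (by linarith)]
  ring

theorem isTest_indicator (hk : 0 ≤ k) {s : Set ℝ} (hs : MeasurableSet s) :
    IsTest k (s.indicator fun _ => 1) := by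
  refine ⟨measurable_const.indicator hs, 1, fun x hx => ?_⟩
  rw [one_mul]
  refine le_trans ?_ (one_le_weight hk hx)
  by_cases h : x ∈ s <;> simp [h]

/-- Expressing nonnegativity by continuous linear functionals makes it a closed condition and one
that Bochner integrals preserve. -/
theorem nonneg_iff_pairing (hk : 0 ≤ k) {u : L1 k} :
    Nonneg u ↔ ∀ s, MeasurableSet s → 0 ≤ pairing k (s.indicator fun _ => 1) u := by
  constructor
  · intro h s hs
    rw [pairing_apply (isTest_indicator hk hs)]
    refine integral_nonneg_of_ae ?_
    filter_upwards [h] with x hx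
    exact mul_nonneg (indicator_nonneg (fun _ _ => zero_le_one) _) hx
  · intro h
    refine ae_nonneg_of_forall_setIntegral_nonneg
      (integrableOn_of_memLp hk (memLp_coe u)) fun s hs _ => ?_
    have := h s hs
    rw [pairing_apply (isTest_indicator hk hs)] at this
    rw [← integral_indicator hs]
    convert this using 2
    ext x
    by_cases hx : x ∈ s <;> simp [hx]

theorem isClosed_nonneg (hk : 0 ≤ k) : IsClosed {u : L1 k | Nonneg u} := by
  have : {u : L1 k | Nonneg u} = ⋂ (s : Set ℝ) (_ : MeasurableSet s),
      {u : L1 k | 0 ≤ pairing k (s.indicator fun _ => 1) u} := by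
    ext u
    simp only [mem_ofPred_eq, mem_iInter]
    exact nonneg_iff_pairing hk
  rw [this]
  exact isClosed_iInter fun s => isClosed_iInter fun _ =>
    isClosed_le continuous_const (by fun_prop)

theorem nonneg_resolvent (hk : 0 ≤ k) (hν : 1 < ν) {q : L1 k} (hq : Nonneg q) :
    Nonneg (resolvent hk ν q) := by
  rw [nonneg_iff_pairing hk]
  intro s hs
  rw [resolvent, ← ContinuousLinearMap.integral_comp_comm _ (integrable_resolvent hk hν q)]
  refine integral_nonneg fun t => ?_
  simp only [Pi.zero_apply]
  rw [map_smul, smul_eq_mul]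
  exact mul_nonneg (Real.exp_pos _).le
    ((nonneg_iff_pairing hk).1 (nonneg_dilL hk hq t) s hs)

theorem integral_le_norm (hk : 0 ≤ k) (u : L1 k) : ∫ x in Ioi 0, u x ≤ ‖u‖ := by
  have := abs_integral_mul_le (φ := fun _ => 1) (C := 1) (fun x hx => by
    simpa using one_le_weight hk hx) (memLp_coe u)
  rw [norm_eq_norm1]
  simp only [one_mul] at this
  exact (le_abs_self _).trans this

/-- With enough damping added, the coagulation operator preserves nonnegativity. -/
theorem nonneg_add_bilL (hk : 0 ≤ k) {K : ℝ → ℝ → ℝ} {κ : ℝ} (hK : IsKernel K κ)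
    (hK0 : ∀ x y, 0 < x → 0 < y → 0 ≤ K x y) {f : L1 k} (hf : Nonneg f) {μ : ℝ}
    (hμ : κ * ‖f‖ ≤ μ) : Nonneg (μ • f + bilL hk hK f f : L1 k) := by
  rw [nonneg_iff_pairing hk]
  intro s hs
  have ht := isTest_indicator hk hs
  obtain ⟨hm, C, hC⟩ := isTest_quad hk ht
  set φ : ℝ → ℝ := s.indicator fun _ => 1 with hφ
  have hφ0 : ∀ x, 0 ≤ φ x := fun x => indicator_nonneg (fun _ _ => zero_le_one) x
  rw [map_add, map_smul, pairing_bilL hk hK f f ht, smul_eq_mul]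
  have hp0 : 0 ≤ pairing k φ f := (nonneg_iff_pairing hk).1 hf s hs
  have hi := integrable_quad hK (memLp_coe f) (memLp_coe f) hm hC
  have hi2 : Integrable (fun p : ℝ × ℝ => κ * ((φ p.1 * f p.1) * f p.2)) quadrant :=
    ((ht.integrable (memLp_coe f)).mul_prod (integrableOn_of_memLp hk (memLp_coe f))).const_mul κ
  have hf1 : ∀ᵐ p ∂quadrant, 0 ≤ f p.1 := Measure.quasiMeasurePreserving_fst.ae hf
  have hf2 : ∀ᵐ p ∂quadrant, 0 ≤ f p.2 := Measure.quasiMeasurePreserving_snd.ae hf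
  -- The gain is nonnegative and dropped; the loss is at most `κ ‖f‖` times the pairing with `f`,
  -- which the damping `μ` covers.
  have h1 : ∫ p, -(κ * ((φ p.1 * f p.1) * f p.2)) ∂quadrant ≤
      ∫ p, K p.1 p.2 * (f p.1 * f p.2) * (1 / 2 * φ (p.1 + p.2) - φ p.1) ∂quadrant := by
    refine integral_mono_ae hi2.neg hi ?_
    filter_upwards [hf1, hf2, ae_quadrant] with p h1 h2 hp
    have h3 := hK0 p.1 p.2 hp.1 hp.2
    have h4 := (le_abs_self _).trans (hK.le p.1 p.2 hp.1 hp.2)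
    have h5 := hφ0 p.1
    have h6 := hφ0 (p.1 + p.2)
    have h7 : 0 ≤ K p.1 p.2 * (f p.1 * f p.2) * (1 / 2 * φ (p.1 + p.2)) := by positivity
    have h8 : K p.1 p.2 * (f p.1 * f p.2 * φ p.1) ≤ κ * (f p.1 * f p.2 * φ p.1) := by gcongr
    linarith
  have h2 : ∫ p, -(κ * ((φ p.1 * f p.1) * f p.2)) ∂quadrant =
      -(κ * (pairing k φ f * ∫ x in Ioi 0, f x)) := by
    rw [integral_neg, integral_const_mul, quadrant,
      integral_prod_mul (fun x => φ x * f x) (fun x => f x), pairing_apply ht]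
  have h3 : κ * (pairing k φ f * ∫ x in Ioi 0, f x) ≤ μ * pairing k φ f := by
    calc _ = κ * (∫ x in Ioi 0, f x) * pairing k φ f := by ring
      _ ≤ κ * ‖f‖ * pairing k φ f := by
        have := hK.nonneg
        gcongr
        exact integral_le_norm hk f
      _ ≤ _ := by gcongr
  linarith

end Resolvent

end

section

variable {k : ℝ}

/-! ### A norm for which the linearised semigroup is a strict contraction -/

/-- The equivalent norm `sup_{t ≥ 0} e^{γ t} ‖T_t u‖` on the functions of zero mass. -/
def decayNorm (hk : 0 ≤ k) (γ : ℝ) (u : L1 k) : ℝ :=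
  ⨆ t : Ici (0 : ℝ), Real.exp (γ * t) * ‖linT hk t u‖

/-- The linearised semigroup decays like `C e^{-γ t}` on functions of zero mass. -/
def DecaysWith (hk : 0 ≤ k) (γ C : ℝ) : Prop :=
  ∀ t, 0 ≤ t → ∀ u : L1 k, massL k u = 0 → ‖linT hk t u‖ ≤ C * Real.exp (-(γ * t)) * ‖u‖

section DecayNorm

variable {hk : 0 ≤ k} {γ C : ℝ} {u v : L1 k}

theorem DecaysWith.weighted_le (h : DecaysWith hk γ C) (hu : massL k u = 0) {t : ℝ}
    (ht : 0 ≤ t) : Real.exp (γ * t) * ‖linT hk t u‖ ≤ C * ‖u‖ := by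
  calc _ ≤ Real.exp (γ * t) * (C * Real.exp (-(γ * t)) * ‖u‖) := by
        gcongr
        exact h t ht u hu
    _ = (Real.exp (γ * t) * Real.exp (-(γ * t))) * (C * ‖u‖) := by ring
    _ = _ := by rw [← Real.exp_add]; simp

theorem DecaysWith.le_decayNorm (h : DecaysWith hk γ C) (hu : massL k u = 0) {t : ℝ}
    (ht : 0 ≤ t) : Real.exp (γ * t) * ‖linT hk t u‖ ≤ decayNorm hk γ u := by
  refine le_ciSup (f := fun t : Ici (0 : ℝ) => Real.exp (γ * t) * ‖linT hk t u‖) ?_ ⟨t, ht⟩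
  refine ⟨C * ‖u‖, ?_⟩
  rintro _ ⟨t, rfl⟩
  exact h.weighted_le hu t.2

theorem decayNorm_le {B : ℝ} (h : ∀ t, 0 ≤ t → Real.exp (γ * t) * ‖linT hk t u‖ ≤ B) :
    decayNorm hk γ u ≤ B := by
  have : Nonempty (Ici (0 : ℝ)) := ⟨⟨0, self_mem_Ici⟩⟩
  exact ciSup_le fun t => h t t.2

theorem DecaysWith.decayNorm_le_norm (h : DecaysWith hk γ C) (hu : massL k u = 0) :
    decayNorm hk γ u ≤ C * ‖u‖ := decayNorm_le fun _ ht => h.weighted_le hu ht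

theorem DecaysWith.norm_le_decayNorm (h : DecaysWith hk γ C) (hu : massL k u = 0) :
    ‖u‖ ≤ decayNorm hk γ u := by
  have := h.le_decayNorm hu le_rfl
  rwa [linT_zero, mul_zero, Real.exp_zero, one_mul] at this

theorem DecaysWith.decayNorm_add (h : DecaysWith hk γ C) (hu : massL k u = 0)
    (hv : massL k v = 0) : decayNorm hk γ (u + v) ≤ decayNorm hk γ u + decayNorm hk γ v := by
  refine decayNorm_le fun t ht => ?_
  rw [map_add]
  calc _ ≤ Real.exp (γ * t) * (‖linT hk t u‖ + ‖linT hk t v‖) := by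
        gcongr
        exact norm_add_le _ _
    _ = _ := mul_add _ _ _
    _ ≤ _ := add_le_add (h.le_decayNorm hu ht) (h.le_decayNorm hv ht)

theorem DecaysWith.decayNorm_smul (h : DecaysWith hk γ C) (hu : massL k u = 0) {c : ℝ}
    (hc : 0 ≤ c) : decayNorm hk γ (c • u) ≤ c * decayNorm hk γ u := by
  refine decayNorm_le fun t ht => ?_
  rw [map_smul, norm_smul, Real.norm_of_nonneg hc, mul_left_comm]
  gcongr
  exact h.le_decayNorm hu ht

end DecayNorm

/-- Resolvent estimate for the linearised operator. -/
theorem decayNorm_resolvent_le (hk : 1 ≤ k) {γ C ν : ℝ}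
    (h : DecaysWith (zero_le_one.trans hk) γ C) (hν : 0 < ν + γ) {d w : L1 k}
    (hd : massL k d = 0) (hw : massL k w = 0)
    (hr : IsResolvent k ν d (linB (zero_le_one.trans hk) (expL k) d + w)) :
    (ν + γ) * decayNorm (zero_le_one.trans hk) γ d ≤ decayNorm (zero_le_one.trans hk) γ w := by
  have hk0 : 0 ≤ k := zero_le_one.trans hk
  have hr' : CharSol k (fun t => Real.exp (ν * t) • d) fun s =>
      linB hk0 (expL k) (Real.exp (ν * s) • d) + Real.exp (ν * s) • w := by
    simpa only [IsResolvent, smul_add, map_smul] using hr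
  -- Variation of constants for `e^{νt} d` over one unit of time: `e^ν d = T_1 d + ∫₀¹ T_{1-s}
  -- (e^{νs} w) ds`. In the decay norm `T_t` has norm at most `e^{-γt}`, and a unit of time suffices
  -- for the sharp resolvent bound.
  have hvar := eq_linT_of_charSol hk (continuous_exp_smul ν d) (continuous_exp_smul ν w) hr'
    zero_le_one
  simp only [mul_one, mul_zero, Real.exp_zero, one_smul] at hvar
  set N := decayNorm hk0 γ d
  set M := decayNorm hk0 γ w
  have key : ∀ τ, 0 ≤ τ → Real.exp (γ * τ) * ‖linT hk0 τ d‖ ≤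
      Real.exp (-ν) * (Real.exp (-γ) * N + M * (Real.exp (-γ) *
        ((Real.exp (ν + γ) - 1) / (ν + γ)))) := by
    intro τ hτ
    have hc : Continuous fun s => linT hk0 (1 - s) (Real.exp (ν * s) • w) :=
      continuous_linT_comp hk0 (by fun_prop) (continuous_exp_smul ν w)
    have h1 := congrArg (linT hk0 τ) hvar
    rw [map_smul, map_add, ← ContinuousLinearMap.intervalIntegral_comp_comm _
      (hc.intervalIntegrable _ _), ← linT_add hk0 hτ zero_le_one] at h1
    have h2 : ‖∫ s in (0 : ℝ)..1, linT hk0 τ (linT hk0 (1 - s) (Real.exp (ν * s) • w))‖ ≤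
        ∫ s in (0 : ℝ)..1, M * Real.exp (-(γ * (τ + 1))) * Real.exp ((ν + γ) * s) := by
      refine intervalIntegral.norm_integral_le_of_norm_le zero_le_one ?_
        (Continuous.intervalIntegrable (by fun_prop) _ _)
      refine Filter.Eventually.of_forall fun s hs => ?_
      have hs1 : 0 ≤ 1 - s := by linarith [hs.2]
      rw [← linT_add hk0 hτ hs1, map_smul, norm_smul, Real.norm_eq_abs, Real.abs_exp]
      have h3 := h.le_decayNorm hw (by positivity : 0 ≤ τ + (1 - s))
      have h4 : ‖linT hk0 (τ + (1 - s)) w‖ = Real.exp (-(γ * (τ + (1 - s)))) *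
          (Real.exp (γ * (τ + (1 - s))) * ‖linT hk0 (τ + (1 - s)) w‖) := by
        rw [← mul_assoc, ← Real.exp_add]
        simp
      rw [h4]
      calc _ ≤ Real.exp (ν * s) * (Real.exp (-(γ * (τ + (1 - s)))) * M) := by gcongr
        _ = M * (Real.exp (ν * s) * Real.exp (-(γ * (τ + (1 - s))))) := by ring
        _ = M * (Real.exp (-(γ * (τ + 1))) * Real.exp ((ν + γ) * s)) := by
            rw [← Real.exp_add, ← Real.exp_add]
            ring_nf
        _ = _ := by ring
    have h5 : ∫ s in (0 : ℝ)..1, M * Real.exp (-(γ * (τ + 1))) * Real.exp ((ν + γ) * s) =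
        M * Real.exp (-(γ * (τ + 1))) * ((Real.exp (ν + γ) - 1) / (ν + γ)) := by
      rw [intervalIntegral.integral_const_mul, intervalIntegral.integral_comp_mul_left
        (fun s => Real.exp s) hν.ne', integral_exp]
      simp only [mul_one, mul_zero, Real.exp_zero, smul_eq_mul]
      ring
    rw [h5] at h2
    have h6 := h.le_decayNorm hd (by positivity : 0 ≤ τ + 1)
    have h7 : Real.exp ν * ‖linT hk0 τ d‖ ≤ ‖linT hk0 (τ + 1) d‖ +
        M * Real.exp (-(γ * (τ + 1))) * ((Real.exp (ν + γ) - 1) / (ν + γ)) := by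
      have h8 := congrArg norm h1
      rw [norm_smul, Real.norm_eq_abs, Real.abs_exp] at h8
      rw [h8]
      exact (norm_add_le _ _).trans (by gcongr)
    have e1 : Real.exp (γ * τ) = Real.exp (γ * (τ + 1)) * Real.exp (-γ) := by
      rw [← Real.exp_add]; ring_nf
    have e2 : Real.exp (γ * (τ + 1)) * Real.exp (-(γ * (τ + 1))) = 1 := by
      rw [← Real.exp_add]; simp
    have e3 : Real.exp (-ν) * Real.exp ν = 1 := by rw [← Real.exp_add]; simp
    calc Real.exp (γ * τ) * ‖linT hk0 τ d‖
        = Real.exp (-ν) * (Real.exp (γ * τ) * (Real.exp ν * ‖linT hk0 τ d‖)) := by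
          linear_combination (-(Real.exp (γ * τ) * ‖linT hk0 τ d‖)) * e3
      _ ≤ Real.exp (-ν) * (Real.exp (γ * τ) * (‖linT hk0 (τ + 1) d‖ +
        M * Real.exp (-(γ * (τ + 1))) * ((Real.exp (ν + γ) - 1) / (ν + γ)))) := by gcongr
      _ = Real.exp (-ν) * (Real.exp (-γ) * (Real.exp (γ * (τ + 1)) * ‖linT hk0 (τ + 1) d‖) +
        M * (Real.exp (-γ) * ((Real.exp (ν + γ) - 1) / (ν + γ)))) := by
          rw [e1]
          linear_combination (Real.exp (-ν) * M * (Real.exp (-γ) *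
            ((Real.exp (ν + γ) - 1) / (ν + γ)))) * e2
      _ ≤ _ := by gcongr
  have h9 : N ≤ Real.exp (-ν) * (Real.exp (-γ) * N + M * (Real.exp (-γ) *
        ((Real.exp (ν + γ) - 1) / (ν + γ)))) := decayNorm_le key
  set E := Real.exp (ν + γ) with hE
  have hE1 : 1 < E := Real.one_lt_exp_iff.2 hν
  have h10 : Real.exp (-ν) * (Real.exp (-γ) * N + M * (Real.exp (-γ) * ((E - 1) / (ν + γ)))) =
      E⁻¹ * (N + M * ((E - 1) / (ν + γ))) := by
    rw [hE, ← Real.exp_neg, neg_add, Real.exp_add (-ν)]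
    ring
  -- With `E = e^{ν+γ} > 1`, the inequality `E N ≤ N + M (E - 1) / (ν + γ)` is divided by `E - 1`.
  rw [h10, le_inv_mul_iff₀ (by linarith)] at h9
  have h11 : (E - 1) * N ≤ (E - 1) * (M / (ν + γ)) := by
    have : M * ((E - 1) / (ν + γ)) = (E - 1) * (M / (ν + γ)) := by ring
    linarith
  have h12 := le_of_mul_le_mul_left h11 (by linarith)
  rw [le_div_iff₀ hν] at h12
  linarith

/-! ### Perturbation estimates near the exponential profile -/

section Perturbation

variable {ε : ℝ} {W : ℝ → ℝ → ℝ}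

/-- The coagulation operator with kernel `2 + ε W` as a bilinear operator. -/
def coagB (hk : 0 ≤ k) (hε : 0 ≤ ε) (hW : Admissible W) : L1 k →L[ℝ] L1 k →L[ℝ] L1 k :=
  bilL hk (isKernel_kernel hε hW)

theorem norm_coagB_le (hk : 0 ≤ k) (hε : 0 ≤ ε) (hε1 : ε ≤ 1) (hW : Admissible W) (u v : L1 k) :
    ‖coagB hk hε hW u v‖ ≤ 9 / 2 * (‖u‖ * ‖v‖) := by
  refine (norm_bilL_le hk _ u v).trans ?_
  gcongr
  linarith

theorem massL_coagB_self (hk : 1 ≤ k) (hε : 0 ≤ ε) (hW : Admissible W) (u : L1 k) :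
    massL k (coagB (zero_le_one.trans hk) hε hW u u) = 0 :=
  massL_bilL_self hk _ (kernel_symm hW ε) u

theorem norm_two_le (hk : 0 ≤ k) (u v : L1 k) :
    ‖bilL hk isKernel_two u v‖ ≤ 3 * (‖u‖ * ‖v‖) :=
  (norm_bilL_le hk isKernel_two u v).trans_eq (by ring)

theorem norm_W_le (hk : 0 ≤ k) (hW : Admissible W) (u v : L1 k) :
    ‖bilL hk (isKernel_of_admissible hW) u v‖ ≤ 3 / 2 * (‖u‖ * ‖v‖) :=
  (norm_bilL_le hk _ u v).trans_eq (by ring)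

/-- Difference of the coagulation operator at two functions near the exponential. -/
theorem norm_coagB_sub_le (hk : 0 ≤ k) (hε : 0 ≤ ε) (hW : Admissible W) {f f' : L1 k} {ρ : ℝ}
    (hf : ‖f - expL k‖ ≤ ρ) (hf' : ‖f' - expL k‖ ≤ ρ) :
    ‖coagB hk hε hW f f - coagB hk hε hW f' f' - linB hk (expL k) (f - f')‖ ≤
      (6 * ρ + 3 * ε * (‖expL k‖ + ρ)) * ‖f - f'‖ := by
  set d := f - f' with hd
  set G := expL k
  have hfn : ‖f‖ ≤ ‖G‖ + ρ := by
    have := norm_add_le G (f - G)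
    rw [add_sub_cancel] at this
    linarith
  have hfn' : ‖f'‖ ≤ ‖G‖ + ρ := by
    have := norm_add_le G (f' - G)
    rw [add_sub_cancel] at this
    linarith
  -- In this arrangement each constant-kernel term contains a deviation from the exponential, of
  -- size `ρ`, and the remaining terms carry the factor `ε`.
  have e : coagB hk hε hW f f - coagB hk hε hW f' f' - linB hk G d =
      bilL hk isKernel_two (f - G) d + bilL hk isKernel_two d (f' - G) +
        ε • (bilL hk (isKernel_of_admissible hW) f d +
          bilL hk (isKernel_of_admissible hW) d f') := by
    rw [coagB, bilL_kernel hk hε hW, bilL_kernel hk hε hW, linB_apply, hd]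
    simp only [map_sub, smul_add, smul_sub, sub_apply]
    abel
  rw [e]
  have h1 := norm_two_le hk (f - G) d
  have h2 := norm_two_le hk d (f' - G)
  have h3 := norm_W_le hk hW f d
  have h4 := norm_W_le hk hW d f'
  have hd0 := norm_nonneg d
  calc _ ≤ ‖bilL hk isKernel_two (f - G) d‖ + ‖bilL hk isKernel_two d (f' - G)‖ +
        ‖ε • (bilL hk (isKernel_of_admissible hW) f d +
          bilL hk (isKernel_of_admissible hW) d f')‖ := norm_add₃_le
    _ ≤ 3 * (‖f - G‖ * ‖d‖) + 3 * (‖d‖ * ‖f' - G‖) +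
        ε * (3 / 2 * (‖f‖ * ‖d‖) + 3 / 2 * (‖d‖ * ‖f'‖)) := by
        rw [norm_smul, Real.norm_of_nonneg hε]
        gcongr
        exact (norm_add_le _ _).trans (add_le_add h3 h4)
    _ ≤ 3 * (ρ * ‖d‖) + 3 * (‖d‖ * ρ) +
        ε * (3 / 2 * ((‖G‖ + ρ) * ‖d‖) + 3 / 2 * (‖d‖ * (‖G‖ + ρ))) := by gcongr
    _ = _ := by ring

/-- Difference between the perturbed coagulation operator and the unperturbed one at the
exponential. -/
theorem norm_coagB_sub_expL_le (hk : 0 ≤ k) (hε : 0 ≤ ε) (hW : Admissible W) {f : L1 k} {ρ : ℝ}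
    (hf : ‖f - expL k‖ ≤ ρ) :
    ‖coagB hk hε hW f f - bilL hk isKernel_two (expL k) (expL k) -
      linB hk (expL k) (f - expL k)‖ ≤
      3 * ρ * ‖f - expL k‖ + 3 / 2 * ε * (‖expL k‖ + ρ) ^ 2 := by
  set G := expL k
  set d := f - G with hd
  have hfn : ‖f‖ ≤ ‖G‖ + ρ := by
    have := norm_add_le G (f - G)
    rw [add_sub_cancel] at this
    linarith
  have e : coagB hk hε hW f f - bilL hk isKernel_two G G - linB hk G d =
      bilL hk isKernel_two d d + ε • bilL hk (isKernel_of_admissible hW) f f := by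
    rw [coagB, bilL_kernel hk hε hW, linB_apply, hd]
    simp only [map_sub, sub_apply]
    abel
  rw [e]
  have h1 := norm_two_le hk d d
  have h3 := norm_W_le hk hW f f
  have hd0 := norm_nonneg d
  have hG0 : 0 ≤ ‖G‖ + ρ := (norm_nonneg f).trans hfn
  calc _ ≤ 3 * (‖d‖ * ‖d‖) + ε * (3 / 2 * (‖f‖ * ‖f‖)) := by
        refine (norm_add_le _ _).trans ?_
        rw [norm_smul, Real.norm_of_nonneg hε]
        gcongr
    _ ≤ 3 * (ρ * ‖d‖) + ε * (3 / 2 * ((‖G‖ + ρ) * (‖G‖ + ρ))) := by gcongr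
    _ = _ := by ring

/-- Stationary solutions. -/
def IsStationary (hk : 0 ≤ k) (hε : 0 ≤ ε) (hW : Admissible W) (G : L1 k) : Prop :=
  CharSol k (fun _ => G) fun _ => coagB hk hε hW G G

/-- One step of the implicit Euler scheme, from `g` to `f`. -/
def IsStep (hk : 0 ≤ k) (hε : 0 ≤ ε) (hW : Admissible W) (l : ℝ) (g f : L1 k) : Prop :=
  IsResolvent k l f (l • g + coagB hk hε hW f f)

/-- Fixed points of the scheme are the stationary solutions, whatever the parameter `l`; the case `l
= 0` serves for uniqueness. -/
theorem isStep_self_iff (hk : 1 ≤ k) (hε : 0 ≤ ε) (hW : Admissible W) (l : ℝ) (G : L1 k) :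
    IsStep (zero_le_one.trans hk) hε hW l G G ↔ IsStationary (zero_le_one.trans hk) hε hW G := by
  constructor
  · intro h
    have := IsResolvent.shift hk h (-l)
    rw [neg_add_cancel, neg_smul, neg_add_cancel_left, isResolvent_zero_iff] at this
    exact this
  · intro h
    have := IsResolvent.shift hk (isResolvent_zero_iff.2 h) l
    rwa [add_zero] at this

/-- Along a characteristic the rescaled transform of the exponential is `Y = ζ / (1 + e^s ζ)`, a
solution of the Riccati equation `Y' = -e^s Y²`. -/
theorem charSol_expL (hk : 1 ≤ k) : CharSol k (fun _ => expL k) fun _ =>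
    bilL (zero_le_one.trans hk) isKernel_two (expL k) (expL k) := by
  have hk0 : 0 ≤ k := zero_le_one.trans hk
  intro ζ hζ t ht
  have hderiv : ∀ s ∈ uIcc 0 t, HasDerivAt (fun s => ζ / (1 + Real.exp s * ζ))
      (Real.exp (-s) * bern k (Real.exp s * ζ) (bilL hk0 isKernel_two (expL k) (expL k))) s := by
    intro s _
    have hne : 1 + Real.exp s * ζ ≠ 0 := by positivity
    have h1 : HasDerivAt (fun s => 1 + Real.exp s * ζ) (Real.exp s * ζ) s :=
      ((Real.hasDerivAt_exp s).mul_const ζ).const_add 1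
    refine ((hasDerivAt_const s ζ).div h1 hne).congr_deriv ?_
    rw [bern_bilL_two_self hk0 _ (by positivity), bern_expL hk0 (by positivity), Real.exp_neg]
    have := Real.exp_ne_zero s
    field_simp
    ring
  have hint := intervalIntegral.integral_eq_sub_of_hasDerivAt hderiv
    ((continuous_char hk continuous_const hζ).intervalIntegrable _ _)
  rw [hint, bern_expL hk0 (by positivity), bern_expL hk0 hζ.le, Real.exp_zero, one_mul,
    Real.exp_neg]
  have := Real.exp_ne_zero t
  have hne : 1 + Real.exp t * ζ ≠ 0 := by positivity
  field_simp
  ring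

theorem massL_sub_eq_zero {f g : L1 k} (hf : massL k f = 1) (hg : massL k g = 1) :
    massL k (f - g) = 0 := by rw [map_sub, hf, hg, sub_self]

/-- The implicit Euler scheme contracts near the exponential. -/
theorem decayNorm_step_sub_le (hk : 1 ≤ k) (hε : 0 ≤ ε) (hW : Admissible W) {γ C l ρ : ℝ}
    (hγ : 0 < γ) (hl : 0 ≤ l) (hC : 0 ≤ C) (h : DecaysWith (zero_le_one.trans hk) γ C)
    {f f' g g' : L1 k} (hf1 : massL k f = 1) (hf1' : massL k f' = 1) (hg1 : massL k g = 1)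
    (hg1' : massL k g' = 1) (hf : ‖f - expL k‖ ≤ ρ) (hf' : ‖f' - expL k‖ ≤ ρ)
    (hs : IsStep (zero_le_one.trans hk) hε hW l g f)
    (hs' : IsStep (zero_le_one.trans hk) hε hW l g' f')
    (hsmall : C * (6 * ρ + 3 * ε * (‖expL k‖ + ρ)) ≤ γ / 2) :
    (l + γ / 2) * decayNorm (zero_le_one.trans hk) γ (f - f') ≤
      l * decayNorm (zero_le_one.trans hk) γ (g - g') := by
  have hk0 : 0 ≤ k := zero_le_one.trans hk
  set d := f - f' with hd
  have hd0 : massL k d = 0 := massL_sub_eq_zero hf1 hf1'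
  have he0 : massL k (g - g') = 0 := massL_sub_eq_zero hg1 hg1'
  set r := coagB hk0 hε hW f f - coagB hk0 hε hW f' f' - linB hk0 (expL k) d with hr
  have hr0 : massL k r = 0 := by
    rw [hr, map_sub, map_sub, massL_coagB_self hk, massL_coagB_self hk, massL_linB hk]
    simp
  have hres : IsResolvent k l d (linB hk0 (expL k) d + (l • (g - g') + r)) := by
    have := IsResolvent.sub hk hs hs'
    convert this using 1
    rw [hr, smul_sub]
    abel
  have hw0 : massL k (l • (g - g') + r) = 0 := by
    rw [map_add, map_smul, he0, hr0]
    simp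
  have h1 := decayNorm_resolvent_le hk h (by positivity : 0 < l + γ) hd0 hw0 hres
  have h2 : decayNorm hk0 γ (l • (g - g') + r) ≤
      l * decayNorm hk0 γ (g - g') + C * ‖r‖ := by
    refine (h.decayNorm_add (by rw [map_smul, he0, smul_zero]) hr0).trans ?_
    exact add_le_add (h.decayNorm_smul he0 hl) (h.decayNorm_le_norm hr0)
  have h3 := norm_coagB_sub_le hk0 hε hW hf hf'
  rw [← hd, ← hr] at h3
  have h4 := h.norm_le_decayNorm hd0
  -- Half of the gap `γ` absorbs the remainder; the other half remains as the contraction.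
  have h5 : C * ‖r‖ ≤ γ / 2 * decayNorm hk0 γ d := by
    calc C * ‖r‖ ≤ C * ((6 * ρ + 3 * ε * (‖expL k‖ + ρ)) * ‖d‖) := by gcongr
      _ = C * (6 * ρ + 3 * ε * (‖expL k‖ + ρ)) * ‖d‖ := by ring
      _ ≤ γ / 2 * ‖d‖ := by gcongr
      _ ≤ _ := by gcongr
  linarith

/-- The implicit Euler scheme preserves a ball around the exponential. -/
theorem decayNorm_step_expL_le (hk : 1 ≤ k) (hε : 0 ≤ ε) (hW : Admissible W) {γ C l ρ R : ℝ}
    (hγ : 0 < γ) (hl : 0 ≤ l) (hC : 0 ≤ C) (h : DecaysWith (zero_le_one.trans hk) γ C)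
    {f g : L1 k} (hf1 : massL k f = 1) (hg1 : massL k g = 1) (hf : ‖f - expL k‖ ≤ ρ)
    (hs : IsStep (zero_le_one.trans hk) hε hW l g f)
    (hg : decayNorm (zero_le_one.trans hk) γ (g - expL k) ≤ R)
    (hsmall : C * (3 * ρ) ≤ γ / 2)
    (hsmall' : C * (3 / 2 * ε * (‖expL k‖ + ρ) ^ 2) ≤ γ / 2 * R) :
    decayNorm (zero_le_one.trans hk) γ (f - expL k) ≤ R := by
  have hk0 : 0 ≤ k := zero_le_one.trans hk
  have hG1 := massL_expL hk
  set d := f - expL k with hd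
  have hd0 : massL k d = 0 := massL_sub_eq_zero hf1 hG1
  have he0 : massL k (g - expL k) = 0 := massL_sub_eq_zero hg1 hG1
  set r := coagB hk0 hε hW f f - bilL hk0 isKernel_two (expL k) (expL k) -
    linB hk0 (expL k) d with hr
  have hr0 : massL k r = 0 := by
    rw [hr, map_sub, map_sub, massL_coagB_self hk, massL_linB hk,
      massL_bilL_self hk _ fun _ _ _ _ => rfl]
    simp
  have hres : IsResolvent k l d (linB hk0 (expL k) d + (l • (g - expL k) + r)) := by
    have h0 := IsResolvent.shift hk (isResolvent_zero_iff.2 (charSol_expL hk)) l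
    rw [add_zero] at h0
    have := IsResolvent.sub hk hs h0
    convert this using 1
    rw [hr, smul_sub]
    abel
  have hw0 : massL k (l • (g - expL k) + r) = 0 := by
    rw [map_add, map_smul, he0, hr0]
    simp
  have h1 := decayNorm_resolvent_le hk h (by positivity : 0 < l + γ) hd0 hw0 hres
  have h2 : decayNorm hk0 γ (l • (g - expL k) + r) ≤
      l * decayNorm hk0 γ (g - expL k) + C * ‖r‖ := by
    refine (h.decayNorm_add (by rw [map_smul, he0, smul_zero]) hr0).trans ?_
    exact add_le_add (h.decayNorm_smul he0 hl) (h.decayNorm_le_norm hr0)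
  have h3 := norm_coagB_sub_expL_le hk0 hε hW hf
  rw [← hd, ← hr] at h3
  have h4 := h.norm_le_decayNorm hd0
  have h5 : C * ‖r‖ ≤ γ / 2 * decayNorm hk0 γ d + γ / 2 * R := by
    calc C * ‖r‖ ≤ C * (3 * ρ * ‖d‖ + 3 / 2 * ε * (‖expL k‖ + ρ) ^ 2) := by gcongr
      _ = C * (3 * ρ) * ‖d‖ + C * (3 / 2 * ε * (‖expL k‖ + ρ) ^ 2) := by ring
      _ ≤ γ / 2 * ‖d‖ + γ / 2 * R := by gcongr
      _ ≤ _ := by gcongr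
  have h6 : (l + γ / 2) * decayNorm hk0 γ d ≤ (l + γ / 2) * R := by
    have := mul_le_mul_of_nonneg_left hg hl
    linarith
  exact le_of_mul_le_mul_left h6 (by positivity)

end Perturbation

end

section

variable {k ε : ℝ} {W : ℝ → ℝ → ℝ}

/-! ### Existence of stationary solutions near the exponential -/

/-- The nonnegative functions of mass one at distance at most `ρ` from the exponential. -/
def profileBall (k ρ : ℝ) : Set (L1 k) := {f | Nonneg f ∧ massL k f = 1 ∧ ‖f - expL k‖ ≤ ρ}

theorem isClosed_profileBall (hk : 0 ≤ k) (ρ : ℝ) : IsClosed (profileBall k ρ) :=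
  (isClosed_nonneg hk).inter ((isClosed_eq (massL k).continuous continuous_const).inter
    (isClosed_le (continuous_id.sub continuous_const).norm continuous_const))

theorem profileBall_mono {ρ ρ' : ℝ} (h : ρ ≤ ρ') {f : L1 k} (hf : f ∈ profileBall k ρ) :
    f ∈ profileBall k ρ' := ⟨hf.1, hf.2.1, hf.2.2.trans h⟩

theorem norm_le_of_mem_profileBall {ρ : ℝ} {f : L1 k} (hf : f ∈ profileBall k ρ) :
    ‖f‖ ≤ ‖expL k‖ + ρ := by
  have := norm_add_le (expL k) (f - expL k)
  rw [add_sub_cancel] at this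
  linarith [hf.2.2]

theorem expL_eq_resolvent (hk : 1 ≤ k) {ν : ℝ} (hν : 1 < ν) :
    expL k = resolvent (zero_le_one.trans hk) ν
      (ν • expL k + bilL (zero_le_one.trans hk) isKernel_two (expL k) (expL k)) := by
  have h := IsResolvent.shift hk (isResolvent_zero_iff.2 (charSol_expL hk)) ν
  rw [add_zero] at h
  exact h.unique hk hν (isResolvent_resolvent hk hν _)

theorem nonneg_add_smul {u v : L1 k} (hu : Nonneg u) (hv : Nonneg v) (hk : 0 ≤ k) {c : ℝ}
    (hc : 0 ≤ c) : Nonneg (c • u + v : L1 k) := by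
  rw [nonneg_iff_pairing hk] at *
  intro s hs
  rw [map_add, map_smul, smul_eq_mul]
  exact add_nonneg (mul_nonneg hc (hu s hs)) (hv s hs)

/-- Solvability of one step of the implicit Euler scheme. -/
theorem exists_isStep (hk : 1 ≤ k) : ∃ l : ℝ, 0 < l ∧ ∀ ρ : ℝ, 0 ≤ ρ → ρ ≤ 1 →
    ∀ W : ℝ → ℝ → ℝ, ∀ hW : Admissible W, ∀ ε : ℝ, ∀ hε : 0 ≤ ε, ε ≤ ρ →
    ∀ g ∈ profileBall k ρ, ∃ f ∈ profileBall k (2 * ρ),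
      IsStep (zero_le_one.trans hk) hε hW l g f := by
  have hk0 : 0 ≤ k := zero_le_one.trans hk
  set E := expL k with hE
  set N := ‖E‖ with hN
  have hN0 : 0 ≤ N := norm_nonneg _
  set L := ‖linB hk0 E‖ with hL
  have hL0 : 0 ≤ L := norm_nonneg _
  -- `μ` is the damping which keeps the right-hand side nonnegative: the kernel is at most `3` and
  -- the norm in the ball at most `N + 2`. `A` collects the errors proportional to `ρ`, and `B` is a
  -- Lipschitz constant of the coagulation operator on the ball. With `l = A + 2 + B`, both the
  -- invariance of the ball of radius `2 ρ` and the contraction follow; `l` depends on `k` only, so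
  -- `ρ` can be chosen after it.
  set μ := 3 * (N + 2) with hμ
  set A := 2 * L + 12 + 3 / 2 * (N + 2) ^ 2 with hA
  set B := 9 * (N + 2) with hB
  have hA0 : 0 ≤ A := by positivity
  have hB0 : 0 ≤ B := by positivity
  have hμ0 : 0 ≤ μ := by positivity
  refine ⟨A + 2 + B, by positivity, fun ρ hρ hρ1 W hW ε hε hερ g hg => ?_⟩
  set l := A + 2 + B with hl
  have hl0 : 0 ≤ l := by positivity
  set ν := l + μ with hν
  have hν1 : 1 < ν := by linarith
  have hε1 : ε ≤ 1 := hερ.trans hρ1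
  -- A fixed point solves `(l + μ - A) f = l g + μ f + C(f, f)`, with `A` the generator of the
  -- dilations. This is the Euler step with `μ f` added to both sides.
  set Θ : L1 k → L1 k := fun f =>
    resolvent hk0 ν (l • g + (μ • f + coagB hk0 hε hW f f)) with hΘ
  have hnorm : ∀ f ∈ profileBall k (2 * ρ), ‖f‖ ≤ N + 2 := fun f hf =>
    (norm_le_of_mem_profileBall hf).trans (by linarith)
  have hmaps : MapsTo Θ (profileBall k (2 * ρ)) (profileBall k (2 * ρ)) := by
    intro f hf
    refine ⟨nonneg_resolvent hk0 hν1 (nonneg_add_smul hg.1 (nonneg_add_bilL hk0 _ ?_ hf.1 ?_)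
      hk0 hl0), ?_, ?_⟩
    · intro x y hx hy
      have := hW.nonneg x y hx hy
      unfold kernel
      positivity
    · have := hnorm f hf
      have h0 := norm_nonneg f
      rw [hμ]
      gcongr
      linarith
    · simp only [hΘ]
      rw [massL_resolvent hk hν1, map_add, map_add, map_smul, map_smul, massL_coagB_self hk,
        hg.2.1, hf.2.1]
      have : ν ≠ 0 := by positivity
      simp only [smul_eq_mul, mul_one, add_zero]
      rw [← hν, div_self this]
    -- The exponential is the resolvent of its own right-hand side, so the difference is again a
    -- resolvent and only deviations from `E` have to be estimated.
    · have e : Θ f - E = resolvent hk0 ν (l • (g - E) + μ • (f - E) +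
          (coagB hk0 hε hW f f - bilL hk0 isKernel_two E E - linB hk0 E (f - E)) +
          linB hk0 E (f - E)) := by
        conv_lhs => rw [hE, expL_eq_resolvent hk hν1]
        simp only [hΘ]
        rw [← resolvent_sub hk0 hν1]
        congr 1
        rw [← hE, hν, smul_sub, smul_sub, add_smul l μ E]
        abel
      rw [← hE, e]
      refine (norm_resolvent_le hk0 hν1 _).trans ?_
      rw [div_le_iff₀ (by linarith)]
      have h1 := norm_coagB_sub_expL_le hk0 hε hW hf.2.2
      have h2 := (linB hk0 E).le_opNorm (f - E)
      have h3 := hf.2.2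
      have h4 := hg.2.2
      rw [← hE] at h1 h3 h4
      have h5 := norm_nonneg (f - E)
      calc _ ≤ ‖l • (g - E)‖ + ‖μ • (f - E)‖ + ‖coagB hk0 hε hW f f -
            bilL hk0 isKernel_two E E - linB hk0 E (f - E)‖ + ‖linB hk0 E (f - E)‖ := norm_add₄_le
        _ ≤ l * ρ + μ * (2 * ρ) + (3 * (2 * ρ) * (2 * ρ) + 3 / 2 * ε * (N + 2 * ρ) ^ 2) +
            L * (2 * ρ) := by
            rw [norm_smul, norm_smul, Real.norm_of_nonneg hl0, Real.norm_of_nonneg hμ0]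
            gcongr
            · exact h1.trans (by gcongr)
            · exact h2.trans (by gcongr)
        _ ≤ l * ρ + μ * (2 * ρ) + (3 * (2 * ρ) * (2 * 1) + 3 / 2 * ρ * (N + 2 * 1) ^ 2) +
            L * (2 * ρ) := by gcongr
        _ = ρ * (l + 2 * μ + A) := by rw [hA]; ring
        _ ≤ ρ * (2 * (ν - 1)) := by
            gcongr
            rw [hν, hl]
            linarith
        _ = _ := by ring
  have hlip : ∀ f ∈ profileBall k (2 * ρ), ∀ f' ∈ profileBall k (2 * ρ),
      ‖Θ f - Θ f'‖ ≤ (μ + B) / (ν - 1) * ‖f - f'‖ := by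
    intro f hf f' hf'
    have e : Θ f - Θ f' = resolvent hk0 ν (μ • (f - f') + coagB hk0 hε hW f (f - f') +
        coagB hk0 hε hW (f - f') f') := by
      simp only [hΘ]
      rw [← resolvent_sub hk0 hν1]
      congr 1
      simp only [map_sub, sub_apply, smul_sub]
      abel
    rw [e]
    refine (norm_resolvent_le hk0 hν1 _).trans ?_
    rw [div_mul_eq_mul_div]
    refine div_le_div_of_nonneg_right ?_ (by linarith)
    have h1 := norm_coagB_le hk0 hε hε1 hW f (f - f')
    have h2 := norm_coagB_le hk0 hε hε1 hW (f - f') f'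
    have h3 := hnorm f hf
    have h4 := hnorm f' hf'
    calc _ ≤ ‖μ • (f - f')‖ + ‖coagB hk0 hε hW f (f - f')‖ + ‖coagB hk0 hε hW (f - f') f'‖ :=
          norm_add₃_le
      _ ≤ μ * ‖f - f'‖ + 9 / 2 * ((N + 2) * ‖f - f'‖) + 9 / 2 * (‖f - f'‖ * (N + 2)) := by
          rw [norm_smul, Real.norm_of_nonneg hμ0]
          gcongr
          · exact h1.trans (by gcongr)
          · exact h2.trans (by gcongr)
      _ = _ := by rw [hB]; ring
  have hq0 : 0 ≤ (μ + B) / (ν - 1) := div_nonneg (by positivity) (by linarith)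
  have hq1 : (μ + B) / (ν - 1) < 1 := by
    rw [div_lt_one (by linarith)]
    linarith
  have hcontr : ContractingWith ⟨(μ + B) / (ν - 1), hq0⟩
      (hmaps.restrict Θ (profileBall k (2 * ρ)) (profileBall k (2 * ρ))) := by
    refine ⟨hq1, LipschitzWith.of_dist_le_mul fun x y => ?_⟩
    rw [Subtype.dist_eq, Subtype.dist_eq, dist_eq_norm, dist_eq_norm]
    exact hlip x x.2 y y.2
  obtain ⟨f, hf, hfix, -⟩ := hcontr.exists_fixedPoint' (isClosed_profileBall hk0 _).isComplete
    hmaps (profileBall_mono (by linarith) hg) (edist_ne_top _ _)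
  refine ⟨f, hf, ?_⟩
  have h := isResolvent_resolvent hk hν1 (l • g + (μ • f + coagB hk0 hε hW f f))
  have hfix' : resolvent hk0 ν (l • g + (μ • f + coagB hk0 hε hW f f)) = f := hfix
  rw [hfix'] at h
  -- Removes the artificial damping from both sides.
  have h2 := IsResolvent.shift hk h (-μ)
  have e1 : -μ + ν = l := by rw [hν]; ring
  have e2 : -μ • f + (l • g + (μ • f + coagB hk0 hε hW f f)) =
      l • g + coagB hk0 hε hW f f := by
    rw [neg_smul]; abel
  rw [e1, e2] at h2
  exact h2

/-- Decay of the linearised semigroup in `L¹_k`, `k ≥ 3/2`, at rate at least `1/2`. -/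
theorem exists_decaysWith (hk : 3 / 2 ≤ k) (hk0 : 0 ≤ k) :
    ∃ C : ℝ, 1 ≤ C ∧ DecaysWith hk0 (1 / 2) C := by
  obtain ⟨C, hC, h⟩ := exists_norm_linT_le (k := k) (p := 3 / 2) (by linarith) (by norm_num)
    (by norm_num) hk
  refine ⟨C, hC, fun t ht u hu => ?_⟩
  have := h t ht u hu
  norm_num at this ⊢
  exact this

/-- Uniqueness of stationary solutions near the exponential. -/
theorem exists_stationary_unique (hk : 3 / 2 ≤ k) (hk0 : 0 ≤ k) :
    ∃ ρ ε₀ : ℝ, 0 < ρ ∧ 0 < ε₀ ∧ ∀ W : ℝ → ℝ → ℝ, ∀ hW : Admissible W, ∀ ε : ℝ, ∀ hε : 0 ≤ ε,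
      ε ≤ ε₀ → ∀ G G' : L1 k, massL k G = 1 → massL k G' = 1 → ‖G - expL k‖ ≤ ρ →
      ‖G' - expL k‖ ≤ ρ → IsStationary hk0 hε hW G → IsStationary hk0 hε hW G' → G = G' := by
  have hk1 : 1 ≤ k := by linarith
  obtain ⟨C, hC1, hC⟩ := exists_decaysWith hk hk0
  have hC0 : 0 ≤ C := by linarith
  set N := ‖expL k‖
  have hN : 0 ≤ N := norm_nonneg _
  -- For `ε, ρ' ≤ ρ ≤ 1` the perturbation constant `C (6 ρ' + 3 ε (N + ρ'))` is at most `C (9 + 3 N)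
  -- ρ = 1/4`, half of the gap `1/2`.
  set ρ := 1 / (4 * (C * (9 + 3 * N))) with hρ
  have hρ0 : 0 < ρ := by positivity
  have hρ1 : ρ ≤ 1 := by
    rw [hρ, div_le_one (by positivity)]
    nlinarith [mul_nonneg hC0 hN]
  refine ⟨ρ, ρ, hρ0, hρ0, fun W hW ε hε hερ G G' h1 h2 h3 h4 h5 h6 => ?_⟩
  have hsmall : C * (6 * ρ + 3 * ε * (N + ρ)) ≤ 1 / 2 / 2 := by
    calc _ ≤ C * (6 * ρ + 3 * ρ * (N + 1)) := by gcongr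
      _ = (C * (9 + 3 * N)) * ρ := by ring
      _ = 1 / 2 / 2 := by rw [hρ]; field_simp; norm_num
  -- With `l = 0` the right-hand side of the contraction inequality vanishes.
  have h := decayNorm_step_sub_le hk1 hε hW (l := 0) (by norm_num) le_rfl hC0 hC h1 h2 h1 h2 h3 h4
    ((isStep_self_iff hk1 hε hW 0 G).2 h5) ((isStep_self_iff hk1 hε hW 0 G').2 h6) hsmall
  have h7 := hC.norm_le_decayNorm (massL_sub_eq_zero h1 h2)
  rw [zero_mul] at h
  have h8 : ‖G - G'‖ ≤ 0 := by linarith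
  exact sub_eq_zero.1 (norm_le_zero_iff.1 h8)

/-- Existence of stationary solutions near the exponential. -/
theorem exists_stationary (hk : 3 / 2 ≤ k) (hk0 : 0 ≤ k) {ρ : ℝ} (hρ : 0 < ρ) :
    ∃ ε₀ : ℝ, 0 < ε₀ ∧ ∀ W : ℝ → ℝ → ℝ, ∀ hW : Admissible W, ∀ ε : ℝ, ∀ hε : 0 ≤ ε,
      ε ≤ ε₀ → ∃ G ∈ profileBall k ρ, IsStationary hk0 hε hW G := by
  have hk1 : 1 ≤ k := by linarith
  obtain ⟨C, hC1, hC⟩ := exists_decaysWith hk hk0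
  obtain ⟨l, hl, hstep⟩ := exists_isStep hk1
  have hC0 : 0 ≤ C := by linarith
  set N := ‖expL k‖
  have hN : 0 ≤ N := norm_nonneg _
  -- The factor `1/8`, instead of `1/4`, leaves room for the radius `2 R` in which a step lands.
  set R := min ρ (1 / (8 * (C * (9 + 3 * N)))) with hR
  have hR0 : 0 < R := lt_min hρ (by positivity)
  have hRρ : R ≤ ρ := min_le_left _ _
  have hRC : (C * (9 + 3 * N)) * R ≤ 1 / 8 := by
    calc _ ≤ (C * (9 + 3 * N)) * (1 / (8 * (C * (9 + 3 * N)))) := by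
          gcongr
          exact min_le_right _ _
      _ = _ := by field_simp
  have hR1 : R ≤ 1 / 8 := by nlinarith [mul_nonneg hC0 hN, mul_nonneg (mul_nonneg hC0 hN) hR0.le]
  -- The second entry bounds the forcing by the perturbation, `3/2 C ε (N + 1)²`, by `R / 4`, which
  -- is `γ / 2` times `R`.
  set ε₀ := min R (R / (6 * (C * (N + 1) ^ 2))) with hε₀
  have hε₀C : C * (N + 1) ^ 2 * ε₀ ≤ R / 6 := by
    calc _ ≤ C * (N + 1) ^ 2 * (R / (6 * (C * (N + 1) ^ 2))) := by
          gcongr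
          exact min_le_right _ _
      _ = _ := by field_simp
  refine ⟨ε₀, lt_min hR0 (by positivity), fun W hW ε hε hεε => ?_⟩
  have hεR : ε ≤ R := hεε.trans (min_le_left _ _)
  have hstep' := hstep R hR0.le (by linarith) W hW ε hε hεR
  -- a step from a function which is close for the decay norm
  set S : Set (L1 k) := {g | Nonneg g ∧ massL k g = 1 ∧ decayNorm hk0 (1 / 2) (g - expL k) ≤ R}
    with hS
  have hSball : ∀ g ∈ S, g ∈ profileBall k R := fun g hg =>
    ⟨hg.1, hg.2.1, (hC.norm_le_decayNorm (massL_sub_eq_zero hg.2.1 (massL_expL hk1))).trans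
      hg.2.2⟩
  -- The fixed point argument places `f` only in the ball of radius `2 R` of the original norm, and
  -- iteration would lose more and more. The gap restores the radius `R` in the decay norm.
  have hSstep : ∀ g ∈ S, ∃ f ∈ S, IsStep hk0 hε hW l g f := by
    intro g hg
    obtain ⟨f, hf, hfs⟩ := hstep' g (hSball g hg)
    refine ⟨f, ⟨hf.1, hf.2.1, ?_⟩, hfs⟩
    refine decayNorm_step_expL_le hk1 hε hW (by norm_num) hl.le hC0 hC hf.2.1 hg.2.1 hf.2.2 hfs
      hg.2.2 ?_ ?_
    · nlinarith [mul_nonneg hC0 hN, mul_nonneg (mul_nonneg hC0 hN) hR0.le]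
    · calc C * (3 / 2 * ε * (‖expL k‖ + 2 * R) ^ 2) ≤ C * (3 / 2 * ε₀ * (N + 1) ^ 2) := by
            gcongr
            linarith
        _ = 3 / 2 * (C * (N + 1) ^ 2 * ε₀) := by ring
        _ ≤ _ := by linarith
  have hE : expL k ∈ S := by
    refine ⟨nonneg_expL k, massL_expL hk1, ?_⟩
    rw [sub_self]
    refine (decayNorm_le fun t _ => ?_).trans hR0.le
    simp
  choose! Φ hΦ hΦs using hSstep
  set g : ℕ → L1 k := fun n => Φ^[n] (expL k) with hg
  have hgS : ∀ n, g n ∈ S := fun n => by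
    induction n with
    | zero => exact hE
    | succ n ih =>
      rw [hg]
      simp only [Function.iterate_succ_apply']
      exact hΦ _ ih
  have hgs : ∀ n, IsStep hk0 hε hW l (g n) (g (n + 1)) := fun n => by
    have : g (n + 1) = Φ (g n) := Function.iterate_succ_apply' _ _ _
    rw [this]
    exact hΦs _ (hgS n)
  have hcontr : ∀ {a b a' b' : L1 k}, a ∈ profileBall k (2 * R) → massL k b = 1 →
      a' ∈ profileBall k (2 * R) → massL k b' = 1 → IsStep hk0 hε hW l b a →
      IsStep hk0 hε hW l b' a' →
      decayNorm hk0 (1 / 2) (a - a') ≤ l / (l + 1 / 4) * decayNorm hk0 (1 / 2) (b - b') := by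
    intro a b a' b' ha hb ha' hb' hs hs'
    have h := decayNorm_step_sub_le hk1 hε hW (by norm_num) hl.le hC0 hC ha.2.1 ha'.2.1 hb hb'
      ha.2.2 ha'.2.2 hs hs' ?_
    · rw [div_mul_eq_mul_div, le_div_iff₀ (by positivity)]
      linarith
    · calc _ ≤ C * (6 * (2 * R) + 3 * R * (N + 2 * 1)) := by gcongr; linarith
        _ ≤ 2 * (C * (9 + 3 * N) * R) := by
          nlinarith [mul_nonneg hC0 hN, mul_nonneg (mul_nonneg hC0 hN) hR0.le]
        _ ≤ _ := by linarith
  set q := l / (l + 1 / 4) with hq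
  have hq0 : 0 ≤ q := by positivity
  have hq1 : q < 1 := by rw [hq, div_lt_one (by positivity)]; linarith
  have hgball : ∀ n, g n ∈ profileBall k R := fun n => hSball _ (hgS n)
  have hgball2 : ∀ n, g n ∈ profileBall k (2 * R) := fun n =>
    profileBall_mono (by linarith) (hgball n)
  have hgeom : ∀ n, decayNorm hk0 (1 / 2) (g n - g (n + 1)) ≤
      decayNorm hk0 (1 / 2) (g 0 - g 1) * q ^ n := fun n => by
    induction n with
    | zero => simp
    | succ n ih =>
      refine (hcontr (hgball2 _) (hgball n).2.1 (hgball2 _) (hgball (n + 1)).2.1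
        (hgs n) (hgs (n + 1))).trans ?_
      calc _ ≤ q * (decayNorm hk0 (1 / 2) (g 0 - g 1) * q ^ n) := by gcongr
        _ = _ := by ring
  have hcauchy : CauchySeq g := by
    refine cauchySeq_of_le_geometric q (decayNorm hk0 (1 / 2) (g 0 - g 1)) hq1 fun n => ?_
    rw [dist_eq_norm]
    exact (hC.norm_le_decayNorm (massL_sub_eq_zero (hgball n).2.1 (hgball (n + 1)).2.1)).trans
      (hgeom n)
  obtain ⟨G, hG⟩ := cauchySeq_tendsto_of_complete hcauchy
  have hGball : G ∈ profileBall k R := (isClosed_profileBall hk0 R).mem_of_tendsto hG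
    (Filter.Eventually.of_forall hgball)
  -- `Φ` is a mere choice of steps and is not known to be continuous. Instead, a step `f` from the
  -- limit `G` is compared with the steps from `g n`; the contraction forces `f = G`.
  obtain ⟨f, hf, hfs⟩ := hstep' G hGball
  have hlim : Filter.Tendsto (fun n => g (n + 1)) Filter.atTop (nhds f) := by
    rw [tendsto_iff_norm_sub_tendsto_zero]
    have h1 : Filter.Tendsto (fun n => q * (C * ‖g n - G‖)) Filter.atTop (nhds (q * (C * 0))) :=
      ((tendsto_iff_norm_sub_tendsto_zero.1 hG).const_mul C).const_mul q
    rw [mul_zero, mul_zero] at h1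
    refine squeeze_zero (fun _ => norm_nonneg _) (fun n => ?_) h1
    refine (hC.norm_le_decayNorm (massL_sub_eq_zero (hgball (n + 1)).2.1 hf.2.1)).trans ?_
    refine (hcontr (hgball2 _) (hgball n).2.1 hf hGball.2.1 (hgs n) hfs).trans ?_
    gcongr
    exact hC.decayNorm_le_norm (massL_sub_eq_zero (hgball n).2.1 hGball.2.1)
  have hfG : f = G := tendsto_nhds_unique hlim (hG.comp (Filter.tendsto_add_atTop_nat 1))
  rw [hfG] at hfs
  exact ⟨G, profileBall_mono hRρ hGball, (isStep_self_iff hk1 hε hW l G).1 hfs⟩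

end

section

/-! ### Averaging over dilations -/

theorem integral_Ioi_comp_mul_left_zero (g : ℝ → ℝ) {τ : ℝ} (hτ : 0 < τ) :
    ∫ x in Ioi (0 : ℝ), g (τ * x) = τ⁻¹ * ∫ x in Ioi (0 : ℝ), g x := by
  rw [integral_comp_mul_left_Ioi g 0 hτ, mul_zero, smul_eq_mul]

theorem integrableOn_Ioi_comp_mul_left_zero {g : ℝ → ℝ} (hg : IntegrableOn g (Ioi 0)) {τ : ℝ}
    (hτ : 0 < τ) : IntegrableOn (fun x => g (τ * x)) (Ioi 0) := by
  rwa [integrableOn_Ioi_comp_mul_left_iff g 0 hτ, mul_zero]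

theorem integrable_mul_comp_mul {h p : ℝ → ℝ} (hm : Measurable h) (hi : IntegrableOn h (Ioi 0))
    (hp : Measurable p) (hp1 : IntegrableOn (fun τ => p τ / τ) (Ioi 0)) :
    Integrable (fun q : ℝ × ℝ => p q.2 * h (q.2 * q.1))
      ((volume.restrict (Ioi (0 : ℝ))).prod (volume.restrict (Ioi (0 : ℝ)))) := by
  rw [integrable_prod_iff' (by fun_prop)]
  constructor
  · filter_upwards [ae_restrict_mem measurableSet_Ioi] with τ hτ
    exact (integrableOn_Ioi_comp_mul_left_zero hi hτ).const_mul (p τ)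
  · refine (hp1.norm.mul_const (∫ x in Ioi (0 : ℝ), |h x|)).congr ?_
    filter_upwards [ae_restrict_mem measurableSet_Ioi] with τ hτ
    have hτ : 0 < τ := hτ
    simp only [norm_mul, Real.norm_eq_abs, norm_div]
    rw [integral_const_mul, integral_Ioi_comp_mul_left_zero (fun x => |h x|) hτ, abs_of_pos hτ]
    ring

/-- A function whose dilates are close to it is controlled by its averages over dilations. -/
theorem integral_abs_le_of_dilation_average {h p ω B : ℝ → ℝ} (hm : Measurable h)
    (hi : IntegrableOn h (Ioi 0)) (hp : Measurable p) (hp0 : ∀ τ, 0 < τ → 0 ≤ p τ)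
    (hp1 : IntegrableOn (fun τ => p τ / τ) (Ioi 0))
    (hp2 : IntegrableOn (fun τ => p τ / τ ^ 2) (Ioi 0))
    (hω : ∀ τ, 0 < τ → ∫ x in Ioi 0, |h x - τ ^ 2 * h (τ * x)| ≤ ω τ)
    (hpω : IntegrableOn (fun τ => p τ / τ ^ 2 * ω τ) (Ioi 0)) {a : ℝ} (ha : 0 < a)
    (hB : ∀ x, a < x → |∫ τ in Ioi 0, p τ * h (τ * x)| ≤ B x) (hBi : IntegrableOn B (Ioi a)) :
    (∫ τ in Ioi 0, p τ / τ ^ 2) * ∫ x in Ioi a, |h x| ≤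
      (∫ τ in Ioi 0, p τ / τ ^ 2 * ω τ) + ∫ x in Ioi a, B x := by
  set μ := (volume : Measure ℝ).restrict (Ioi 0) with hμ
  have hI2 := integrable_mul_comp_mul hm hi hp hp1
  have hI1 : Integrable (fun q : ℝ × ℝ => h q.1 * (p q.2 / q.2 ^ 2)) (μ.prod μ) := hi.mul_prod hp2
  -- The weight `p(τ) / τ²` makes `D` that weight times `h(x) - τ² h(τ x)`, the difference between
  -- `h` and its mass-preserving dilation. Integrating over `τ` expresses `h` by these differences
  -- and the average.
  set D : ℝ × ℝ → ℝ := fun q => h q.1 * (p q.2 / q.2 ^ 2) - p q.2 * h (q.2 * q.1) with hD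
  have hDi : Integrable D (μ.prod μ) := hI1.sub hI2
  have hDn := hDi.norm
  set Z := ∫ τ in Ioi 0, p τ / τ ^ 2 with hZ
  have hle : volume.restrict (Ioi a) ≤ μ := Measure.restrict_mono (Ioi_subset_Ioi ha.le) le_rfl
  have hZ0 : 0 ≤ Z := setIntegral_nonneg measurableSet_Ioi fun τ hτ =>
    div_nonneg (hp0 τ hτ) (sq_nonneg τ)
  have hpt : ∀ᵐ x ∂volume.restrict (Ioi a), Z * |h x| ≤ (∫ τ, ‖D (x, τ)‖ ∂μ) + B x := by
    have h1 := ae_mono hle hDi.prod_right_ae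
    have h2 := ae_mono hle hI2.prod_right_ae
    filter_upwards [h1, h2, ae_restrict_mem measurableSet_Ioi] with x h1 h2 hx
    have e : Z * h x = (∫ τ, D (x, τ) ∂μ) + ∫ τ, p τ * h (τ * x) ∂μ := by
      rw [← integral_add h1 h2]
      simp only [hD, sub_add_cancel]
      rw [integral_const_mul, mul_comm]
    have hZe : Z * |h x| = |Z * h x| := by rw [abs_mul, abs_of_nonneg hZ0]
    rw [hZe, e]
    exact (abs_add_le _ _).trans (add_le_add (norm_integral_le_integral_norm fun τ => D (x, τ)) (hB x hx))
  have hDx : Integrable (fun x => ∫ τ, ‖D (x, τ)‖ ∂μ) μ := hDn.integral_prod_left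
  calc Z * ∫ x in Ioi a, |h x| = ∫ x in Ioi a, Z * |h x| := (integral_const_mul _ _).symm
    _ ≤ ∫ x in Ioi a, ((∫ τ, ‖D (x, τ)‖ ∂μ) + B x) :=
        integral_mono_ae ((hi.mono_set (Ioi_subset_Ioi ha.le)).abs.const_mul Z)
          ((hDx.mono_measure hle).add hBi) hpt
    _ = (∫ x in Ioi a, ∫ τ, ‖D (x, τ)‖ ∂μ) + ∫ x in Ioi a, B x :=
        integral_add (hDx.mono_measure hle) hBi
    _ ≤ _ := by
        gcongr
        calc ∫ x in Ioi a, ∫ τ, ‖D (x, τ)‖ ∂μ ≤ ∫ x, ∫ τ, ‖D (x, τ)‖ ∂μ ∂μ :=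
              integral_mono_measure hle
                (Filter.Eventually.of_forall fun x => integral_nonneg fun τ => norm_nonneg _) hDx
          _ = ∫ τ, ∫ x, ‖D (x, τ)‖ ∂μ ∂μ := integral_integral_swap hDn
          _ ≤ _ := by
            refine integral_mono_ae hDn.integral_prod_right hpω ?_
            filter_upwards [ae_restrict_mem measurableSet_Ioi] with τ hτ
            have hτ' : 0 < τ := hτ
            have h3 : ∀ x, ‖D (x, τ)‖ = p τ / τ ^ 2 * |h x - τ ^ 2 * h (τ * x)| := fun x => by
              have hp' : 0 ≤ p τ / τ ^ 2 := div_nonneg (hp0 τ hτ) (sq_nonneg τ)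
              have e : D (x, τ) = p τ / τ ^ 2 * (h x - τ ^ 2 * h (τ * x)) := by
                simp only [hD]
                field_simp
              rw [e, norm_mul, Real.norm_of_nonneg hp', Real.norm_eq_abs]
            simp only [h3]
            rw [integral_const_mul]
            have := hp0 τ hτ
            gcongr
            exact hω τ hτ

/-! ### A family of peaked kernels -/

/-- The function `4 s (1 - s)` of `s = 2^{-τ}`, with a unique maximum at `τ = 1`. -/
def peak (τ : ℝ) : ℝ :=
  4 * (Real.exp (-(Real.log 2 * τ)) * (1 - Real.exp (-(Real.log 2 * τ))))

theorem continuous_peak : Continuous peak := by unfold peak; fun_prop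

theorem peak_one : peak 1 = 1 := by
  rw [peak, mul_one, Real.exp_neg, Real.exp_log two_pos]
  norm_num

theorem peak_eq (τ : ℝ) : peak τ = 1 - (1 - 2 * Real.exp (-(Real.log 2 * τ))) ^ 2 := by
  rw [peak]; ring

theorem peak_le_one (τ : ℝ) : peak τ ≤ 1 := by
  rw [peak_eq]
  linarith [sq_nonneg (1 - 2 * Real.exp (-(Real.log 2 * τ)))]

theorem peak_nonneg {τ : ℝ} (hτ : 0 ≤ τ) : 0 ≤ peak τ := by
  have h2 := Real.log_pos one_lt_two
  have : Real.exp (-(Real.log 2 * τ)) ≤ 1 := Real.exp_le_one_iff.2 (by nlinarith)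
  have h3 := Real.exp_pos (-(Real.log 2 * τ))
  unfold peak
  nlinarith

theorem peak_le {τ : ℝ} (hτ : 0 ≤ τ) : peak τ ≤ 4 * (τ * Real.exp (-(τ / 4))) := by
  have h2 := Real.log_two_gt_d9
  have h2' := Real.log_two_lt_d9
  have h3 : 1 - Real.exp (-(Real.log 2 * τ)) ≤ τ := by
    have := Real.add_one_le_exp (-(Real.log 2 * τ))
    nlinarith
  have h4 : Real.exp (-(Real.log 2 * τ)) ≤ Real.exp (-(τ / 4)) :=
    Real.exp_le_exp.2 (by nlinarith)
  unfold peak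
  calc _ ≤ 4 * (Real.exp (-(Real.log 2 * τ)) * τ) := by gcongr
    _ ≤ 4 * (Real.exp (-(τ / 4)) * τ) := by gcongr
    _ = _ := by ring

/-- Since `peak τ = 1 - (1 - 2^{1-τ})²`, distance of `τ` from `1` costs a fixed amount. On the side
`τ ≤ 1 - δ` the comparison with the other side is `e^a - 1 ≥ 1 - e^{-a}`, that is `cosh a ≥ 1`. -/
theorem exists_peak_le {δ : ℝ} (hδ : 0 < δ) :
    ∃ θ, 0 < θ ∧ θ < 1 ∧ ∀ τ, δ ≤ |τ - 1| → peak τ ≤ θ := by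
  have h2 := Real.log_pos one_lt_two
  set κ := 1 - Real.exp (-(Real.log 2 * δ)) with hκ
  have hκ0 : 0 < κ := by
    have : Real.exp (-(Real.log 2 * δ)) < 1 := Real.exp_lt_one_iff.2 (by nlinarith)
    linarith
  have hκ1 : κ < 1 := by linarith [Real.exp_pos (-(Real.log 2 * δ))]
  refine ⟨1 - κ ^ 2, by nlinarith, by nlinarith, fun τ hτ => ?_⟩
  rw [peak_eq]
  have e : 2 * Real.exp (-(Real.log 2 * τ)) = Real.exp (-(Real.log 2 * (τ - 1))) := by
    rw [show -(Real.log 2 * (τ - 1)) = Real.log 2 + -(Real.log 2 * τ) by ring, Real.exp_add,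
      Real.exp_log two_pos]
  rw [e]
  have hsq : κ ≤ |1 - Real.exp (-(Real.log 2 * (τ - 1)))| := by
    rcases le_abs.1 hτ with h | h
    · refine le_trans ?_ (le_abs_self _)
      have : Real.exp (-(Real.log 2 * (τ - 1))) ≤ Real.exp (-(Real.log 2 * δ)) :=
        Real.exp_le_exp.2 (by nlinarith)
      linarith
    · refine le_trans ?_ (neg_le_abs _)
      have h1 : Real.exp (Real.log 2 * δ) ≤ Real.exp (-(Real.log 2 * (τ - 1))) :=
        Real.exp_le_exp.2 (by nlinarith)
      have h3 : 2 ≤ Real.exp (Real.log 2 * δ) + Real.exp (-(Real.log 2 * δ)) := by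
        have := Real.one_le_cosh (Real.log 2 * δ)
        rw [Real.cosh_eq] at this
        linarith
      linarith
  have := sq_le_sq' (by linarith) hsq
  rw [sq_abs] at this
  linarith

/-- The powers of `peak` concentrate at `τ = 1`. -/
theorem exists_integral_peak_le {ω : ℝ → ℝ} (hω0 : ∀ τ, 0 < τ → 0 ≤ ω τ)
    (hω : ContinuousAt ω 1) (hω1 : ω 1 = 0)
    (hi1 : ∀ n, 4 ≤ n → IntegrableOn (fun τ => peak τ ^ n / τ ^ 2) (Ioi 0))
    (hi2 : ∀ n, 4 ≤ n → IntegrableOn (fun τ => peak τ ^ n / τ ^ 2 * ω τ) (Ioi 0))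
    {η : ℝ} (hη : 0 < η) :
    ∃ n : ℕ, 4 ≤ n ∧ 0 < ∫ τ in Ioi 0, peak τ ^ n / τ ^ 2 ∧
      ∫ τ in Ioi 0, peak τ ^ n / τ ^ 2 * ω τ ≤ η * ∫ τ in Ioi 0, peak τ ^ n / τ ^ 2 := by
  have hω' := Metric.continuousAt_iff.1 hω (η / 2) (by positivity)
  obtain ⟨δ, hδ, hδω⟩ := hω'
  obtain ⟨θ, hθ0, hθ1, hθ⟩ := exists_peak_le hδ
  have hc := Metric.continuousAt_iff.1 (continuous_peak.continuousAt (x := 1)) ((1 - θ) / 2)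
    (by linarith)
  obtain ⟨δ', hδ', hδp⟩ := hc
  set r := min (δ' / 2) (1 / 2) with hr
  have hr0 : 0 < r := by positivity
  have hr1 : r ≤ 1 / 2 := min_le_right _ _
  have hrδ : r ≤ δ' / 2 := min_le_left _ _
  -- A level strictly between `θ` and the maximum `1`: the normalisation is at least of order
  -- `θ'^n`, the contribution away from `τ = 1` at most of order `θ^n`, and their ratio tends to
  -- `0`.
  set θ' := (1 + θ) / 2 with hθ'
  have hθθ' : θ < θ' := by rw [hθ']; linarith
  have hθ'0 : 0 < θ' := by linarith
  -- lower bound of the normalisation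
  have hlow : ∀ n, 4 ≤ n → θ' ^ n * (r / 4) ≤ ∫ τ in Ioi 0, peak τ ^ n / τ ^ 2 := by
    intro n hn
    have hsub : Ioc 1 (1 + r) ⊆ Ioi (0 : ℝ) := fun x hx => lt_trans one_pos hx.1
    calc θ' ^ n * (r / 4) = ∫ τ in Ioc 1 (1 + r), θ' ^ n / 4 := by
          rw [setIntegral_const, Real.volume_real_Ioc_of_le (by linarith), smul_eq_mul]
          ring
      _ ≤ ∫ τ in Ioc 1 (1 + r), peak τ ^ n / τ ^ 2 := by
          refine setIntegral_mono_on (by simp) ((hi1 n hn).mono_set hsub) measurableSet_Ioc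
            fun τ hτ => ?_
          have h1 : dist τ 1 < δ' := by
            rw [Real.dist_eq, abs_of_pos (by linarith [hτ.1])]
            linarith [hτ.2]
          have h2 := hδp h1
          rw [peak_one, Real.dist_eq] at h2
          have h3 : θ' ≤ peak τ := by
            have := (abs_lt.1 h2).1
            rw [hθ']
            linarith
          have h4 : 0 < τ := hsub hτ
          have h5 : τ ^ 2 ≤ 4 := by nlinarith [hτ.2]
          gcongr
          exact pow_nonneg (hθ'0.le.trans h3) n
      _ ≤ _ := by
          refine setIntegral_mono_set (hi1 n hn) ?_ hsub.eventuallyLE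
          filter_upwards [ae_restrict_mem measurableSet_Ioi] with τ hτ
          have hτ : 0 < τ := hτ
          have := peak_nonneg hτ.le
          simp only [Pi.zero_apply]
          positivity
  have hI0 : 0 ≤ ∫ τ in Ioi 0, peak τ ^ 4 / τ ^ 2 * ω τ :=
    setIntegral_nonneg measurableSet_Ioi fun τ hτ => by
      have hτ' : 0 < τ := hτ
      have := hω0 τ hτ'
      positivity
  set I := ∫ τ in Ioi 0, peak τ ^ 4 / τ ^ 2 * ω τ with hI
  have hlim := (tendsto_pow_atTop_nhds_zero_of_lt_one (by positivity : 0 ≤ θ / θ')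
    ((div_lt_one hθ'0).2 hθθ')).mul_const I
  rw [zero_mul] at hlim
  obtain ⟨m, hm⟩ := ((hlim.eventually (gt_mem_nhds
    (by positivity : 0 < η / 2 * (θ' ^ 4 * (r / 4)))))).exists
  refine ⟨m + 4, by omega, lt_of_lt_of_le (by positivity) (hlow (m + 4) (by omega)), ?_⟩
  have hi1' := hi1 (m + 4) (by omega)
  have hi2' := hi2 (m + 4) (by omega)
  set Z := ∫ τ in Ioi 0, peak τ ^ (m + 4) / τ ^ 2 with hZ
  have hbound : ∫ τ in Ioi 0, peak τ ^ (m + 4) / τ ^ 2 * ω τ ≤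
      ∫ τ in Ioi 0, (η / 2 * (peak τ ^ (m + 4) / τ ^ 2) +
        θ ^ m * (peak τ ^ 4 / τ ^ 2 * ω τ)) := by
    refine setIntegral_mono_on hi2' ((hi1'.const_mul _).add ((hi2 4 le_rfl).const_mul _))
      measurableSet_Ioi fun τ hτ => ?_
    have hτ : 0 < τ := hτ
    have h0 := peak_nonneg hτ.le
    have hw := hω0 τ hτ
    rcases lt_or_ge |τ - 1| δ with h | h
    · have h1 := hδω (x := τ) (by rwa [Real.dist_eq])
      rw [hω1, Real.dist_eq, sub_zero, abs_of_nonneg hw] at h1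
      have h2 : 0 ≤ θ ^ m * (peak τ ^ 4 / τ ^ 2 * ω τ) := by positivity
      have h3 : peak τ ^ (m + 4) / τ ^ 2 * ω τ ≤ peak τ ^ (m + 4) / τ ^ 2 * (η / 2) := by gcongr
      linarith
    · have h1 := hθ τ h
      have h2 : 0 ≤ η / 2 * (peak τ ^ (m + 4) / τ ^ 2) := by positivity
      have h3 : peak τ ^ (m + 4) / τ ^ 2 * ω τ ≤ θ ^ m * (peak τ ^ 4 / τ ^ 2 * ω τ) := by
        calc _ = peak τ ^ m * (peak τ ^ 4 / τ ^ 2 * ω τ) := by ring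
          _ ≤ _ := by gcongr
      linarith
  rw [integral_add (hi1'.const_mul _) ((hi2 4 le_rfl).const_mul _), integral_const_mul,
    integral_const_mul] at hbound
  have h1 : θ ^ m * I ≤ η / 2 * Z := by
    have h2 : θ ^ m * I ≤ θ' ^ m * (η / 2 * (θ' ^ 4 * (r / 4))) := by
      have h3 : θ ^ m = θ' ^ m * (θ / θ') ^ m := by
        rw [← mul_pow, mul_div_cancel₀ _ hθ'0.ne']
      rw [h3, mul_assoc]
      gcongr
    have h4 := hlow (m + 4) (by omega)
    calc _ ≤ _ := h2
      _ = η / 2 * (θ' ^ (m + 4) * (r / 4)) := by ring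
      _ ≤ _ := by gcongr
  linarith

end

section

/-! ### Smallness from the transform and equicontinuity under dilations -/

theorem integrableOn_of_abs_le_weight_exp {g : ℝ → ℝ} (hg : Measurable g) {C : ℝ}
    (h : ∀ τ, 0 < τ → |g τ| ≤ C * ((1 + τ) ^ 4 * Real.exp (-τ))) : IntegrableOn g (Ioi 0) := by
  refine Integrable.mono' ((integrableOn_weight_exp 4).const_mul C) hg.aestronglyMeasurable ?_
  filter_upwards [ae_restrict_mem measurableSet_Ioi] with τ hτ
  have := h τ hτ
  rw [Real.norm_eq_abs]
  exact_mod_cast this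

/-- The fourth power is what is needed at the origin: `τ^4` compensates the weight `τ^{-2}` together
with the singularity `τ^{-2}` of `dilationModulus`. -/
theorem peak_pow_le {n : ℕ} (hn : 4 ≤ n) {τ : ℝ} (hτ : 0 ≤ τ) :
    peak τ ^ n ≤ 256 * (τ ^ 4 * Real.exp (-τ)) := by
  calc peak τ ^ n ≤ peak τ ^ 4 := pow_le_pow_of_le_one (peak_nonneg hτ) (peak_le_one τ) hn
    _ ≤ (4 * (τ * Real.exp (-(τ / 4)))) ^ 4 := by
        have := peak_nonneg hτ
        gcongr
        exact peak_le hτ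
    _ = 256 * (τ ^ 4 * Real.exp (-(τ / 4)) ^ 4) := by ring
    _ = _ := by
        rw [← Real.exp_nat_mul]
        congr 3
        push_cast
        ring

/-- Bound for the distance of a function to its dilation by `τ`. -/
def dilationModulus (c τ : ℝ) : ℝ := c * (|τ - 1| * (1 + 1 / τ) * (τ + 1 / τ))

theorem measurable_peak : Measurable peak := continuous_peak.measurable

theorem integrableOn_peak_div {n : ℕ} (hn : 4 ≤ n) :
    IntegrableOn (fun τ => peak τ ^ n / τ) (Ioi 0) := by
  have := measurable_peak
  refine integrableOn_of_abs_le_weight_exp (C := 256) (by fun_prop) fun τ hτ => ?_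
  have h0 := peak_nonneg hτ.le
  rw [abs_of_nonneg (by positivity), div_le_iff₀ hτ]
  refine (peak_pow_le hn hτ.le).trans ?_
  have h1 : τ ^ 4 ≤ (1 + τ) ^ 4 * τ := by
    have : 0 ≤ τ * (1 + 3 * τ + 6 * τ ^ 2 + 3 * τ ^ 3 + τ ^ 4 ) := by positivity
    nlinarith [mul_pos hτ hτ, pow_pos hτ 3, pow_pos hτ 4, pow_pos hτ 5]
  calc _ ≤ 256 * (((1 + τ) ^ 4 * τ) * Real.exp (-τ)) := by gcongr
    _ = _ := by ring

theorem integrableOn_peak_div_sq {n : ℕ} (hn : 4 ≤ n) :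
    IntegrableOn (fun τ => peak τ ^ n / τ ^ 2) (Ioi 0) := by
  have := measurable_peak
  refine integrableOn_of_abs_le_weight_exp (C := 256) (by fun_prop) fun τ hτ => ?_
  have h0 := peak_nonneg hτ.le
  rw [abs_of_nonneg (by positivity), div_le_iff₀ (by positivity)]
  refine (peak_pow_le hn hτ.le).trans ?_
  have h1 : τ ^ 4 ≤ (1 + τ) ^ 4 * τ ^ 2 := by
    nlinarith [mul_pos hτ hτ, pow_pos hτ 3, pow_pos hτ 4, pow_pos hτ 5, pow_pos hτ 6]
  calc _ ≤ 256 * (((1 + τ) ^ 4 * τ ^ 2) * Real.exp (-τ)) := by gcongr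
    _ = _ := by ring

theorem dilationModulus_nonneg {c τ : ℝ} (hc : 0 ≤ c) (hτ : 0 < τ) : 0 ≤ dilationModulus c τ := by
  unfold dilationModulus
  positivity

theorem integrableOn_peak_mul_modulus {n : ℕ} (hn : 4 ≤ n) {c : ℝ} (hc : 0 ≤ c) :
    IntegrableOn (fun τ => peak τ ^ n / τ ^ 2 * dilationModulus c τ) (Ioi 0) := by
  have := measurable_peak
  refine integrableOn_of_abs_le_weight_exp (C := 256 * c)
    (by unfold dilationModulus; fun_prop) fun τ hτ => ?_
  have h0 := peak_nonneg hτ.le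
  have h1 := dilationModulus_nonneg hc hτ
  rw [abs_of_nonneg (by positivity)]
  have h2 : dilationModulus c τ ≤ c * ((1 + τ) * (1 + 1 / τ) * (τ + 1 / τ)) := by
    unfold dilationModulus
    gcongr
    exact abs_le.2 ⟨by linarith, by linarith⟩
  calc peak τ ^ n / τ ^ 2 * dilationModulus c τ
      ≤ 256 * (τ ^ 4 * Real.exp (-τ)) / τ ^ 2 * (c * ((1 + τ) * (1 + 1 / τ) * (τ + 1 / τ))) := by
        gcongr
        exact peak_pow_le hn hτ.le
    _ = 256 * c * ((1 + τ) ^ 2 * (τ ^ 2 + 1) * Real.exp (-τ)) := by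
        field_simp
        ring
    _ ≤ _ := by
        gcongr
        have : τ ^ 2 + 1 ≤ (1 + τ) ^ 2 := by nlinarith
        calc _ ≤ (1 + τ) ^ 2 * (1 + τ) ^ 2 := by gcongr
          _ = _ := by ring

/-- For `τ ≥ 1` the hypothesis is used with `t = log τ`. For `τ < 1` rescaling the integral by `τ`
reduces it to dilation by `1 / τ`. The modulus is a convenient expression dominating both cases
through `log s ≤ s - 1`. -/
theorem dilation_modulus_le {h : ℝ → ℝ} {c : ℝ} (hc : 0 ≤ c)
    (hmod : ∀ t, 0 ≤ t → ∫ x in Ioi 0, |h x - dilate t h x| ≤ c * t * Real.exp t) {τ : ℝ}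
    (hτ : 0 < τ) : ∫ x in Ioi 0, |h x - τ ^ 2 * h (τ * x)| ≤ dilationModulus c τ := by
  have hlog : ∀ s : ℝ, 0 < s → Real.exp (2 * Real.log s) = s ^ 2 := fun s hs => by
    rw [two_mul, Real.exp_add, Real.exp_log hs, sq]
  unfold dilationModulus
  rcases le_or_gt 1 τ with h1 | h1
  · have h2 := hmod (Real.log τ) (Real.log_nonneg h1)
    simp only [dilate, hlog τ hτ, Real.exp_log hτ] at h2
    refine h2.trans ?_
    rw [mul_assoc c, abs_of_nonneg (by linarith)]
    have h3 := Real.log_le_sub_one_of_pos hτ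
    have h4 : 0 ≤ 1 / τ := by positivity
    gcongr
    · calc _ ≤ τ - 1 := h3
        _ = (τ - 1) * 1 := (mul_one _).symm
        _ ≤ _ := by
          gcongr
          linarith
    · linarith
  · have hτ' : 0 < 1 / τ := by positivity
    have h2 := hmod (Real.log (1 / τ)) (Real.log_nonneg (by rw [le_div_iff₀ hτ]; linarith))
    simp only [dilate, hlog _ hτ', Real.exp_log hτ'] at h2
    have h3 := integral_Ioi_comp_mul_left_zero
      (fun x => |h x - (1 / τ) ^ 2 * h (1 / τ * x)|) hτ
    have e : ∀ x, |h x - τ ^ 2 * h (τ * x)| =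
        τ ^ 2 * |h (τ * x) - (1 / τ) ^ 2 * h (1 / τ * (τ * x))| := fun x => by
      have e1 : 1 / τ * (τ * x) = x := by field_simp
      have e2 : τ ^ 2 = |τ ^ 2| := (abs_of_nonneg (by positivity)).symm
      rw [e1]
      conv_rhs => rw [e2]
      rw [← abs_mul, abs_sub_comm]
      congr 1
      field_simp
    simp only [e]
    rw [integral_const_mul, h3]
    have h4 := Real.log_le_sub_one_of_pos hτ'
    calc τ ^ 2 * (τ⁻¹ * _) ≤ τ ^ 2 * (τ⁻¹ * (c * Real.log (1 / τ) * (1 / τ))) := by gcongr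
      _ = c * Real.log (1 / τ) := by field_simp
      _ ≤ c * (1 / τ - 1) := by gcongr
      _ = c * ((1 - τ) * 1 * (1 / τ)) := by field_simp
      _ ≤ _ := by
        rw [abs_sub_comm, abs_of_nonneg (by linarith)]
        gcongr <;> linarith

theorem integrableOn_bernFun_mul {h : ℝ → ℝ} (hi : IntegrableOn h (Ioi 0)) {z : ℝ} (hz : 0 ≤ z) :
    IntegrableOn (fun x => bernFun z x * h x) (Ioi 0) := by
  refine Integrable.mono' hi.norm
    ((measurable_bernFun z).aestronglyMeasurable.mul hi.aestronglyMeasurable) ?_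
  filter_upwards [ae_restrict_mem measurableSet_Ioi] with x hx
  have hx : 0 < x := hx
  have h1 := bernFun_nonneg (z := z) (x := x) (by positivity)
  rw [norm_mul, Real.norm_of_nonneg h1]
  exact mul_le_of_le_one_left (norm_nonneg _) (bernFun_le_one z x)

/-- Binomial expansion of `4^n s^n (1 - s)^n` in powers of `s = e^{-μy}`. The coefficients sum to
zero for `n ≠ 0`, so each exponential may be replaced by minus the corresponding `bernFun`. -/
theorem peak_pow_eq {n : ℕ} (hn : n ≠ 0) (μ y : ℝ) :
    (4 * (Real.exp (-(μ * y)) * (1 - Real.exp (-(μ * y))))) ^ n =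
      ∑ j ∈ Finset.range (n + 1), -(4 ^ n * ((-1) ^ j * (n.choose j))) * bernFun ((n + j) * μ) y := by
  have h1 : ∑ j ∈ Finset.range (n + 1), (4 : ℝ) ^ n * ((-1) ^ j * (n.choose j)) = 0 := by
    rw [← Finset.mul_sum]
    have := Int.alternating_sum_range_choose_of_ne hn
    have h2 : ((∑ m ∈ Finset.range (n + 1), ((-1) ^ m * (n.choose m) : ℤ) : ℤ) : ℝ) = 0 := by
      rw [this]; simp
    push_cast at h2
    rw [h2, mul_zero]
  set s := Real.exp (-(μ * y)) with hs
  have h3 : ∀ j : ℕ, bernFun ((n + j) * μ) y = 1 - s ^ n * s ^ j := fun j => by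
    rw [bernFun, ← pow_add, hs, ← Real.exp_nat_mul]
    congr 2
    push_cast
    ring
  have h4 : ∀ j : ℕ, -((4 : ℝ) ^ n * ((-1) ^ j * (n.choose j))) * (1 - s ^ n * s ^ j) =
      -((4 : ℝ) ^ n * ((-1) ^ j * (n.choose j))) -
        -((4 : ℝ) ^ n * ((-1) ^ j * (n.choose j))) * (s ^ n * s ^ j) := fun j => by ring
  simp only [h3, h4]
  rw [Finset.sum_sub_distrib, Finset.sum_neg_distrib, h1, neg_zero, zero_sub,
    ← Finset.sum_neg_distrib, mul_pow, mul_pow, show (1 - s) = -s + 1 by ring, add_pow,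
    Finset.mul_sum, Finset.mul_sum]
  refine Finset.sum_congr rfl fun j _ => ?_
  rw [one_pow, neg_pow]
  ring

/-- After the substitution `y = τ x` the average is `x⁻¹` times a combination of transform values at
points `z ≤ 2 n log 2 / x`, with coefficients of total size `4^n 2^n`. The bound `η z²` thus gives
decay `x^{-3}`, integrable at infinity. -/
theorem abs_integral_peak_le {h : ℝ → ℝ} (hi : IntegrableOn h (Ioi 0)) {η : ℝ}
    (hb : ∀ z, 0 < z → |∫ x in Ioi 0, bernFun z x * h x| ≤ η * z ^ 2) {n : ℕ} (hn : 4 ≤ n)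
    {x : ℝ} (hx : 0 < x) :
    |∫ τ in Ioi 0, peak τ ^ n * h (τ * x)| ≤
      η * (8 ^ n * (2 * n * Real.log 2) ^ 2) * x ^ (-3 : ℝ) := by
  have hl := Real.log_pos one_lt_two
  have hn0 : n ≠ 0 := by omega
  have hnpos : (0 : ℝ) < n := by positivity
  set μ := Real.log 2 / x with hμ
  have hμ0 : 0 < μ := by positivity
  have hη : 0 ≤ η := by
    have := (abs_nonneg _).trans (hb 1 one_pos)
    linarith
  have e1 : ∫ τ in Ioi 0, peak τ ^ n * h (τ * x) = x⁻¹ * ∫ y in Ioi 0,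
      (4 * (Real.exp (-(μ * y)) * (1 - Real.exp (-(μ * y))))) ^ n * h y := by
    rw [← integral_Ioi_comp_mul_left_zero _ hx]
    refine setIntegral_congr_fun measurableSet_Ioi fun τ _ => ?_
    have : μ * (τ * x) = Real.log 2 * τ := by rw [hμ]; field_simp
    simp only [peak, mul_comm x τ, this]
  have e2 : ∫ y in Ioi 0, (4 * (Real.exp (-(μ * y)) * (1 - Real.exp (-(μ * y))))) ^ n * h y =
      ∑ j ∈ Finset.range (n + 1), -(4 ^ n * ((-1) ^ j * (n.choose j))) *
        ∫ y in Ioi 0, bernFun ((n + j) * μ) y * h y := by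
    simp only [peak_pow_eq hn0, Finset.sum_mul, mul_assoc (-_ : ℝ)]
    rw [integral_finsetSum]
    · simp only [integral_const_mul]
    · intro j _
      exact (integrableOn_bernFun_mul hi (by positivity)).const_mul _
  have hsum : ∑ j ∈ Finset.range (n + 1), ((n.choose j : ℕ) : ℝ) = 2 ^ n := by
    exact_mod_cast Nat.sum_range_choose n
  rw [e1, e2, abs_mul, abs_of_pos (by positivity : 0 < x⁻¹)]
  have e3 : x ^ (-3 : ℝ) = x⁻¹ * (x⁻¹) ^ 2 := by
    rw [Real.rpow_neg hx.le]
    norm_cast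
    field_simp
  calc _ ≤ x⁻¹ * ∑ j ∈ Finset.range (n + 1), 4 ^ n * (n.choose j) * (η * (2 * n * μ) ^ 2) := by
        gcongr
        refine (Finset.abs_sum_le_sum_abs _ _).trans (Finset.sum_le_sum fun j hj => ?_)
        have hj' : (j : ℝ) ≤ n := by exact_mod_cast Nat.lt_succ_iff.1 (Finset.mem_range.1 hj)
        rw [abs_mul]
        have e4 : |-((4 : ℝ) ^ n * ((-1) ^ j * (n.choose j)))| = 4 ^ n * (n.choose j) := by
          rw [abs_neg, abs_mul, abs_mul, abs_pow, abs_pow, abs_neg, abs_one, one_pow, one_mul,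
            Nat.abs_cast, Nat.abs_ofNat]
        rw [e4]
        gcongr
        refine (hb _ (by positivity)).trans ?_
        gcongr
        linarith
    _ = x⁻¹ * (4 ^ n * (∑ j ∈ Finset.range (n + 1), ((n.choose j : ℕ) : ℝ)) *
          (η * (2 * n * μ) ^ 2)) := by
        rw [Finset.mul_sum (Finset.range (n + 1)) _ ((4 : ℝ) ^ n), Finset.sum_mul]
    _ = _ := by
        rw [hsum, e3, hμ, ← mul_pow]
        norm_num
        ring

/-- A function with small transform which is close to its dilates is small in `L¹(a, ∞)`. -/
theorem exists_integral_Ioi_le_of_transform {c a σ : ℝ} (hc : 0 ≤ c) (ha : 0 < a) (hσ : 0 < σ) :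
    ∃ η : ℝ, 0 < η ∧ ∀ h : ℝ → ℝ, Measurable h → IntegrableOn h (Ioi 0) →
      (∀ t, 0 ≤ t → ∫ x in Ioi 0, |h x - dilate t h x| ≤ c * t * Real.exp t) →
      (∀ z, 0 < z → |∫ x in Ioi 0, bernFun z x * h x| ≤ η * z ^ 2) →
      ∫ x in Ioi a, |h x| ≤ σ := by
  have hcont : ContinuousAt (dilationModulus c) 1 := by
    have h1 : ContinuousAt (fun τ : ℝ => 1 / τ) 1 := by
      simp
    unfold dilationModulus
    exact continuousAt_const.mul ((((continuousAt_id.sub continuousAt_const).abs).mul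
      (continuousAt_const.add h1)).mul (continuousAt_id.add h1))
  -- `n` is fixed first, from `c` and `σ` alone, so that the error of replacing `h` by its average
  -- costs at most `σ / 2`. Only then is `η` taken small compared with the factor `A`, which is
  -- exponential in `n`.
  obtain ⟨n, hn, hZ0, hpn⟩ := exists_integral_peak_le (ω := dilationModulus c)
    (fun τ hτ => dilationModulus_nonneg hc hτ) hcont (by simp [dilationModulus])
    (fun n hn => integrableOn_peak_div_sq hn) (fun n hn => integrableOn_peak_mul_modulus hn hc)
    (half_pos hσ)
  set Z := ∫ τ in Ioi 0, peak τ ^ n / τ ^ 2 with hZ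
  set A := (8 : ℝ) ^ n * (2 * n * Real.log 2) ^ 2 with hA
  have hA0 : 0 ≤ A := by positivity
  set J := ∫ x in Ioi a, x ^ (-3 : ℝ) with hJ
  have hJ0 : 0 ≤ J := setIntegral_nonneg measurableSet_Ioi fun x hx =>
    Real.rpow_nonneg (ha.le.trans (le_of_lt hx)) _
  set η := σ / 2 * Z / (A * J + 1) with hη
  have hη0 : 0 < η := by positivity
  refine ⟨η, hη0, fun h hm hi hmod hb => ?_⟩
  have hJi : IntegrableOn (fun x : ℝ => x ^ (-3 : ℝ)) (Ioi a) :=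
    integrableOn_Ioi_rpow_of_lt (by norm_num) ha
  have key := integral_abs_le_of_dilation_average (p := fun τ => peak τ ^ n) hm hi
    (measurable_peak.pow_const n) (fun τ hτ => pow_nonneg (peak_nonneg hτ.le) n)
    (integrableOn_peak_div hn) (integrableOn_peak_div_sq hn)
    (fun τ hτ => dilation_modulus_le hc hmod hτ) (integrableOn_peak_mul_modulus hn hc) ha
    (B := fun x => η * A * x ^ (-3 : ℝ))
    (fun x hx => abs_integral_peak_le hi hb hn (ha.trans hx)) (hJi.const_mul _)
  rw [integral_const_mul, ← hJ] at key
  have h1 : η * A * J ≤ σ / 2 * Z := by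
    calc η * A * J ≤ η * (A * J + 1) := by nlinarith
      _ = σ / 2 * Z := by rw [hη]; field_simp
  have h2 : Z * ∫ x in Ioi a, |h x| ≤ Z * σ := by linarith
  exact le_of_mul_le_mul_left h2 hZ0

end

section

variable {ε : ℝ} {W : ℝ → ℝ → ℝ} {G : L1 1}

/-! ### Bounds for the transform of a stationary solution -/

/-- The transform equals `-1/2` times the integral of `W` against a product that is nonnegative when
`G` is; `0 ≤ W ≤ 1` then bounds it by the value for `W = 1`. -/
theorem abs_bern_W_le (hW : Admissible W) (hG : Nonneg G) {z : ℝ} (hz : 0 ≤ z) :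
    bern 1 z (bilL zero_le_one (isKernel_of_admissible hW) G G) ≤ 0 ∧
      -(1 / 2 * bern 1 z G ^ 2) ≤ bern 1 z (bilL zero_le_one (isKernel_of_admissible hW) G G) := by
  have h1 := bern_bilL_symm zero_le_one (isKernel_of_admissible hW) hW.symm G G hz
  rw [map_add] at h1
  have hb := integrableOn_bernFun_mul (integrableOn_of_memLp zero_le_one (memLp_coe G)) hz
  have hbG : ∀ᵐ x ∂volume.restrict (Ioi (0 : ℝ)), 0 ≤ bernFun z x * G x := by
    filter_upwards [hG, ae_restrict_mem measurableSet_Ioi] with x hx hx0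
    exact mul_nonneg (bernFun_nonneg (mul_nonneg hz (le_of_lt hx0))) hx
  have h2 : ∀ᵐ p ∂quadrant, 0 ≤ bernFun z p.1 * G p.1 :=
    Measure.quasiMeasurePreserving_fst.ae hbG
  have h3 : ∀ᵐ p ∂quadrant, 0 ≤ bernFun z p.2 * G p.2 :=
    Measure.quasiMeasurePreserving_snd.ae hbG
  have h0 : ∀ᵐ p ∂quadrant, 0 ≤ W p.1 p.2 * ((bernFun z p.1 * G p.1) * (bernFun z p.2 * G p.2)) := by
    filter_upwards [h2, h3, ae_quadrant] with p h2 h3 hp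
    exact mul_nonneg (hW.nonneg _ _ hp.1 hp.2) (mul_nonneg h2 h3)
  have h4 : ∫ p, W p.1 p.2 * ((bernFun z p.1 * G p.1) * (bernFun z p.2 * G p.2)) ∂quadrant ≤
      bern 1 z G ^ 2 := by
    have e : bern 1 z G ^ 2 =
        ∫ p, (bernFun z p.1 * G p.1) * (bernFun z p.2 * G p.2) ∂quadrant := by
      rw [quadrant, integral_prod_mul (fun x => bernFun z x * G x) (fun x => bernFun z x * G x),
        bern_apply zero_le_one hz, sq]
    rw [e]
    refine integral_mono_of_nonneg h0 (hb.mul_prod hb) ?_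
    filter_upwards [h2, h3, ae_quadrant] with p h2 h3 hp
    exact mul_le_of_le_one_left (mul_nonneg h2 h3) (hW.le_one _ _ hp.1 hp.2)
  have h5 := integral_nonneg_of_ae h0
  constructor <;> linarith

theorem bern_coagB_bounds (hε : 0 ≤ ε) (hW : Admissible W) (hG : Nonneg G) {z : ℝ} (hz : 0 ≤ z) :
    bern 1 z (coagB zero_le_one hε hW G G) ≤ -bern 1 z G ^ 2 ∧
      -((1 + ε / 2) * bern 1 z G ^ 2) ≤ bern 1 z (coagB zero_le_one hε hW G G) := by
  obtain ⟨h1, h2⟩ := abs_bern_W_le hW hG hz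
  rw [coagB, bilL_kernel zero_le_one hε hW, map_add, map_smul, smul_eq_mul,
    bern_bilL_two_self zero_le_one G hz]
  constructor
  · nlinarith
  · nlinarith

theorem bern_pos (hG : Nonneg G) (hm : massL 1 G = 1) {z : ℝ} (hz : 0 < z) : 0 < bern 1 z G := by
  rw [bern_apply zero_le_one hz.le]
  have hi := integrableOn_bernFun_mul (integrableOn_of_memLp zero_le_one (memLp_coe G)) hz.le
  have h0 : ∀ᵐ x ∂volume.restrict (Ioi (0 : ℝ)), 0 ≤ bernFun z x * G x := by
    filter_upwards [hG, ae_restrict_mem measurableSet_Ioi] with x hx hx0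
    exact mul_nonneg (bernFun_nonneg (mul_nonneg hz.le (le_of_lt hx0))) hx
  refine lt_of_le_of_ne (integral_nonneg_of_ae h0) fun h => ?_
  have h1 := (integral_eq_zero_iff_of_nonneg_ae h0 hi).1 h.symm
  have h2 : mass G = 0 := by
    rw [mass]
    refine integral_eq_zero_of_ae ?_
    filter_upwards [h1, ae_restrict_mem measurableSet_Ioi] with x hx hx0
    have hx0 : 0 < x := hx0
    have h3 : 0 < bernFun z x := by
      have : Real.exp (-(z * x)) < 1 := Real.exp_lt_one_iff.2 (by nlinarith)
      unfold bernFun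
      linarith
    have h4 : G x = 0 := by
      rcases mul_eq_zero.1 hx with h | h
      · exact absurd h h3.ne'
      · exact h
    rw [h4, mul_zero, Pi.zero_apply]
  rw [massL_apply le_rfl, h2] at hm
  exact zero_ne_one hm

/-- Along characteristics, the reciprocal of the transform grows at a rate between `1` and
`1 + ε / 2`. -/
theorem inv_bern_increment (hε : 0 ≤ ε) (hW : Admissible W) (hG : Nonneg G) (hm : massL 1 G = 1)
    (hs : IsStationary zero_le_one hε hW G) {ζ z : ℝ} (hζ : 0 < ζ) (hz : ζ ≤ z) :
    z - ζ ≤ z / bern 1 z G - ζ / bern 1 ζ G ∧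
      z / bern 1 z G - ζ / bern 1 ζ G ≤ (1 + ε / 2) * (z - ζ) := by
  set Y : ℝ → ℝ := fun t => bern 1 ζ G + ∫ s in (0 : ℝ)..t,
    Real.exp (-s) * bern 1 (Real.exp s * ζ) (coagB zero_le_one hε hW G G) with hY
  have hYeq : ∀ t, 0 ≤ t → Y t = Real.exp (-t) * bern 1 (Real.exp t * ζ) G := fun t ht =>
    (hs ζ hζ t ht).symm
  have hYd : ∀ t, HasDerivAt Y
      (Real.exp (-t) * bern 1 (Real.exp t * ζ) (coagB zero_le_one hε hW G G)) t :=
    fun t => hasDerivAt_char le_rfl continuous_const hζ _ t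
  have hYpos : ∀ t, 0 ≤ t → 0 < Y t := fun t ht => by
    rw [hYeq t ht]
    exact mul_pos (Real.exp_pos _) (bern_pos hG hm (by positivity))
  -- The two-sided bounds on coagulation are Riccati inequalities for `Y`; passing to `1 / Y` turns
  -- them into `e^t ≤ (1 / Y)' ≤ (1 + ε/2) e^t`.
  set D : ℝ → ℝ := fun t => -(Real.exp (-t) *
    bern 1 (Real.exp t * ζ) (coagB zero_le_one hε hW G G)) / Y t ^ 2 with hD
  have hId : ∀ t, 0 ≤ t → HasDerivAt (fun t => (Y t)⁻¹) (D t) t := fun t ht =>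
    (hYd t).inv (hYpos t ht).ne'
  have hDb : ∀ t, 0 ≤ t → Real.exp t ≤ D t ∧ D t ≤ (1 + ε / 2) * Real.exp t := by
    intro t ht
    have h1 := bern_coagB_bounds hε hW hG (z := Real.exp t * ζ) (by positivity)
    have h2 := hYpos t ht
    have e : Real.exp t * Y t ^ 2 = Real.exp (-t) * bern 1 (Real.exp t * ζ) G ^ 2 := by
      rw [hYeq t ht, mul_pow, ← mul_assoc, sq (Real.exp (-t)), ← mul_assoc, ← Real.exp_add,
        add_neg_cancel, Real.exp_zero, one_mul]
    have h3 := Real.exp_pos (-t)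
    constructor
    · rw [hD]
      simp only []
      rw [le_div_iff₀ (by positivity), e]
      nlinarith
    · rw [hD]
      simp only []
      rw [div_le_iff₀ (by positivity), mul_assoc, e]
      nlinarith
  have hz0 : 0 < z := hζ.trans_le hz
  set T := Real.log (z / ζ) with hT
  have hT0 : 0 ≤ T := Real.log_nonneg (by rwa [one_le_div hζ])
  have heT : Real.exp T = z / ζ := Real.exp_log (by positivity)
  have hmono : ∀ c : ℝ, ∀ t, 0 ≤ t → HasDerivAt (fun t => (Y t)⁻¹ - c * Real.exp t)
      (D t - c * Real.exp t) t := fun c t ht => (hId t ht).sub ((Real.hasDerivAt_exp t).const_mul c)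
  have h0mem : (0 : ℝ) ∈ Icc 0 T := ⟨le_rfl, hT0⟩
  have hTmem : T ∈ Icc 0 T := ⟨hT0, le_rfl⟩
  have hY0 : (Y 0)⁻¹ = 1 / bern 1 ζ G := by simp [hY]
  have hYT : (Y T)⁻¹ = z / ζ / bern 1 z G := by
    rw [hYeq T hT0, Real.exp_neg, heT, div_mul_cancel₀ _ hζ.ne', mul_inv, inv_inv]
    ring
  have hlow : MonotoneOn (fun t => (Y t)⁻¹ - 1 * Real.exp t) (Icc 0 T) := by
    refine monotoneOn_of_deriv_nonneg (convex_Icc 0 T)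
      (fun t ht => (hmono 1 t ht.1).continuousAt.continuousWithinAt)
      (fun t ht => ?_) fun t ht => ?_
    all_goals rw [interior_Icc] at ht
    · exact (hmono 1 t ht.1.le).differentiableAt.differentiableWithinAt
    · rw [(hmono 1 t ht.1.le).deriv]
      linarith [(hDb t ht.1.le).1]
  have hupp : AntitoneOn (fun t => (Y t)⁻¹ - (1 + ε / 2) * Real.exp t) (Icc 0 T) := by
    refine antitoneOn_of_deriv_nonpos (convex_Icc 0 T)
      (fun t ht => (hmono _ t ht.1).continuousAt.continuousWithinAt)
      (fun t ht => ?_) fun t ht => ?_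
    all_goals rw [interior_Icc] at ht
    · exact (hmono _ t ht.1.le).differentiableAt.differentiableWithinAt
    · rw [(hmono _ t ht.1.le).deriv]
      linarith [(hDb t ht.1.le).2]
  have h1 := hlow h0mem hTmem hT0
  have h2 := hupp h0mem hTmem hT0
  simp only [hY0, hYT, heT, Real.exp_zero] at h1 h2
  have e1 : z / bern 1 z G - ζ / bern 1 ζ G =
      ζ * (z / ζ / bern 1 z G - 1 / bern 1 ζ G) := by field_simp
  have e2 : z - ζ = ζ * (z / ζ - 1) := by field_simp
  rw [e1, e2]
  constructor
  · exact mul_le_mul_of_nonneg_left (by linarith) hζ.le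
  · rw [mul_left_comm]
    exact mul_le_mul_of_nonneg_left (by linarith) hζ.le

theorem tendsto_bern_div (G : L1 1) :
    Filter.Tendsto (fun ζ => bern 1 ζ G / ζ) (nhdsWithin 0 (Ioi 0)) (nhds (massL 1 G)) := by
  have hmi : IntegrableOn (fun x => x * G x) (Ioi 0) := (isTest_id le_rfl).integrable (memLp_coe G)
  have h1 : Filter.Tendsto (fun ζ => ∫ x in Ioi 0, ζ⁻¹ * (bernFun ζ x * G x))
      (nhdsWithin 0 (Ioi 0)) (nhds (∫ x in Ioi 0, x * G x)) := by
    refine tendsto_integral_filter_of_dominated_convergence (fun x => |x * G x|) ?_ ?_ hmi.abs ?_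
    · exact Filter.Eventually.of_forall fun z => ((measurable_bernFun z).aestronglyMeasurable.mul
        (MemLp_aesm (memLp_coe G))).const_mul _
    · filter_upwards [self_mem_nhdsWithin] with ζ hζ
      have hζ : 0 < ζ := hζ
      filter_upwards [ae_restrict_mem measurableSet_Ioi] with x hx
      have hx : 0 < x := hx
      rw [norm_mul, norm_mul, Real.norm_of_nonneg (by positivity : 0 ≤ ζ⁻¹), Real.norm_eq_abs,
        Real.norm_eq_abs, abs_of_nonneg (bernFun_nonneg (by positivity)), abs_mul, abs_of_pos hx,
        ← mul_assoc]
      gcongr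
      rw [inv_mul_le_iff₀ hζ]
      exact bernFun_le ζ x
    · filter_upwards with x
      have hd : HasDerivAt (fun ζ => bernFun ζ x) x 0 := by
        have h2 : HasDerivAt (fun ζ : ℝ => -(ζ * x)) (-(1 * x)) 0 :=
          ((hasDerivAt_id (0 : ℝ)).mul_const x).neg
        refine (h2.exp.const_sub 1).congr_deriv ?_
        simp
      have h3 := hd.tendsto_slope_zero_right
      have h4 : ∀ ζ : ℝ, ζ⁻¹ • (bernFun (0 + ζ) x - bernFun 0 x) = ζ⁻¹ * bernFun ζ x := fun ζ => by
        simp [bernFun]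
      simp only [h4] at h3
      simpa only [mul_assoc] using h3.mul_const (G x)
  rw [massL_apply le_rfl, mass]
  refine h1.congr' ?_
  filter_upwards [self_mem_nhdsWithin] with ζ hζ
  have hζ : 0 < ζ := hζ
  rw [integral_const_mul, bern_apply zero_le_one hζ.le]
  ring

/-- The starting point `ζ` of the characteristic is sent to `0`, where unit mass gives `ζ / F(ζ) →
1`. -/
theorem div_bern_bounds (hε : 0 ≤ ε) (hW : Admissible W) (hG : Nonneg G) (hm : massL 1 G = 1)
    (hs : IsStationary zero_le_one hε hW G) {z : ℝ} (hz : 0 < z) :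
    1 + z ≤ z / bern 1 z G ∧ z / bern 1 z G ≤ 1 + (1 + ε / 2) * z := by
  have hlim : Filter.Tendsto (fun ζ => ζ / bern 1 ζ G) (nhdsWithin 0 (Ioi 0)) (nhds 1) := by
    have h := (tendsto_bern_div G).inv₀ (by rw [hm]; exact one_ne_zero)
    rw [hm, inv_one] at h
    refine h.congr fun ζ => ?_
    rw [inv_div]
  have hid : Filter.Tendsto (fun ζ : ℝ => ζ) (nhdsWithin 0 (Ioi 0)) (nhds 0) :=
    tendsto_nhdsWithin_of_tendsto_nhds Filter.tendsto_id
  have hev : ∀ᶠ ζ in nhdsWithin (0 : ℝ) (Ioi 0), 0 < ζ ∧ ζ ≤ z := by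
    filter_upwards [Ioc_mem_nhdsGT hz] with ζ hζ using hζ
  constructor
  · have h1 := hlim.add (hid.const_sub z)
    rw [sub_zero] at h1
    refine le_of_tendsto h1 ?_
    filter_upwards [hev] with ζ hζ
    linarith [(inv_bern_increment hε hW hG hm hs hζ.1 hζ.2).1]
  · have h1 := hlim.add ((hid.const_sub z).const_mul (1 + ε / 2))
    rw [sub_zero] at h1
    refine ge_of_tendsto h1 ?_
    filter_upwards [hev] with ζ hζ
    linarith [(inv_bern_increment hε hW hG hm hs hζ.1 hζ.2).2]

theorem bern_bounds (hε : 0 ≤ ε) (hW : Admissible W) (hG : Nonneg G) (hm : massL 1 G = 1)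
    (hs : IsStationary zero_le_one hε hW G) {z : ℝ} (hz : 0 < z) :
    z / (1 + (1 + ε / 2) * z) ≤ bern 1 z G ∧ bern 1 z G ≤ z / (1 + z) := by
  have hF := bern_pos hG hm hz
  obtain ⟨h1, h2⟩ := div_bern_bounds hε hW hG hm hs hz
  rw [le_div_iff₀ hF] at h1
  rw [div_le_iff₀ hF] at h2
  constructor
  · rw [div_le_iff₀ (by positivity)]
    linarith
  · rw [le_div_iff₀ (by positivity)]
    linarith

/-- Equal masses make the difference vanish to second order at `z = 0`; the factor `z²` is what the
Tauberian step needs at large `x`. -/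
theorem abs_bern_sub_le (hε : 0 ≤ ε) (hW : Admissible W) (hG : Nonneg G) (hm : massL 1 G = 1)
    (hs : IsStationary zero_le_one hε hW G) {z : ℝ} (hz : 0 < z) :
    |bern 1 z (G - expL 1)| ≤ ε * z ^ 2 := by
  obtain ⟨h1, h2⟩ := bern_bounds hε hW hG hm hs hz
  rw [map_sub, bern_expL zero_le_one hz.le, abs_of_nonpos (by linarith)]
  have h3 : z / (1 + z) - z / (1 + (1 + ε / 2) * z) ≤ ε * z ^ 2 := by
    rw [div_sub_div _ _ (by positivity) (by positivity), div_le_iff₀ (by positivity)]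
    have h4 : 1 ≤ (1 + z) * (1 + (1 + ε / 2) * z) := by
      have : 0 ≤ ε / 2 := by positivity
      nlinarith [mul_pos hz hz, mul_nonneg this hz.le, mul_nonneg (mul_nonneg this hz.le) hz.le]
    have h5 : 0 ≤ ε * z ^ 2 := by positivity
    nlinarith
  linarith

/-! ### Moments -/

theorem integral_profile_le_one (hε : 0 ≤ ε) (hW : Admissible W) (hG : Nonneg G)
    (hm : massL 1 G = 1) (hs : IsStationary zero_le_one hε hW G) : ∫ x in Ioi 0, G x ≤ 1 := by
  refine le_of_tendsto (tendsto_bern (integrableOn_of_memLp zero_le_one (memLp_coe G))) ?_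
  filter_upwards [Filter.eventually_gt_atTop 0] with z hz
  have h := (bern_bounds hε hW hG hm hs hz).2
  rw [bern_apply zero_le_one hz.le] at h
  refine h.trans ?_
  rw [div_le_one (by positivity)]
  linarith

theorem norm_profile_le (hε : 0 ≤ ε) (hW : Admissible W) (hG : Nonneg G)
    (hm : massL 1 G = 1) (hs : IsStationary zero_le_one hε hW G) : ‖G‖ ≤ 2 := by
  have hi := integrableOn_of_memLp zero_le_one (memLp_coe G)
  have hmi : IntegrableOn (fun x => x * G x) (Ioi 0) := (isTest_id le_rfl).integrable (memLp_coe G)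
  have e : norm1 1 G = (∫ x in Ioi 0, G x) + ∫ x in Ioi 0, x * G x := by
    rw [norm1, ← integral_add hi hmi]
    refine integral_congr_ae ?_
    filter_upwards [hG] with x hx
    rw [abs_of_nonneg hx, Real.rpow_one]
    ring
  have h1 := integral_profile_le_one hε hW hG hm hs
  rw [massL_apply le_rfl, mass] at hm
  rw [norm_eq_norm1, e]
  linarith

/-- On `(0, a]` one has `1 ≤ e · e^{-x/a}`, and `∫ e^{-x/a} G` is the total integral, at most `1`,
minus the transform at `1 / a`, which is bounded below by `1 - (a + ε)`. -/
theorem integral_Ioc_profile_le (hε : 0 ≤ ε) (hW : Admissible W) (hG : Nonneg G)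
    (hm : massL 1 G = 1) (hs : IsStationary zero_le_one hε hW G) {a : ℝ} (ha : 0 < a) :
    ∫ x in Ioc 0 a, G x ≤ 3 * (a + ε) := by
  have hi := integrableOn_of_memLp zero_le_one (memLp_coe G)
  have hz : 0 < 1 / a := by positivity
  have hb := integrableOn_bernFun_mul hi hz.le
  have h1 := (bern_bounds hε hW hG hm hs hz).1
  have h2 := integral_profile_le_one hε hW hG hm hs
  rw [bern_apply zero_le_one hz.le] at h1
  have hd := hi.sub hb
  have h3 : ∫ x in Ioc 0 a, G x ≤ ∫ x in Ioc 0 a, Real.exp 1 * (G x - bernFun (1 / a) x * G x) := by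
    refine setIntegral_mono_on_ae (hi.mono_set Ioc_subset_Ioi_self)
      ((hd.mono_set Ioc_subset_Ioi_self).const_mul _) measurableSet_Ioc ?_
    filter_upwards [(ae_restrict_iff' measurableSet_Ioi).1 hG] with x hx hx0
    have hx1 := hx hx0.1
    have e1 : Real.exp 1 * (G x - bernFun (1 / a) x * G x) =
        Real.exp (1 + -(1 / a * x)) * G x := by
      rw [bernFun, Real.exp_add]
      ring
    rw [e1]
    refine le_mul_of_one_le_left hx1 (Real.one_le_exp ?_)
    have : x / a ≤ 1 := (div_le_one ha).2 hx0.2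
    have e2 : 1 / a * x = x / a := by ring
    rw [e2]
    linarith
  have h4 : ∫ x in Ioc 0 a, (G x - bernFun (1 / a) x * G x) ≤
      ∫ x in Ioi 0, (G x - bernFun (1 / a) x * G x) := by
    refine setIntegral_mono_set hd ?_ Ioc_subset_Ioi_self.eventuallyLE
    filter_upwards [hG] with x hx
    have := bernFun_le_one (1 / a) x
    simp only [Pi.zero_apply]
    nlinarith
  have h5 : ∫ x in Ioi 0, (G x - bernFun (1 / a) x * G x) ≤ a + ε := by
    rw [integral_sub hi hb]
    have h6 : 1 - (a + ε) ≤ 1 / a / (1 + (1 + ε / 2) * (1 / a)) := by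
      have e3 : 1 / a / (1 + (1 + ε / 2) * (1 / a)) = 1 / (a + 1 + ε / 2) := by
        field_simp
        ring
      rw [e3, le_div_iff₀ (by positivity)]
      nlinarith [mul_nonneg ha.le hε]
    linarith
  rw [integral_const_mul] at h3
  have h7 : Real.exp 1 ≤ 3 := by linarith [Real.exp_one_lt_d9]
  have h8 : 0 ≤ ∫ x in Ioc 0 a, (G x - bernFun (1 / a) x * G x) := by
    refine integral_nonneg_of_ae ?_
    filter_upwards [ae_restrict_of_ae_restrict_of_subset Ioc_subset_Ioi_self hG] with x hx
    have := bernFun_le_one (1 / a) x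
    simp only [Pi.zero_apply]
    nlinarith
  calc _ ≤ _ := h3
    _ ≤ 3 * (∫ x in Ioc 0 a, (G x - bernFun (1 / a) x * G x)) := by gcongr
    _ ≤ 3 * (a + ε) := by gcongr; exact h4.trans h5

/-- The lower bound on the transform gives `∫ (zx - (1 - e^{-zx})) G ≤ (1 + ε/2) z²`, and the
integrand is at least `(zx)² / 4` times `G` where `zx ≤ 1`. Taking `z = 1 / R` bounds the second
moment on `(0, R]` by `4 + 2 ε`, uniformly in `R`. -/
theorem integrableOn_sq_mul_profile (hε : 0 ≤ ε) (hε1 : ε ≤ 1) (hW : Admissible W) (hG : Nonneg G)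
    (hm : massL 1 G = 1) (hs : IsStationary zero_le_one hε hW G) :
    IntegrableOn (fun x => x ^ 2 * G x) (Ioi 0) ∧ ∫ x in Ioi 0, x ^ 2 * G x ≤ 6 := by
  have hi := integrableOn_of_memLp zero_le_one (memLp_coe G)
  have hmi : IntegrableOn (fun x => x * G x) (Ioi 0) := (isTest_id le_rfl).integrable (memLp_coe G)
  have hm' := hm
  rw [massL_apply le_rfl, mass] at hm'
  have hbound : ∀ R : ℝ, 0 < R → ∫ x in Ioc 0 R, x ^ 2 * G x ≤ 6 := by
    intro R hR
    have hz : 0 < 1 / R := by positivity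
    have hb := integrableOn_bernFun_mul hi hz.le
    have hd : IntegrableOn (fun x => 1 / R * (x * G x) - bernFun (1 / R) x * G x) (Ioi 0) :=
      (hmi.const_mul (1 / R)).sub hb
    have hpos : ∀ x, 0 < x → 0 ≤ 1 / R * x - bernFun (1 / R) x := fun x hx => by
      linarith [bernFun_le (1 / R) x]
    have h1 := (bern_bounds hε hW hG hm hs hz).1
    rw [bern_apply zero_le_one hz.le] at h1
    have h2 : ∫ x in Ioi 0, (1 / R * (x * G x) - bernFun (1 / R) x * G x) ≤
        (1 + ε / 2) * (1 / R) ^ 2 := by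
      rw [integral_sub (hmi.const_mul _) hb, integral_const_mul, hm', mul_one]
      set z := 1 / R
      have h3 : z - (1 + ε / 2) * z ^ 2 ≤ z / (1 + (1 + ε / 2) * z) := by
        rw [le_div_iff₀ (by positivity)]
        have : 0 ≤ (1 + ε / 2) ^ 2 * z ^ 3 := by positivity
        nlinarith
      linarith
    have h3 : ∫ x in Ioc 0 R, x ^ 2 * G x ≤
        ∫ x in Ioc 0 R, 4 * R ^ 2 * (1 / R * (x * G x) - bernFun (1 / R) x * G x) := by
      refine integral_mono_of_nonneg ?_ ((hd.mono_set Ioc_subset_Ioi_self).const_mul _) ?_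
      · filter_upwards [ae_restrict_of_ae_restrict_of_subset Ioc_subset_Ioi_self hG] with x hx
        exact mul_nonneg (sq_nonneg x) hx
      · filter_upwards [ae_restrict_of_ae_restrict_of_subset Ioc_subset_Ioi_self hG,
          ae_restrict_mem measurableSet_Ioc] with x hx hxR
        set u := 1 / R * x with hu
        have hxu : x = R * u := by rw [hu]; field_simp
        have hu1 : u ≤ 1 := by
          rw [hu, one_div, inv_mul_le_iff₀ hR, mul_one]
          exact hxR.2
        have h4 : (1 - u / 2) ^ 2 ≤ Real.exp (-u) := by
          have h5 := Real.add_one_le_exp (-(u / 2))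
          have h6 : Real.exp (-u) = Real.exp (-(u / 2)) ^ 2 := by
            rw [← Real.exp_nat_mul]
            congr 1
            push_cast
            ring
          rw [h6]
          exact pow_le_pow_left₀ (by linarith) (by linarith) 2
        have h7 : x ^ 2 ≤ 4 * R ^ 2 * (u - bernFun (1 / R) x) := by
          rw [bernFun, ← hu]
          calc x ^ 2 = 4 * R ^ 2 * (u ^ 2 / 4) := by
                conv_lhs => rw [hxu]
                ring
            _ ≤ _ := by
                gcongr
                nlinarith
        calc x ^ 2 * G x ≤ 4 * R ^ 2 * (u - bernFun (1 / R) x) * G x := by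
              apply mul_le_mul_of_nonneg_right h7 hx
          _ = _ := by rw [hu]; ring
    have h4 : ∫ x in Ioc 0 R, (1 / R * (x * G x) - bernFun (1 / R) x * G x) ≤
        ∫ x in Ioi 0, (1 / R * (x * G x) - bernFun (1 / R) x * G x) := by
      refine setIntegral_mono_set hd ?_ Ioc_subset_Ioi_self.eventuallyLE
      filter_upwards [hG, ae_restrict_mem measurableSet_Ioi] with x hx hx0
      have := mul_nonneg (hpos x hx0) hx
      simp only [Pi.zero_apply]
      linarith
    rw [integral_const_mul] at h3
    calc _ ≤ _ := h3
      _ ≤ 4 * R ^ 2 * ((1 + ε / 2) * (1 / R) ^ 2) := by gcongr; exact h4.trans h2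
      _ = 4 + 2 * ε := by field_simp; ring
      _ ≤ 6 := by linarith
  have hloc : ∀ R : ℝ, IntegrableOn (fun x => x ^ 2 * G x) (Ioc 0 R) := by
    intro R
    have hmn : IntegrableOn (fun x => ‖x * G x‖) (Ioi 0) := hmi.norm
    refine Integrable.mono' ((hmn.mono_set (Ioc_subset_Ioi_self (a := R) (b := 0))).const_mul |R|)
      ((Measurable.aestronglyMeasurable (by fun_prop)).mul
        ((MemLp_aesm (memLp_coe G)).mono_measure (Measure.restrict_mono Ioc_subset_Ioi_self le_rfl)))
      ?_
    filter_upwards [ae_restrict_mem measurableSet_Ioc] with x hx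
    have hx0 : 0 < x := hx.1
    rw [norm_mul, norm_mul, Real.norm_of_nonneg (sq_nonneg x), Real.norm_of_nonneg hx0.le]
    have : x ≤ |R| := hx.2.trans (le_abs_self R)
    calc x ^ 2 * ‖G x‖ = x * (x * ‖G x‖) := by ring
      _ ≤ _ := by gcongr
  have hint : IntegrableOn (fun x => x ^ 2 * G x) (Ioi 0) := by
    refine integrableOn_Ioi_of_intervalIntegral_norm_bounded 6 0 hloc Filter.tendsto_id ?_
    filter_upwards [Filter.eventually_gt_atTop 0] with R hR
    rw [intervalIntegral.integral_of_le hR.le]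
    refine le_trans (le_of_eq ?_) (hbound R hR)
    refine integral_congr_ae ?_
    filter_upwards [ae_restrict_of_ae_restrict_of_subset Ioc_subset_Ioi_self hG] with x hx
    exact Real.norm_of_nonneg (mul_nonneg (sq_nonneg x) hx)
  refine ⟨hint, ?_⟩
  have hlim : Filter.Tendsto (fun R : ℝ => ∫ x in (0 : ℝ)..R, x ^ 2 * G x) Filter.atTop _ :=
    intervalIntegral_tendsto_integral_Ioi 0 hint Filter.tendsto_id
  refine le_of_tendsto hlim ?_
  filter_upwards [Filter.eventually_gt_atTop 0] with R hR
  rw [intervalIntegral.integral_of_le hR.le]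
  exact hbound R hR

end

section

variable {k ε : ℝ} {W : ℝ → ℝ → ℝ}

/-! ### Every profile is close to the exponential -/

/-- For a stationary solution Duhamel's formula writes `G - S_t G` as an integral over a time `t`.
This equicontinuity under dilations supplies the Tauberian condition. -/
theorem norm_sub_dilL_le (hk : 1 ≤ k) {G g : L1 k} (h : CharSol k (fun _ => G) fun _ => g)
    {t : ℝ} (ht : 0 ≤ t) :
    ‖G - dilL (zero_le_one.trans hk) t G‖ ≤ ‖g‖ * t * Real.exp t := by
  have hk0 : 0 ≤ k := zero_le_one.trans hk
  have h1 := mild_of_charSol hk continuous_const h ht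
  have h2 : G - dilL hk0 t G = ∫ s in (0 : ℝ)..t, dilL hk0 (t - s) g := by
    rw [sub_eq_iff_eq_add']
    exact h1
  rw [h2]
  have h3 : ‖∫ s in (0 : ℝ)..t, dilL hk0 (t - s) g‖ ≤ Real.exp t * ‖g‖ * |t - 0| := by
    refine intervalIntegral.norm_integral_le_of_norm_le_const fun s hs => ?_
    rw [uIoc_of_le ht] at hs
    refine (norm_dilL_le hk0 (by linarith [hs.2]) g).trans ?_
    gcongr
    linarith [hs.1]
  rw [sub_zero, abs_of_nonneg ht] at h3
  linarith

theorem integral_abs_le_norm (hk : 0 ≤ k) (u : L1 k) : ∫ x in Ioi 0, |u x| ≤ ‖u‖ := by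
  have h := norm1_mono hk (memLp_coe u)
  rw [norm_eq_norm1]
  simpa only [norm1, Real.rpow_zero, mul_one] using h

theorem integral_abs_sub_dilate_le (hk : 0 ≤ k) (u : L1 k) {t : ℝ} (ht : 0 ≤ t) :
    ∫ x in Ioi 0, |u x - dilate t u x| ≤ ‖u - dilL hk t u‖ := by
  refine le_trans (le_of_eq ?_) (integral_abs_le_norm hk _)
  refine integral_congr_ae ?_
  filter_upwards [coeFn_sub' u (dilL hk t u), coeFn_dilL hk ht u] with x h1 h2
  rw [h1, h2]

/-- With `v = √u`, either `v ≤ δ⁻¹` and the constant dominates, or `δ v ≥ 1` and the square does. -/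
theorem rpow_three_half_le {u δ : ℝ} (hu : 0 < u) (hδ : 0 < δ) :
    u ^ (3 / 2 : ℝ) ≤ δ * u ^ (2 : ℝ) + (δ⁻¹) ^ 3 := by
  set v := Real.sqrt u with hv
  have hv0 : 0 < v := Real.sqrt_pos.2 hu
  have huv : u = v ^ 2 := (Real.sq_sqrt hu.le).symm
  have e1 : u ^ (3 / 2 : ℝ) = v ^ 3 := by
    rw [huv, ← Real.rpow_natCast v 2, ← Real.rpow_mul hv0.le, ← Real.rpow_natCast v 3]
    norm_num
  have e2 : u ^ (2 : ℝ) = v ^ 4 := by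
    rw [huv, Real.rpow_ofNat]
    ring
  rw [e1, e2]
  rcases le_total v δ⁻¹ with h | h
  · have : v ^ 3 ≤ (δ⁻¹) ^ 3 := pow_le_pow_left₀ hv0.le h 3
    have h2 : 0 ≤ δ * v ^ 4 := by positivity
    linarith
  · have h1 : 1 ≤ δ * v := by
      rw [inv_le_iff_one_le_mul₀ hδ] at h
      linarith
    have h2 : 0 ≤ (δ⁻¹) ^ 3 := by positivity
    have h3 : v ^ 3 * 1 ≤ v ^ 3 * (δ * v) := by gcongr
    linarith

theorem memLp_two_profile {G : L1 1} (hε : 0 ≤ ε) (hε1 : ε ≤ 1) (hW : Admissible W)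
    (hG : Nonneg G) (hm : massL 1 G = 1) (hs : IsStationary zero_le_one hε hW G) :
    MemLp G 1 (weightMeasure 2) ∧ norm1 2 G ≤ 9 := by
  have hi := integrableOn_of_memLp zero_le_one (memLp_coe G)
  have hmi : IntegrableOn (fun x => x * G x) (Ioi 0) := (isTest_id le_rfl).integrable (memLp_coe G)
  obtain ⟨hqi, hq⟩ := integrableOn_sq_mul_profile hε hε1 hW hG hm hs
  have h1 := integral_profile_le_one hε hW hG hm hs
  rw [massL_apply le_rfl, mass] at hm
  have hsum : IntegrableOn (fun x => G x + 2 * (x * G x) + x ^ 2 * G x) (Ioi 0) :=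
    (hi.add (hmi.const_mul 2)).add hqi
  have hae : (fun x => G x + 2 * (x * G x) + x ^ 2 * G x) =ᵐ[volume.restrict (Ioi 0)]
      fun x => |G x| * (1 + x) ^ (2 : ℝ) := by
    filter_upwards [hG] with x hx
    rw [abs_of_nonneg hx, Real.rpow_ofNat]
    ring
  refine ⟨memLp_iff_norm.2 ⟨MemLp_aesm (memLp_coe G), hsum.congr hae⟩, ?_⟩
  have hi2 : IntegrableOn (fun x => G x + 2 * (x * G x)) (Ioi 0) := hi.add (hmi.const_mul 2)
  rw [norm1, ← integral_congr_ae hae, integral_add hi2 hqi,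
    integral_add hi (hmi.const_mul 2), integral_const_mul, hm]
  linarith

theorem toL1_sub_expL {u : ℝ → ℝ} (hu : MemLp u 1 (weightMeasure k)) :
    ‖toL1 k u - expL k‖ = norm1 k fun x => u x - expFun x := by
  rw [norm_eq_norm1]
  refine norm1_congr ?_
  filter_upwards [coeFn_sub' (toL1 k u) (expL k), coeFn_toL1 hu,
    coeFn_toL1 (memLp_expFun k)] with x h1 h2 h3
  rw [h1, h2, expL, h3]

/-- The `L¹` distance is small by the Tauberian estimate away from the origin and the direct bound
near it; interpolation with the bounded norm in `L¹_2` lifts this to the exponent `3/2`. Here `B`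
bounds the distance in `L¹_2`, and `δ`, `σ` make both terms of the interpolation equal to `ρ / 2`.
-/
theorem exists_norm_profile_sub_le {ρ : ℝ} (hρ : 0 < ρ) :
    ∃ ε₀ : ℝ, 0 < ε₀ ∧ ∀ W : ℝ → ℝ → ℝ, ∀ hW : Admissible W, ∀ ε : ℝ, ∀ hε : 0 ≤ ε,
      ε ≤ ε₀ → ∀ G : L1 1, Nonneg G → massL 1 G = 1 → IsStationary zero_le_one hε hW G →
        MemLp G 1 (weightMeasure (3 / 2)) ∧ ‖toL1 (3 / 2) G - expL (3 / 2)‖ ≤ ρ := by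
  set B := 9 + ‖expL 2‖ with hB
  have hB0 : 0 < B := by positivity
  set δ := ρ / (2 * B) with hδ
  have hδ0 : 0 < δ := by positivity
  set σ := δ ^ 3 * (ρ / 2) with hσ
  have hσ0 : 0 < σ := by positivity
  set c := 18 + 3 * (‖expL 1‖ * ‖expL 1‖) with hc
  have hc0 : 0 ≤ c := by positivity
  obtain ⟨η, hη, hsmall⟩ := exists_integral_Ioi_le_of_transform hc0
    (by positivity : 0 < σ / 16) (half_pos hσ0)
  -- `σ / 12` is such that the part near the origin, `3 (σ / 16 + ε) + σ / 16`, is at most `σ / 2`.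
  refine ⟨min (min η 1) (σ / 12), by positivity, fun W hW ε hε hεε G hG hm hs => ?_⟩
  have hε1 : ε ≤ 1 := hεε.trans ((min_le_left _ _).trans (min_le_right _ _))
  have hεη : ε ≤ η := hεε.trans ((min_le_left _ _).trans (min_le_left _ _))
  have hεσ : ε ≤ σ / 12 := hεε.trans (min_le_right _ _)
  obtain ⟨hG2, hG2n⟩ := memLp_two_profile hε hε1 hW hG hm hs
  have hE2 := memLp_expFun 2
  have hk2 : (3 / 2 : ℝ) ≤ 2 := by norm_num
  have hG32 := memLp_mono hk2 hG2
  refine ⟨hG32, ?_⟩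
  rw [toL1_sub_expL hG32]
  have hh2 : MemLp (fun x => G x - expFun x) 1 (weightMeasure 2) := hG2.sub hE2
  have hh32 := memLp_mono hk2 hh2
  have hh0 := memLp_mono (zero_le_two : (0 : ℝ) ≤ 2) hh2
  set h : L1 1 := G - expL 1 with hh
  have hhe : (h : ℝ → ℝ) =ᵐ[volume.restrict (Ioi 0)] fun x => G x - expFun x := by
    filter_upwards [coeFn_sub' G (expL 1), coeFn_toL1 (memLp_expFun 1)] with x h1 h2
    rw [hh, h1, expL, h2]
  have hhi := integrableOn_of_memLp zero_le_one (memLp_coe h)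
  -- the tail
  have htail : ∫ x in Ioi (σ / 16), |h x| ≤ σ / 2 := by
    refine hsmall h (Lp.stronglyMeasurable h).measurable hhi (fun t ht => ?_) fun z hz => ?_
    · refine (integral_abs_sub_dilate_le zero_le_one h ht).trans ?_
      have h1 := norm_sub_dilL_le le_rfl hs ht
      have h2 := norm_sub_dilL_le le_rfl (charSol_expL le_rfl) ht
      have h3 : ‖coagB zero_le_one hε hW G G‖ ≤ 18 := by
        have h4 := norm_profile_le hε hW hG hm hs
        calc _ ≤ 9 / 2 * (‖G‖ * ‖G‖) := norm_coagB_le zero_le_one hε hε1 hW G G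
          _ ≤ 9 / 2 * (2 * 2) := by gcongr
          _ = 18 := by norm_num
      have h5 := norm_two_le zero_le_one (expL 1) (expL 1)
      have e : h - dilL zero_le_one t h =
          (G - dilL zero_le_one t G) - (expL 1 - dilL zero_le_one t (expL 1)) := by
        rw [hh, map_sub]
        abel
      rw [e]
      refine (norm_sub_le _ _).trans ((add_le_add h1 h2).trans ?_)
      rw [hc, add_mul, add_mul]
      gcongr
    · have h1 := abs_bern_sub_le hε hW hG hm hs hz
      rw [bern_apply zero_le_one hz.le] at h1
      refine h1.trans ?_
      gcongr
  -- the part near the origin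
  have hnear : ∫ x in Ioc 0 (σ / 16), |h x| ≤ 3 * (σ / 16 + ε) + σ / 16 := by
    have hGi := (integrableOn_of_memLp zero_le_one (memLp_coe G)).mono_set
      (Ioc_subset_Ioi_self (a := σ / 16) (b := 0))
    have hone : IntegrableOn (fun _ : ℝ => (1 : ℝ)) (Ioc 0 (σ / 16)) := by simp
    calc ∫ x in Ioc 0 (σ / 16), |h x| ≤ ∫ x in Ioc 0 (σ / 16), (G x + 1) := by
          refine integral_mono_of_nonneg (Filter.Eventually.of_forall fun x => abs_nonneg _)
            (hGi.add hone) ?_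
          filter_upwards [ae_restrict_of_ae_restrict_of_subset Ioc_subset_Ioi_self hG,
            ae_restrict_of_ae_restrict_of_subset Ioc_subset_Ioi_self hhe,
            ae_restrict_mem measurableSet_Ioc] with x h1 h2 h3
          simp only [h2]
          refine (abs_sub _ _).trans ?_
          have h4 : expFun x ≤ 1 := Real.exp_le_one_iff.2 (by linarith [h3.1])
          rw [abs_of_nonneg h1, expFun, Real.abs_exp]
          exact add_le_add le_rfl h4
      _ = (∫ x in Ioc 0 (σ / 16), G x) + σ / 16 := by
          rw [integral_add hGi hone, setIntegral_const,
            Real.volume_real_Ioc_of_le (by positivity), smul_eq_mul]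
          ring
      _ ≤ _ := by
          gcongr
          exact integral_Ioc_profile_le hε hW hG hm hs (by positivity)
  have htotal : ∫ x in Ioi 0, |h x| ≤ σ := by
    have hsplit : Ioi (0 : ℝ) = Ioc 0 (σ / 16) ∪ Ioi (σ / 16) :=
      (Ioc_union_Ioi_eq_Ioi (by positivity)).symm
    rw [hsplit, setIntegral_union (Ioc_disjoint_Ioi le_rfl) measurableSet_Ioi
      (hhi.abs.mono_measure (Measure.restrict_mono Ioc_subset_Ioi_self le_rfl))
      (hhi.abs.mono_measure (Measure.restrict_mono (Ioi_subset_Ioi (by positivity)) le_rfl))]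
    linarith
  have hn0 : norm1 0 (fun x => G x - expFun x) ≤ σ := by
    refine le_trans (le_of_eq ?_) htotal
    rw [norm1]
    refine integral_congr_ae ?_
    filter_upwards [hhe] with x hx
    rw [hx, Real.rpow_zero, mul_one]
  have hn2 : norm1 2 (fun x => G x - expFun x) ≤ B := by
    rw [← toL1_sub_expL hG2]
    refine (norm_sub_le _ _).trans ?_
    rw [norm_toL1 hG2]
    linarith
  -- interpolation
  have hi2 := (memLp_iff_norm.1 hh2).2
  have hi0 := (memLp_iff_norm.1 hh0).2
  have hint : norm1 (3 / 2) (fun x => G x - expFun x) ≤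
      δ * norm1 2 (fun x => G x - expFun x) + (δ⁻¹) ^ 3 * norm1 0 (fun x => G x - expFun x) := by
    rw [norm1, norm1, norm1, ← integral_const_mul, ← integral_const_mul,
      ← integral_add (hi2.const_mul δ) (hi0.const_mul _)]
    refine setIntegral_mono_on (memLp_iff_norm.1 hh32).2
      ((hi2.const_mul δ).add (hi0.const_mul _)) measurableSet_Ioi fun x hx => ?_
    have hx : 0 < x := hx
    have h1 := rpow_three_half_le (by positivity : 0 < 1 + x) hδ0
    rw [Real.rpow_zero]
    calc _ ≤ |G x - expFun x| * (δ * (1 + x) ^ (2 : ℝ) + (δ⁻¹) ^ 3) := by gcongr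
      _ = _ := by ring
  calc _ ≤ _ := hint
    _ ≤ δ * B + (δ⁻¹) ^ 3 * σ := by gcongr
    _ = ρ := by
      rw [hσ, ← mul_assoc, ← mul_pow, inv_mul_cancel₀ hδ0.ne', hδ]
      field_simp
      norm_num

end

section

variable {k ε : ℝ} {W : ℝ → ℝ → ℝ}

/-! ### Mild solutions and solutions along characteristics -/

theorem coagL1_kernel (hk : 0 ≤ k) (hε : 0 ≤ ε) (hW : Admissible W) (u : L1 k) :
    coagL1 k (kernel ε W) u = coagB hk hε hW u u := coagL1_eq hk _ u

theorem integral_dilateL1_eq (hk : 0 ≤ k) {t : ℝ} (ht : 0 ≤ t) (g : ℝ → L1 k) :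
    ∫ s in (0 : ℝ)..t, dilateL1 k (t - s) (g s) = ∫ s in (0 : ℝ)..t, dilL hk (t - s) (g s) := by
  refine intervalIntegral.integral_congr fun s hs => ?_
  rw [uIcc_of_le ht] at hs
  exact (dilL_apply hk (by linarith [hs.2]) (g s)).symm

theorem isMildSolution_const_iff (hk : 1 ≤ k) (hε : 0 ≤ ε) (hW : Admissible W) (G : L1 k) :
    IsMildSolution k (kernel ε W) G (fun _ => G) ↔
      IsStationary (zero_le_one.trans hk) hε hW G := by
  have hk0 : 0 ≤ k := zero_le_one.trans hk
  constructor
  · intro h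
    refine charSol_of_mild hk continuous_const fun t ht => ?_
    have := h.duhamel t ht
    rwa [integral_dilateL1_eq hk0 ht (fun _ => coagL1 k (kernel ε W) G),
      coagL1_kernel hk0 hε hW, ← dilL_apply hk0 ht] at this
  · intro h
    refine ⟨continuousOn_const, fun t ht => ?_⟩
    rw [integral_dilateL1_eq hk0 ht (fun _ => coagL1 k (kernel ε W) G),
      coagL1_kernel hk0 hε hW, ← dilL_apply hk0 ht]
    exact mild_of_charSol hk continuous_const h ht

theorem isUnitProfile_iff (hε : 0 ≤ ε) (hW : Admissible W) (G : L1 1) :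
    IsUnitProfile (kernel ε W) G ↔
      Nonneg G ∧ massL 1 G = 1 ∧ IsStationary zero_le_one hε hW G := by
  rw [← isMildSolution_const_iff le_rfl hε hW, massL_apply le_rfl]
  exact ⟨fun h => ⟨h.nonneg, h.mass_eq_one, h.stationary⟩, fun h => ⟨h.1, h.2.1, h.2.2⟩⟩

/-! ### Changing the weight -/

section Transfer

variable {j : ℝ} {u : L1 j}

theorem bern_toL1 (hj : 0 ≤ j) (hk : 0 ≤ k) (hu : MemLp u 1 (weightMeasure k)) {z : ℝ}
    (hz : 0 ≤ z) : bern k z (toL1 k u) = bern j z u := by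
  rw [bern, pairing_toL1 (isTest_bernFun hk hz) hu, bern_apply hj hz]

theorem massL_toL1 (hj : 1 ≤ j) (hk : 1 ≤ k) (hu : MemLp u 1 (weightMeasure k)) :
    massL k (toL1 k u) = massL j u := by
  rw [massL, pairing_toL1 (isTest_id hk) hu, massL_apply hj, mass]

theorem bern_coagB_eq (hk : 0 ≤ k) (hε : 0 ≤ ε) (hW : Admissible W) (u : L1 k) {z : ℝ}
    (hz : 0 ≤ z) : bern k z (coagB hk hε hW u u) = -(1 / 2) * ∫ p, kernel ε W p.1 p.2 *
      ((bernFun z p.1 * u p.1) * (bernFun z p.2 * u p.2)) ∂quadrant := by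
  have := bern_bilL_symm hk (isKernel_kernel hε hW) (kernel_symm hW ε) u u hz
  rw [map_add] at this
  rw [coagB]
  linarith

theorem bern_coagB_toL1 (hj : 0 ≤ j) (hk : 0 ≤ k) (hε : 0 ≤ ε) (hW : Admissible W)
    (hu : MemLp u 1 (weightMeasure k)) {z : ℝ} (hz : 0 ≤ z) :
    bern k z (coagB hk hε hW (toL1 k u) (toL1 k u)) = bern j z (coagB hj hε hW u u) := by
  rw [bern_coagB_eq hk hε hW _ hz, bern_coagB_eq hj hε hW _ hz]
  congr 1
  have h := coeFn_toL1 hu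
  refine integral_congr_ae ?_
  filter_upwards [Measure.quasiMeasurePreserving_fst.ae h,
    Measure.quasiMeasurePreserving_snd.ae h] with p h1 h2
  rw [h1, h2]

/-- Stationarity is an identity between transforms, which do not see the weight. -/
theorem IsStationary.toL1 (hj : 1 ≤ j) (hk : 1 ≤ k) (hε : 0 ≤ ε) (hW : Admissible W)
    (hu : MemLp u 1 (weightMeasure k)) (h : IsStationary (zero_le_one.trans hj) hε hW u) :
    IsStationary (zero_le_one.trans hk) hε hW (toL1 k u) := by
  have hj0 : 0 ≤ j := zero_le_one.trans hj
  have hk0 : 0 ≤ k := zero_le_one.trans hk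
  intro ζ hζ t ht
  rw [bern_toL1 hj0 hk0 hu (by positivity), bern_toL1 hj0 hk0 hu hζ.le, h ζ hζ t ht]
  congr 1
  refine intervalIntegral.integral_congr fun s _ => ?_
  simp only []
  rw [bern_coagB_toL1 hj0 hk0 hε hW hu (by positivity)]

theorem nonneg_toL1 (hu : MemLp u 1 (weightMeasure k)) (h : Nonneg u) : Nonneg (toL1 k u) := by
  filter_upwards [h, coeFn_toL1 hu] with x h1 h2
  rwa [h2]

end Transfer

theorem isUnitProfile_toL1 (hk : 1 ≤ k) (hε : 0 ≤ ε) (hW : Admissible W) {G : L1 k}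
    (hG : Nonneg G) (hm : massL k G = 1) (hs : IsStationary (zero_le_one.trans hk) hε hW G) :
    IsUnitProfile (kernel ε W) (toL1 1 G) := by
  have h1 := memLp_mono hk (memLp_coe G)
  exact (isUnitProfile_iff hε hW _).2 ⟨nonneg_toL1 h1 hG, by rw [massL_toL1 hk le_rfl h1, hm],
    hs.toL1 hk le_rfl hε hW h1⟩

/-- The argument runs in `L¹_{3/2}`: the exponent exceeds `1`, which leaves a gap for the linearised
semigroup, and is below `2`, so that interpolation with the a priori second moment of a profile is
possible. Profiles in `L¹_1` therefore belong to this space and lie in the region of local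
uniqueness. -/
theorem exists_existsUnique_profile : ∃ ε₁ : ℝ, 0 < ε₁ ∧ ∀ W : ℝ → ℝ → ℝ, Admissible W →
    ∀ ε : ℝ, 0 ≤ ε → ε ≤ ε₁ → ∃! G : L1 1, IsUnitProfile (kernel ε W) G := by
  have hk0 : (0 : ℝ) ≤ 3 / 2 := by norm_num
  have hk1 : (1 : ℝ) ≤ 3 / 2 := by norm_num
  obtain ⟨ρ, εu, hρ, hεu, huniq⟩ := exists_stationary_unique le_rfl hk0
  obtain ⟨εc, hεc, hclose⟩ := exists_norm_profile_sub_le hρ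
  obtain ⟨εe, hεe, hexist⟩ := exists_stationary le_rfl hk0 hρ
  refine ⟨min (min εu εc) εe, by positivity, fun W hW ε hε hεε => ?_⟩
  have h1 : ε ≤ εu := hεε.trans ((min_le_left _ _).trans (min_le_left _ _))
  have h2 : ε ≤ εc := hεε.trans ((min_le_left _ _).trans (min_le_right _ _))
  have h3 : ε ≤ εe := hεε.trans (min_le_right _ _)
  obtain ⟨G, hG, hGs⟩ := hexist W hW ε hε h3
  have hprof := isUnitProfile_toL1 hk1 hε hW hG.1 hG.2.1 hGs
  refine ⟨toL1 1 G, hprof, fun G' hG' => ?_⟩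
  have key : ∀ H : L1 1, IsUnitProfile (kernel ε W) H → MemLp H 1 (weightMeasure (3 / 2)) ∧
      massL (3 / 2) (toL1 (3 / 2) H) = 1 ∧ ‖toL1 (3 / 2) H - expL (3 / 2)‖ ≤ ρ ∧
      IsStationary hk0 hε hW (toL1 (3 / 2) H) := by
    intro H hH
    obtain ⟨hH1, hH2, hH3⟩ := (isUnitProfile_iff hε hW H).1 hH
    obtain ⟨h4, h5⟩ := hclose W hW ε hε h2 H hH1 hH2 hH3
    exact ⟨h4, by rw [massL_toL1 le_rfl hk1 h4, hH2], h5, hH3.toL1 le_rfl hk1 hε hW h4⟩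
  obtain ⟨a1, a2, a3, a4⟩ := key G' hG'
  obtain ⟨b1, b2, b3, b4⟩ := key _ hprof
  have heq := huniq W hW ε hε h1 _ _ a2 b2 a3 b3 a4 b4
  refine L1_ext ?_
  have e1 := coeFn_toL1 a1
  rw [heq] at e1
  exact e1.symm.trans (coeFn_toL1 b1)

/-! ### Stability -/

/-- At the first time when `m` reaches `K`, continuity gives `m ≤ K` up to that time, and the
hypothesis then gives a strict inequality there. -/
theorem lt_of_bootstrap {m : ℝ → ℝ} (hm : Continuous m) {K : ℝ} (h0 : m 0 < K)
    (h : ∀ t, 0 < t → (∀ s ∈ Icc 0 t, m s ≤ K) → m t < K) {t : ℝ} (ht : 0 ≤ t) : m t < K := by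
  by_contra! hcon
  set S := Ici (0 : ℝ) ∩ m ⁻¹' Ici K with hS
  have hSc : IsClosed S := isClosed_Ici.inter (isClosed_Ici.preimage hm)
  have hbdd : BddBelow S := ⟨0, fun s hs => hs.1⟩
  have hmem := hSc.csInf_mem ⟨t, ht, hcon⟩ hbdd
  set τ := sInf S with hτ
  have hτ0 : 0 < τ := by
    refine lt_of_le_of_ne hmem.1 fun he => ?_
    have h1 : K ≤ m τ := hmem.2
    rw [← he] at h1
    linarith
  have hlt : ∀ s, 0 ≤ s → s < τ → m s ≤ K := fun s hs0 hs => by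
    by_contra! hc
    exact absurd (csInf_le hbdd ⟨hs0, hc.le⟩) (not_le.2 hs)
  have hτK : m τ ≤ K := by
    refine le_of_tendsto (hm.continuousAt.tendsto.mono_left nhdsWithin_le_nhds :
      Filter.Tendsto m (nhdsWithin τ (Iio τ)) (nhds (m τ))) ?_
    filter_upwards [Ico_mem_nhdsLT hτ0] with s hs using hlt s hs.1 hs.2
  have := h τ hτ0 fun s hs => by
    rcases hs.2.lt_or_eq with h1 | h1
    · exact hlt s hs.1 h1
    · rwa [h1]
  exact absurd hmem.2 (not_le.2 this)

/-- Decay for a small nonlinear perturbation of the linearised equation. -/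
theorem norm_lt_of_small_perturbation (hk0 : 0 ≤ k) {C κ K : ℝ} (hC : 1 ≤ C) (hκ : 0 ≤ κ)
    (hdecay : DecaysWith hk0 1 C) (hCκ : C * κ ≤ 1 / 4) {h r : ℝ → L1 k} (hh : Continuous h)
    (hvar : ∀ t, 0 ≤ t → h t = linT hk0 t (h 0) + ∫ s in (0 : ℝ)..t, linT hk0 (t - s) (r s))
    (hm : massL k (h 0) = 0) (hmr : ∀ s, massL k (r s) = 0)
    (hr : ∀ s, 0 ≤ s → ‖h s‖ ≤ K → ‖r s‖ ≤ κ * ‖h s‖) (hK : 2 * C * ‖h 0‖ < K) {t : ℝ}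
    (ht : 0 ≤ t) : Real.exp (1 / 2 * t) * ‖h t‖ < K := by
  have hK0 : 0 ≤ K := le_trans (by positivity) hK.le
  have hn0 := norm_nonneg (h 0)
  -- Linear decay at rate `1` is traded for rate `1/2`. Under the bound `e^{s/2} ‖h s‖ ≤ K` the
  -- Duhamel integral contributes at most `2 C κ K ≤ K / 2`, because `∫₀^t e^{-(t-s)} e^{-s/2} ds ≤
  -- 2 e^{-t/2}`; the initial value contributes less than `K / 2`.
  refine lt_of_bootstrap (m := fun t => Real.exp (1 / 2 * t) * ‖h t‖) (by fun_prop) ?_ ?_ ht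
  · simp only [mul_zero, Real.exp_zero, one_mul]
    nlinarith
  · intro t ht hle
    have hnorm : ∀ s ∈ Icc 0 t, ‖h s‖ ≤ Real.exp (-(1 / 2 * s)) * K := fun s hs => by
      rw [Real.exp_neg, ← div_eq_inv_mul, le_div_iff₀' (Real.exp_pos _)]
      exact hle s hs
    have h1 : ‖∫ s in (0 : ℝ)..t, linT hk0 (t - s) (r s)‖ ≤
        ∫ s in (0 : ℝ)..t, C * κ * K * Real.exp (-t) * Real.exp (1 / 2 * s) := by
      refine intervalIntegral.norm_integral_le_of_norm_le ht.le ?_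
        (Continuous.intervalIntegrable (by fun_prop) _ _)
      refine Filter.Eventually.of_forall fun s hs => ?_
      have hs' : s ∈ Icc 0 t := ⟨hs.1.le, hs.2⟩
      have h2 := hnorm s hs'
      have h3 : ‖h s‖ ≤ K := h2.trans (mul_le_of_le_one_left hK0
        (Real.exp_le_one_iff.2 (by linarith [hs.1])))
      have h4 := hr s hs.1.le h3
      calc _ ≤ C * Real.exp (-(1 * (t - s))) * ‖r s‖ := hdecay _ (by linarith [hs.2]) _ (hmr s)
        _ ≤ C * Real.exp (-(1 * (t - s))) * (κ * (Real.exp (-(1 / 2 * s)) * K)) := by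
            gcongr
            exact h4.trans (by gcongr)
        _ = C * κ * K * (Real.exp (-(1 * (t - s))) * Real.exp (-(1 / 2 * s))) := by ring
        _ = C * κ * K * (Real.exp (-t) * Real.exp (1 / 2 * s)) := by
            rw [← Real.exp_add, ← Real.exp_add]
            ring_nf
        _ = _ := by ring
    rw [intervalIntegral.integral_const_mul, intervalIntegral.integral_comp_mul_left
      (fun s => Real.exp s) (by norm_num), integral_exp, mul_zero, Real.exp_zero,
      smul_eq_mul] at h1
    have h5 : ‖linT hk0 t (h 0)‖ ≤ C * Real.exp (-t) * ‖h 0‖ := by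
      have := hdecay t ht.le (h 0) hm
      rwa [one_mul] at this
    have h6 : ‖h t‖ ≤ C * Real.exp (-t) * ‖h 0‖ +
        C * κ * K * Real.exp (-t) * (2 * Real.exp (1 / 2 * t)) := by
      rw [hvar t ht.le]
      refine (norm_add_le _ _).trans (add_le_add h5 (h1.trans ?_))
      have h7 : (1 / 2 : ℝ)⁻¹ * (Real.exp (1 / 2 * t) - 1) ≤ 2 * Real.exp (1 / 2 * t) := by
        norm_num
      gcongr
    have e1 : Real.exp (1 / 2 * t) * Real.exp (-t) ≤ 1 := by
      rw [← Real.exp_add]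
      exact Real.exp_le_one_iff.2 (by linarith)
    have e2 : Real.exp (1 / 2 * t) * Real.exp (-t) * Real.exp (1 / 2 * t) = 1 := by
      rw [← Real.exp_add, ← Real.exp_add]
      ring_nf
      simp
    calc Real.exp (1 / 2 * t) * ‖h t‖ ≤ Real.exp (1 / 2 * t) * (C * Real.exp (-t) * ‖h 0‖ +
          C * κ * K * Real.exp (-t) * (2 * Real.exp (1 / 2 * t))) := by gcongr
      _ = (Real.exp (1 / 2 * t) * Real.exp (-t)) * (C * ‖h 0‖) + 2 * (C * κ) * K *
          (Real.exp (1 / 2 * t) * Real.exp (-t) * Real.exp (1 / 2 * t)) := by ring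
      _ ≤ 1 * (C * ‖h 0‖) + 2 * (1 / 4) * K * 1 := by
          rw [e2]
          gcongr
      _ < K := by linarith

/-- Nonlinear stability of a stationary solution close to the exponential. -/
theorem norm_sub_stationary_le (hk : 1 ≤ k) (hε : 0 ≤ ε) (hW : Admissible W) {C ρ : ℝ}
    (hC : 1 ≤ C) (hdecay : DecaysWith (zero_le_one.trans hk) 1 C)
    (hsmall : C * (6 * ρ + 3 * ε * (‖expL k‖ + ρ)) ≤ 1 / 4) (hρ : 0 < ρ)
    {G f₀ : L1 k} {f : ℝ → L1 k} (hG : IsStationary (zero_le_one.trans hk) hε hW G)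
    (hGm : massL k G = 1) (hGE : ‖G - expL k‖ ≤ ρ / 2) (hf : IsMildSolution k (kernel ε W) f₀ f)
    (hfm : massL k f₀ = 1) (hf₀ : ‖f₀ - G‖ ≤ ρ / (8 * C)) {t : ℝ} (ht : 0 ≤ t) :
    ‖f t - G‖ ≤ 2 * C * Real.exp (-(1 / 2 * t)) * ‖f₀ - G‖ := by
  have hk0 : 0 ≤ k := zero_le_one.trans hk
  -- Only nonnegative times matter; the constant extension makes the solution continuous on `ℝ`.
  set u : ℝ → L1 k := fun s => f (max s 0) with hu
  have hus : ∀ s, 0 ≤ s → u s = f s := fun s hs => by rw [hu]; simp only [max_eq_left hs]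
  have huc : Continuous u :=
    hf.continuousOn.comp_continuous (by fun_prop) fun s => le_max_right s 0
  have hf0 : f 0 = f₀ := by
    have := hf.duhamel 0 le_rfl
    rwa [intervalIntegral.integral_same, add_zero, ← dilL_apply hk0 le_rfl,
      dilL_of_nonpos hk0 le_rfl] at this
  have hu0 : u 0 = f₀ := by rw [hus 0 le_rfl, hf0]
  have hgc : Continuous fun s => coagB hk0 hε hW (u s) (u s) := by fun_prop
  have hchar : CharSol k u fun s => coagB hk0 hε hW (u s) (u s) := by
    refine charSol_of_mild hk hgc fun t ht => ?_
    rw [hus t ht, hu0, dilL_apply hk0 ht, hf.duhamel t ht, integral_dilateL1_eq hk0 ht]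
    congr 1
    refine intervalIntegral.integral_congr fun s hs => ?_
    rw [uIcc_of_le ht] at hs
    rw [hus s hs.1, coagL1_kernel hk0 hε hW]
  set h : ℝ → L1 k := fun s => u s - G with hh
  set r : ℝ → L1 k := fun s => coagB hk0 hε hW (u s) (u s) - coagB hk0 hε hW G G -
    linB hk0 (expL k) (h s) with hr
  have hhc : Continuous h := huc.sub continuous_const
  have hrc : Continuous r :=
    (hgc.sub continuous_const).sub ((linB hk0 (expL k)).continuous.comp hhc)
  have hchar' : CharSol k h fun s => linB hk0 (expL k) (h s) + r s := by
    have := CharSol.sub hk hgc continuous_const hchar hG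
    simpa only [hr, add_sub_cancel] using this
  have hh0 : h 0 = f₀ - G := by rw [hh]; simp only [hu0]
  have hN := norm_nonneg (expL k)
  have hκ : 0 ≤ 6 * ρ + 3 * ε * (‖expL k‖ + ρ) := by positivity
  -- `K ≤ ρ / 2` keeps the solution within `ρ` of the exponential, as `G` is within `ρ / 2`. The
  -- strict lower bound includes the case `f₀ = G`; the sharp constant `2 C ‖f₀ - G‖` is recovered
  -- by letting `K` decrease to it.
  have key : ∀ K, 2 * C * ‖f₀ - G‖ < K → K ≤ ρ / 2 → Real.exp (1 / 2 * t) * ‖h t‖ < K := by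
    intro K hK hKρ
    refine norm_lt_of_small_perturbation hk0 hC hκ hdecay hsmall hhc
      (fun t ht => eq_linT_of_charSol hk hhc hrc hchar' ht) ?_ ?_ ?_ (by rwa [hh0]) ht
    · rw [hh0]
      exact massL_sub_eq_zero hfm hGm
    · intro s
      simp only [hr]
      rw [map_sub, map_sub, massL_coagB_self hk, massL_coagB_self hk, massL_linB hk]
      simp
    · intro s _ hs
      refine norm_coagB_sub_le hk0 hε hW ?_ (by linarith)
      have := norm_add_le (u s - G) (G - expL k)
      rw [sub_add_sub_cancel] at this
      exact this.trans (by linarith [hs])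
  have hle : Real.exp (1 / 2 * t) * ‖h t‖ ≤ 2 * C * ‖f₀ - G‖ := by
    have hlt : 2 * C * ‖f₀ - G‖ < ρ / 2 := by
      have h1 : 2 * C * ‖f₀ - G‖ ≤ 2 * C * (ρ / (8 * C)) := by gcongr
      have h2 : 2 * C * (ρ / (8 * C)) = ρ / 4 := by
        have : C ≠ 0 := by positivity
        field_simp
        norm_num
      linarith
    refine le_of_forall_gt_imp_ge_of_dense fun K hK => ?_
    rcases le_total K (ρ / 2) with h1 | h1
    · exact (key K hK h1).le
    · exact (key _ hlt le_rfl).le.trans h1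
  have e : ‖h t‖ = Real.exp (-(1 / 2 * t)) * (Real.exp (1 / 2 * t) * ‖h t‖) := by
    rw [← mul_assoc, ← Real.exp_add, neg_add_cancel, Real.exp_zero, one_mul]
  have hht : h t = f t - G := by rw [hh]; simp only [hus t ht]
  rw [← hht, e]
  calc _ ≤ Real.exp (-(1 / 2 * t)) * (2 * C * ‖f₀ - G‖) := by gcongr
    _ = _ := by ring

end

end

end Smoluchowski

/-! ### Conclusion: existence, uniqueness and stability combined -/

open Smoluchowski in
theorem proposition8p1 :
    ∃ ε₁ : ℝ, 0 < ε₁ ∧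
      (∀ W : ℝ → ℝ → ℝ, Smoluchowski.Admissible W → ∀ ε : ℝ, 0 ≤ ε → ε ≤ ε₁ →
        ∃! G : Smoluchowski.L1 1, Smoluchowski.IsUnitProfile (Smoluchowski.kernel ε W) G) ∧
      ∀ k : ℝ, 2 < k →
        ∃ C M ε₂ r₁ : ℝ, 0 < C ∧ 0 < M ∧ 0 < ε₂ ∧ ε₂ < ε₁ ∧ 0 < r₁ ∧
          ∀ W : ℝ → ℝ → ℝ, Smoluchowski.Admissible W →
          ∀ ε : ℝ, 0 ≤ ε → ε ≤ ε₂ →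
          ∀ G : Smoluchowski.L1 1, Smoluchowski.IsUnitProfile (Smoluchowski.kernel ε W) G →
            MemLp G 1 (Smoluchowski.weightMeasure k) ∧
            ∀ (f₀ : Smoluchowski.L1 k) (f : ℝ → Smoluchowski.L1 k),
              Smoluchowski.IsMildSolution k (Smoluchowski.kernel ε W) f₀ f →
              Smoluchowski.mass f₀ = 1 →
              Smoluchowski.norm1 k (fun x => f₀ x - G x) ≤ r₁ →
              ∀ t : ℝ, 0 ≤ t →
                Smoluchowski.norm1 k (fun x => f t x - G x) ≤
                  C * Real.exp (-(1 / 2 - M * ε) * t) *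
                    Smoluchowski.norm1 k (fun x => f₀ x - G x) := by
  obtain ⟨ε₁, hε₁, huniq⟩ := exists_existsUnique_profile
  refine ⟨ε₁, hε₁, huniq, fun k hk => ?_⟩
  have hk0 : 0 ≤ k := by linarith
  have hk1 : 1 ≤ k := by linarith
  -- `k > 2` allows `p = 2`, hence linear decay at rate `1`.
  obtain ⟨C, hC, hdec⟩ := exists_norm_linT_le hk1 one_le_two le_rfl hk.le
  have hdecay : DecaysWith hk0 1 C := fun t ht u hu => by
    have := hdec t ht u hu
    norm_num at this ⊢
    exact this
  set N := ‖expL k‖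
  have hN : 0 ≤ N := norm_nonneg _
  set ρ := 1 / (4 * (C * (9 + 3 * N))) with hρ
  have hρ0 : 0 < ρ := by positivity
  have hρ1 : ρ ≤ 1 := by
    rw [hρ, div_le_one (by positivity)]
    nlinarith [mul_nonneg (zero_le_one.trans hC) hN]
  obtain ⟨εe, hεe, hexist⟩ := exists_stationary (by linarith) hk0 (half_pos hρ0)
  -- The rate obtained is `1/2` for all these `ε`, so any positive `M` would do. The entry `ε₁ / 2`
  -- makes the bound on `ε` strictly smaller than `ε₁`.
  refine ⟨2 * C, 1, min (min ρ εe) (ε₁ / 2), ρ / (8 * C), by positivity, one_pos, by positivity,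
    (min_le_right _ _).trans_lt (half_lt_self hε₁), by positivity, fun W hW ε hε hεε G hG => ?_⟩
  have h1 : ε ≤ ρ := hεε.trans ((min_le_left _ _).trans (min_le_left _ _))
  have h2 : ε ≤ εe := hεε.trans ((min_le_left _ _).trans (min_le_right _ _))
  have h3 : ε ≤ ε₁ := hεε.trans ((min_le_right _ _).trans (half_le_self hε₁.le))
  obtain ⟨H, hH, hHs⟩ := hexist W hW ε hε h2
  -- The existence argument in `L¹_k` produces a profile `H` there; uniqueness in `L¹_1` identifies
  -- it with `G`, which gives both the integrability of `G` and its closeness to the exponential.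
  have hGH : G = toL1 1 H :=
    (huniq W hW ε hε h3).unique hG (isUnitProfile_toL1 hk1 hε hW hH.1 hH.2.1 hHs)
  have hae : (G : ℝ → ℝ) =ᵐ[volume.restrict (Ioi 0)] H := by
    rw [hGH]
    exact coeFn_toL1 (memLp_mono hk1 (memLp_coe H))
  refine ⟨(memLp_coe H).ae_eq (ae_weightMeasure_iff.2 hae.symm),
    fun f₀ f hf hfm hf₀ t ht => ?_⟩
  have hnorm : ∀ u : L1 k, norm1 k (fun x => u x - G x) = ‖u - H‖ := fun u => by
    rw [norm_eq_norm1]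
    refine norm1_congr ?_
    filter_upwards [hae, coeFn_sub' u H] with x e1 e2
    rw [e1, e2]
  rw [hnorm] at hf₀
  rw [hnorm, hnorm]
  have hsmall : C * (6 * ρ + 3 * ε * (N + ρ)) ≤ 1 / 4 := by
    calc _ ≤ C * (6 * ρ + 3 * ρ * (N + 1)) := by gcongr
      _ = (C * (9 + 3 * N)) * ρ := by ring
      _ = 1 / 4 := by rw [hρ]; field_simp
  refine (norm_sub_stationary_le hk1 hε hW hC hdecay hsmall hρ0 hHs hH.2.1 hH.2.2 hf
    (by rw [massL_apply hk1, hfm]) hf₀ ht).trans ?_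
  gcongr
  nlinarith [mul_nonneg hε ht]
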